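/- Let $U\subseteq\mathbb R^3$ be a non-empty open set with coordinates $x^\mu$. A configuration on $U$ is a pair of smooth fields: a vielbein $e_\mu{}^i$ with $e=\det e_\mu{}^i\neq0$ (inverse $e^\mu{}_i$) and an $SO(3)$ connection $\omega_\mu{}^{ij}=-\omega_\mu{}^{ji}$. Its torsion and curvature are $$T_{\mu\nu}{}^i=\partial_\mu e_\nu{}^i-e_\mu{}^j\omega_{\nu j}{}^i-(\mu\leftrightarrow\nu),\qquad R_{\mu\nu j}{}^i=\partial_\mu\omega_{\nu j}{}^i-\omega_{\mu j}{}^k\omega_{\nu k}{}^i-(\mu\leftrightarrow\nu).$$ Greek indices are converted to Latin ones with the vielbein, and Latin indices are raised and lowered with $\delta_{ij}$. Put $T_j=T_{ij}{}^i$, $R_{ik}=R_{ijk}{}^j$, $R=R_i{}^i$, $R^A{}_{ij}=\frac12(R_{ij}-R_{ji})$. A tensor $t_{ijk}=-t_{jik}$ has the irreducible components $t_j=t_{ij}{}^i$, $t^*=\frac16t_{ijk}\varepsilon^{ijk}$ and $w_{ijk}=t_{ijk}-t^*\varepsilon_{ijk}-\frac12(\delta_{ik}t_j-\delta_{jk}t_i)$;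 for the torsion they are written $T_j$, $T^*$, $W_{ijk}$. Let $\nabla_kR_{ij}$ be the covariant derivative with respect to $\omega$, and let $C_{ijk}$ be the $w$-component of $\nabla_iR_{jk}-\nabla_jR_{ik}$ (for $T=0$, this is the Cotton tensor). A tilde marks the quantities of the Levi-Civita connection of $g_{\mu\nu}=e_\mu{}^ie_\nu{}^i$, with $\widetilde R_{\mu\nu\rho}{}^\sigma=\partial_\mu\widetilde\Gamma_{\nu\rho}{}^\sigma-\widetilde\Gamma_{\mu\rho}{}^\lambda\widetilde\Gamma_{\nu\lambda}{}^\sigma-(\mu\leftrightarrow\nu)$, $\widetilde R_{\mu\nu}=\widetilde R_{\mu\rho\nu}{}^\rho$, $\widetilde R=g^{\mu\nu}\widetilde R_{\mu\nu}$. For real constants $\kappa,\beta_1,\beta_2,\beta_3,\gamma_1,\gamma_2,\gamma_3,\Lambda$ consider the Lagrangian $$\frac1eL=-\kappa R+\tfrac14T_{ijk}(\beta_1T^{ijk}+\beta_2T^{kij}+\beta_3T^j\delta^{ik})+\tfrac14R_{ijkl}(\gamma_1R^{ijkl}+\gamma_2R^{klij}+\gamma_3R^{ik}\delta^{jl})-\Lambda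 .$$ The equilibrium equations are its Euler–Lagrange equations: the vielbein equation $\delta L/\delta e_\mu{}^i=0$ and the connection equation $\delta L/\delta\omega_\mu{}^{ij}=0$ on $U$. Consider the following requirements. 1. (Pure dislocations of general type.) There is a configuration on $U$ that satisfies both equilibrium equations, with $R_{\mu\nu}{}^{ij}=0$, such that none of $T_j$, $T^*$, $W_{ijk}$ vanishes identically on $U$. 2. (Pure disclinations of general type.) There is a configuration on $U$ that satisfies the connection equation, with $T_{\mu\nu}{}^i=0$, such that neither $\partial_\mu R$ nor $C_{ijk}$ vanishes identically on $U$. 3. (No defects.) There is a configuration on $U$ that satisfies both equilibrium equations, with $R_{\mu\nu}{}^{ij}=0$ and $T_{\mu\nu}{}^i=0$. Then: (a) Requirement 1 implies $\beta_1=-\kappa$, $\beta_2=2\kappa$, $\beta_3=4\kappa$. Requirement 2 (a fortiori the same requirement with both equilibrium equations) implies $\gamma_1=-\gamma_2=:\gamma$ and $\gamma_3=0$. Requirement 3 implies $\Lambda=0$. Conversely, if all these relations hold, with $\kappa$ and $\gamma$ arbitrary, then the three requirements are met. So they reduce the eight parameters to exactly two. (b) If all the relations in (a) hold, then for every configuration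 on $U$ $$L=e\bigl(-\kappa\widetilde R+2\gamma R^A{}_{ij}R^{Aij}\bigr)-2\kappa\,\partial_\mu(eT^\mu),$$ that is, up to a total divergence the free energy density is $\frac1eL=-\kappa\widetilde R+2\gamma R^A{}_{ij}R^{Aij}$. (c) If $\beta_1=-\kappa$, $\beta_2=2\kappa$, $\beta_3=4\kappa$, then every configuration on $U$ with $R_{\mu\nu}{}^{ij}=0$ satisfies the connection equation, and for it the vielbein equation is equivalent to the Einstein equations $$\kappa\bigl(\widetilde R_{\mu\nu}-\tfrac12g_{\mu\nu}\widetilde R\bigr)-\tfrac\Lambda2g_{\mu\nu}=0$$ (with $\Lambda=0$ once requirement 3 is imposed). If $\gamma_1=-\gamma_2$ and $\gamma_3=0$, the same two assertions hold for every configuration on $U$ with $T_{\mu\nu}{}^i=0$. -/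

import Mathlib

noncomputable section

namespace RiemannCartan

/-- Points of the medium, given by coordinates `x^μ`. -/
abbrev Pt := Fin 3 → ℝ

/-- Values of a vielbein: `e μ i` is `e_μ^i`. -/
abbrev Vielbein := Fin 3 → Fin 3 → ℝ

/-- Values of a connection form: `ω μ i j` is `ω_{μ i}^j`. Latin indices are raised and lowered
with the Kronecker symbol, so their position is immaterial. -/
abbrev Connection := Fin 3 → Fin 3 → Fin 3 → ℝ

/-- The partial derivative `∂_μ f`. -/
def pd (μ : Fin 3) (f : Pt → ℝ) (x : Pt) : ℝ := fderiv ℝ f x (Pi.single μ 1)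

/-- The values of the fields and of their first derivatives at a point:
`de ν μ i` is `∂_ν e_μ^i` and `dω ν μ i j` is `∂_ν ω_{μ i}^j`. -/
structure Jet where
  e : Vielbein
  ω : Connection
  de : Fin 3 → Vielbein
  dω : Fin 3 → Connection

/-- The first jet of a pair of fields at a point. -/
def jet (e : Pt → Vielbein) (ω : Pt → Connection) (x : Pt) : Jet where
  e := e x
  ω := ω x
  de := fun ν μ i => pd ν (fun y => e y μ i) x
  dω := fun ν μ i j => pd ν (fun y => ω y μ i j) x

/-- Smooth fields on `U`: an invertible vielbein and an `SO(3)` connection (a one-form with values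
in the antisymmetric matrices). -/
structure IsConfiguration (U : Set Pt) (e : Pt → Vielbein) (ω : Pt → Connection) : Prop where
  smooth_e : ∀ μ i, ContDiffOn ℝ ((⊤ : ℕ∞) : WithTop ℕ∞) (fun x => e x μ i) U
  smooth_ω : ∀ μ i j, ContDiffOn ℝ ((⊤ : ℕ∞) : WithTop ℕ∞) (fun x => ω x μ i j) U
  det_ne_zero : ∀ x ∈ U, (Matrix.of (e x)).det ≠ 0
  antisymm : ∀ x ∈ U, ∀ μ i j, ω x μ i j = - ω x μ j i

/-! ### Torsion and curvature -/

/-- The determinant `e = det e_μ^i`. -/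
def detE (e : Vielbein) : ℝ := (Matrix.of e).det

/-- The inverse vielbein `e^μ_i`. -/
def invE (e : Vielbein) (μ i : Fin 3) : ℝ := (Matrix.of e)⁻¹ i μ

/-- `T_{μν}^i = ∂_μ e_ν^i - e_μ^j ω_{ν j}^i - (μ ↔ ν)`. -/
def torsion (J : Jet) (μ ν i : Fin 3) : ℝ :=
  (J.de μ ν i - ∑ j, J.e μ j * J.ω ν j i) - (J.de ν μ i - ∑ j, J.e ν j * J.ω μ j i)

/-- `R_{μν j}^i = ∂_μ ω_{ν j}^i - ω_{μ j}^k ω_{ν k}^i - (μ ↔ ν)`. -/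
def curvature (J : Jet) (μ ν j i : Fin 3) : ℝ :=
  (J.dω μ ν j i - ∑ k, J.ω μ j k * J.ω ν k i) - (J.dω ν μ j i - ∑ k, J.ω ν j k * J.ω μ k i)

/-- `T_{ijk} = T_{μν k} e^μ_i e^ν_j`. -/
def torsionL (J : Jet) (i j k : Fin 3) : ℝ :=
  ∑ μ, ∑ ν, torsion J μ ν k * invE J.e μ i * invE J.e ν j

/-- `R_{ijkl} = R_{μν kl} e^μ_i e^ν_j`. -/
def curvatureL (J : Jet) (i j k l : Fin 3) : ℝ :=
  ∑ μ, ∑ ν, curvature J μ ν k l * invE J.e μ i * invE J.e ν j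

/-- The Ricci tensor `R_{ik} = R_{ijk}^j`. -/
def ricci (J : Jet) (i k : Fin 3) : ℝ := ∑ j, curvatureL J i j k j

/-- The antisymmetric part `R^A_{ij}` of the Ricci tensor. -/
def ricciA (J : Jet) (i j : Fin 3) : ℝ := (ricci J i j - ricci J j i) / 2

/-- The scalar curvature `R`. -/
def scalarCurv (J : Jet) : ℝ := ∑ i, ricci J i i

/-! ### Irreducible components of a tensor `t_{ijk} = - t_{jik}` -/

/-- The totally antisymmetric symbol, with `ε_{012} = 1`. -/
def eps (i j k : Fin 3) : ℝ :=
  (((j : ℕ) : ℝ) - ((i : ℕ) : ℝ)) * (((k : ℕ) : ℝ) - ((i : ℕ) : ℝ)) *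
    (((k : ℕ) : ℝ) - ((j : ℕ) : ℝ)) / 2

/-- The Kronecker symbol. -/
def kron (i j : Fin 3) : ℝ := if i = j then 1 else 0

/-- The trace `t_j = t_{ij}^i`. -/
def tracePart (t : Fin 3 → Fin 3 → Fin 3 → ℝ) (j : Fin 3) : ℝ := ∑ i, t i j i

/-- The axial part `t^* = t_{ijk} ε^{ijk} / 6`. -/
def axialPart (t : Fin 3 → Fin 3 → Fin 3 → ℝ) : ℝ := (∑ i, ∑ j, ∑ k, t i j k * eps i j k) / 6

/-- The remaining part
`w_{ijk} = t_{ijk} - t^* ε_{ijk} - (δ_{ik} t_j - δ_{jk} t_i) / 2`. -/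
def mixedPart (t : Fin 3 → Fin 3 → Fin 3 → ℝ) (i j k : Fin 3) : ℝ :=
  t i j k - axialPart t * eps i j k - (kron i k * tracePart t j - kron j k * tracePart t i) / 2

/-! ### The Lagrangian and its Euler–Lagrange equations -/

/-- The eight parameters of the Lagrangian. -/
structure Params where
  κ : ℝ
  β₁ : ℝ
  β₂ : ℝ
  β₃ : ℝ
  γ₁ : ℝ
  γ₂ : ℝ
  γ₃ : ℝ
  Λ : ℝ

/-- The general eight-parameter Lagrangian `L` (a density: it contains the factor `det e`). -/
def lagrangian (p : Params) (J : Jet) : ℝ :=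
  detE J.e *
    (-p.κ * scalarCurv J
      + (1 / 4) * (∑ i, ∑ j, ∑ k, torsionL J i j k *
          (p.β₁ * torsionL J i j k + p.β₂ * torsionL J k i j
            + p.β₃ * tracePart (torsionL J) j * kron i k))
      + (1 / 4) * (∑ i, ∑ j, ∑ k, ∑ l, curvatureL J i j k l *
          (p.γ₁ * curvatureL J i j k l + p.γ₂ * curvatureL J k l i j
            + p.γ₃ * ricci J i k * kron j l))
      - p.Λ)

/-- The Euler–Lagrange expression `δL/δe_μ^i = ∂L/∂e_μ^i - ∂_ν (∂L/∂(∂_ν e_μ^i))` at `x`. -/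
def elVielbein (L : Jet → ℝ) (e : Pt → Vielbein) (ω : Pt → Connection) (μ i : Fin 3)
    (x : Pt) : ℝ :=
  let dir : Vielbein := Pi.single μ (Pi.single i 1)
  deriv (fun t : ℝ => L { jet e ω x with e := e x + t • dir }) 0
    - ∑ ν, pd ν (fun y => deriv (fun t : ℝ =>
        L { jet e ω y with de := (jet e ω y).de + t • (Pi.single ν dir : Fin 3 → Vielbein) }) 0) x

/-- The Euler–Lagrange expression `δL/δω_μ^{ij}` at `x`. The variation is taken along
antisymmetric matrices: `ω_μ^{ij}` and `ω_μ^{ji} = - ω_μ^{ij}` are varied together. -/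
def elConnection (L : Jet → ℝ) (e : Pt → Vielbein) (ω : Pt → Connection) (μ i j : Fin 3)
    (x : Pt) : ℝ :=
  let dir : Connection :=
    Pi.single μ (Pi.single i (Pi.single j 1) - Pi.single j (Pi.single i 1))
  deriv (fun t : ℝ => L { jet e ω x with ω := ω x + t • dir }) 0
    - ∑ ν, pd ν (fun y => deriv (fun t : ℝ =>
        L { jet e ω y with dω := (jet e ω y).dω + t • (Pi.single ν dir : Fin 3 → Connection) }) 0) x

/-- The equilibrium equations for the vielbein hold on `U`. -/
def VielbeinEq (p : Params) (U : Set Pt) (e : Pt → Vielbein) (ω : Pt → Connection) : Prop :=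
  ∀ x ∈ U, ∀ μ i, elVielbein (lagrangian p) e ω μ i x = 0

/-- The equilibrium equations for the connection hold on `U`. -/
def ConnectionEq (p : Params) (U : Set Pt) (e : Pt → Vielbein) (ω : Pt → Connection) : Prop :=
  ∀ x ∈ U, ∀ μ i j, elConnection (lagrangian p) e ω μ i j x = 0

/-- `T = 0` on `U`: no dislocations. -/
def TorsionFree (U : Set Pt) (e : Pt → Vielbein) (ω : Pt → Connection) : Prop :=
  ∀ x ∈ U, ∀ μ ν i, torsion (jet e ω x) μ ν i = 0

/-- `R = 0` on `U`: no disclinations. -/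
def CurvatureFree (U : Set Pt) (e : Pt → Vielbein) (ω : Pt → Connection) : Prop :=
  ∀ x ∈ U, ∀ μ ν j i, curvature (jet e ω x) μ ν j i = 0

/-! ### Genericity of torsion and of curvature -/

/-- None of the three irreducible components `T_i`, `T^*`, `W_{ijk}` of the torsion tensor
vanishes identically on `U`. -/
def GenericTorsion (U : Set Pt) (e : Pt → Vielbein) (ω : Pt → Connection) : Prop :=
  (∃ x ∈ U, ∃ i, tracePart (torsionL (jet e ω x)) i ≠ 0) ∧
  (∃ x ∈ U, axialPart (torsionL (jet e ω x)) ≠ 0) ∧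
  (∃ x ∈ U, ∃ i j k, mixedPart (torsionL (jet e ω x)) i j k ≠ 0)

/-- The covariant derivative `∇_k R_{ij} = e^μ_k (∂_μ R_{ij} - ω_{μ i}^l R_{lj} - ω_{μ j}^l R_{il})`
of the Ricci tensor. -/
def covRicci (e : Pt → Vielbein) (ω : Pt → Connection) (x : Pt) (k i j : Fin 3) : ℝ :=
  ∑ μ, invE (e x) μ k *
    (pd μ (fun y => ricci (jet e ω y) i j) x
      - (∑ l, ω x μ i l * ricci (jet e ω x) l j)
      - ∑ l, ω x μ j l * ricci (jet e ω x) i l)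

/-- The trace-free part of `∇_i R_{jk} - ∇_j R_{ik}`; for zero torsion, this is the Cotton tensor
of the metric. -/
def cotton (e : Pt → Vielbein) (ω : Pt → Connection) (x : Pt) (i j k : Fin 3) : ℝ :=
  mixedPart (fun i j k => covRicci e ω x i j k - covRicci e ω x j i k) i j k

/-- On `U`, neither the gradient of the scalar curvature nor the Cotton tensor vanishes
identically. -/
def GenericCurvature (U : Set Pt) (e : Pt → Vielbein) (ω : Pt → Connection) : Prop :=
  (∃ x ∈ U, ∃ μ, pd μ (fun y => scalarCurv (jet e ω y)) x ≠ 0) ∧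
  (∃ x ∈ U, ∃ i j k, cotton e ω x i j k ≠ 0)

/-! ### The three requirements -/

/-- There is an equilibrium configuration on `U` with only dislocations, of general type. -/
def AdmitsDislocations (p : Params) (U : Set Pt) : Prop :=
  ∃ e ω, IsConfiguration U e ω ∧ CurvatureFree U e ω ∧ GenericTorsion U e ω ∧
    VielbeinEq p U e ω ∧ ConnectionEq p U e ω

/-- There is a configuration on `U` with only disclinations, of general type, which satisfies the
equilibrium equations for the connection. -/
def AdmitsDisclinations (p : Params) (U : Set Pt) : Prop :=
  ∃ e ω, IsConfiguration U e ω ∧ TorsionFree U e ω ∧ GenericCurvature U e ω ∧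
    ConnectionEq p U e ω

/-- There is an equilibrium configuration on `U` without defects. -/
def AdmitsDefectFree (p : Params) (U : Set Pt) : Prop :=
  ∃ e ω, IsConfiguration U e ω ∧ CurvatureFree U e ω ∧ TorsionFree U e ω ∧
    VielbeinEq p U e ω ∧ ConnectionEq p U e ω

/-- `β₁ = -κ`, `β₂ = 2κ`, `β₃ = 4κ`. -/
def Params.BetaRel (p : Params) : Prop := p.β₁ = -p.κ ∧ p.β₂ = 2 * p.κ ∧ p.β₃ = 4 * p.κ

/-- `γ₁ = -γ₂ = γ` (where `γ` is `γ₁`) and `γ₃ = 0`. -/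
def Params.GammaRel (p : Params) : Prop := p.γ₂ = -p.γ₁ ∧ p.γ₃ = 0

/-! ### Riemannian geometry of the induced metric -/

/-- `g_{μν} = e_μ^i e_ν^i`. -/
def metric (e : Pt → Vielbein) (x : Pt) (μ ν : Fin 3) : ℝ := ∑ i, e x μ i * e x ν i

/-- The inverse metric `g^{μν}`. -/
def invMetric (e : Pt → Vielbein) (x : Pt) (μ ν : Fin 3) : ℝ := (Matrix.of (metric e x))⁻¹ μ ν

/-- The Christoffel symbols `Γ̃_{μν}^ρ`. -/
def christoffel (e : Pt → Vielbein) (x : Pt) (μ ν ρ : Fin 3) : ℝ :=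
  ∑ σ, (1 / 2) * (pd μ (fun y => metric e y ν σ) x + pd ν (fun y => metric e y μ σ) x
    - pd σ (fun y => metric e y μ ν) x) * invMetric e x σ ρ

/-- `R̃_{μνρ}^σ = ∂_μ Γ̃_{νρ}^σ - Γ̃_{μρ}^λ Γ̃_{νλ}^σ - (μ ↔ ν)`. -/
def riemann (e : Pt → Vielbein) (x : Pt) (μ ν ρ σ : Fin 3) : ℝ :=
  (pd μ (fun y => christoffel e y ν ρ σ) x
      - ∑ l, christoffel e x μ ρ l * christoffel e x ν l σ)
    - (pd ν (fun y => christoffel e y μ ρ σ) x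
      - ∑ l, christoffel e x ν ρ l * christoffel e x μ l σ)

/-- `R̃_{μν} = R̃_{μρν}^ρ`. -/
def ricciLC (e : Pt → Vielbein) (x : Pt) (μ ν : Fin 3) : ℝ := ∑ ρ, riemann e x μ ρ ν ρ

/-- `R̃ = g^{μν} R̃_{μν}`. -/
def scalarLC (e : Pt → Vielbein) (x : Pt) : ℝ := ∑ μ, ∑ ν, invMetric e x μ ν * ricciLC e x μ ν

/-- The Einstein equations with a cosmological constant, multiplied by `κ`:
`κ (R̃_{μν} - g_{μν} R̃ / 2) - (Λ / 2) g_{μν} = 0` on `U`. -/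
def EinsteinEq (κ Λ : ℝ) (U : Set Pt) (e : Pt → Vielbein) : Prop :=
  ∀ x ∈ U, ∀ μ ν,
    κ * (ricciLC e x μ ν - (1 / 2) * metric e x μ ν * scalarLC e x)
      - (Λ / 2) * metric e x μ ν = 0

/-- The vector density `e T^μ`. -/
def torsionDensity (e : Pt → Vielbein) (ω : Pt → Connection) (μ : Fin 3) (x : Pt) : ℝ :=
  detE (e x) * ∑ j, invE (e x) μ j * tracePart (torsionL (jet e ω x)) j

end RiemannCartan

end

noncomputable section

namespace RiemannCartan

-- The Lagrangian is linear in its parameters, so it splits (`lagrangian_eq`) into a distinguished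
-- part `Params.einstein κ`, torsion squares with the deviations b₁ = β₁ + κ, b₂ = β₂ - 2κ, b₃ = β₃
-- - 4κ as coefficients, the curvature squares, and the cosmological term. The Euler–Lagrange
-- expression `EL` is additive, so each part is treated separately. Two principles are used
-- throughout: a total divergence has no Euler–Lagrange expression (`EL_divLagr`), and neither has a
-- sum of products of quantities that vanish on `U` (`EL_mul_sum_mul_eq_zero`).
--
-- Up to the divergence of e e^μ_j e^ν_i ω_ν^{ji}, the distinguished part depends only on the
-- vielbein and its first derivatives (`lagrangian_einstein`). Hence its connection equation is an
-- identity (`EL_einstein_connection`) and its vielbein equation is the same for all connections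
-- (`EL_einstein_vielbein`). The latter may thus be evaluated at the torsion-free connection, where
-- the torsion squares contribute nothing and the scalar curvature, varied at fixed ω, gives the
-- Einstein tensor (`EL_hilbert`). Comparing the Lagrangian at ω with its value at the torsion-free
-- connection also gives the formula for the free energy.
--
-- For zero curvature the curvature squares drop out, and the connection equation says that the
-- linear expression `torsionStress` in the torsion vanishes. It multiplies the trace, axial and
-- mixed components by b₁ - b₂/2 + b₃, b₁ + b₂ and b₁ - b₂/2. If none of the components vanishes
-- identically, all three factors are zero, and so are the b's.
--
-- For zero torsion the torsion squares drop out. In three dimensions the curvature is determined by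
-- the Ricci tensor, and by the pair symmetry the curvature squares may be replaced by s
-- R_{ij}R^{ij} + t R² with s = γ₁ + γ₂ + γ₃/4 and t = -(γ₁ + γ₂)/4 (`EL_curvatureTerms`). The
-- connection equation becomes linear in the covariant derivative of the Ricci tensor
-- (`EL_ricciLagr`). With the contracted Bianchi identity its trace is (3s + 8t) ∇R = 0 and its
-- mixed part is 2s C = 0, so s = t = 0 when neither ∇R nor C vanishes identically. Conversely s = t
-- = 0 removes the curvature squares from both equations.
--
-- Without defects only the cosmological term survives, which forces Λ = 0. The converse is shown by
-- explicit fields: a rotating orthonormal frame of the Euclidean metric with ω = 0, and a warped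
-- metric with its torsion-free connection.

local notation "∞" => ((⊤ : ℕ∞) : WithTop ℕ∞)

/-! ### The inverse vielbein -/

theorem sum_invE_mul {e : Vielbein} (h : detE e ≠ 0) (i j : Fin 3) :
    ∑ μ, invE e μ i * e μ j = kron i j := by
  have h1 : (Matrix.of e)⁻¹ * Matrix.of e = 1 :=
    Matrix.nonsing_inv_mul _ (isUnit_iff_ne_zero.mpr h)
  have := congrFun (congrFun h1 i) j
  simpa [Matrix.mul_apply, Matrix.one_apply, invE, kron] using this

theorem sum_mul_invE {e : Vielbein} (h : detE e ≠ 0) (μ ν : Fin 3) :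
    ∑ i, e μ i * invE e ν i = kron μ ν := by
  have h1 : Matrix.of e * (Matrix.of e)⁻¹ = 1 :=
    Matrix.mul_nonsing_inv _ (isUnit_iff_ne_zero.mpr h)
  have := congrFun (congrFun h1 μ) ν
  simpa [Matrix.mul_apply, Matrix.one_apply, invE, kron] using this

theorem contDiff_detE : ContDiff ℝ ∞ detE := by
  unfold detE
  simp only [Matrix.det_fin_three, Matrix.of_apply]
  fun_prop

theorem detE_mul_invE {e : Vielbein} (h : detE e ≠ 0) (μ i : Fin 3) :
    detE e * invE e μ i = (Matrix.of e).adjugate i μ := by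
  rw [invE, Matrix.inv_def, Ring.inverse_eq_inv', Matrix.smul_apply, smul_eq_mul, ← mul_assoc]
  change detE e * (detE e)⁻¹ * _ = _
  rw [mul_inv_cancel₀ h, one_mul]

theorem contDiffAt_invE {e : Vielbein} (h : detE e ≠ 0) (μ i : Fin 3) :
    ContDiffAt ℝ ∞ (fun e => invE e μ i) e := by
  have h1 : (fun e => invE e μ i) = fun e => (detE e)⁻¹ * (Matrix.of e).adjugate i μ := by
    funext e
    rw [invE, Matrix.inv_def, Ring.inverse_eq_inv', Matrix.smul_apply, smul_eq_mul]
    rfl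
  rw [h1]
  refine (contDiff_detE.contDiffAt.inv h).mul ?_
  simp only [Matrix.adjugate_fin_three, Matrix.of_apply]
  fin_cases i <;> fin_cases μ <;> simp <;> fun_prop

/-- Jacobi's formula. Since e e^μ_i is a cofactor, both sides are polynomials in the entries, and
the expanded 3 × 3 determinant is differentiated along a line. -/
theorem fderiv_detE {e : Vielbein} (h : detE e ≠ 0) (a : Vielbein) :
    fderiv ℝ detE e a = detE e * ∑ μ, ∑ i, invE e μ i * a μ i := by
  have h2 : HasDerivAt (fun t : ℝ => detE (e + t • a)) (fderiv ℝ detE e a) 0 := by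
    have h3 : HasDerivAt (fun t : ℝ => e + t • a) a 0 := by
      simpa using ((hasDerivAt_id (0 : ℝ)).smul_const a).const_add e
    have h4 : HasFDerivAt detE (fderiv ℝ detE e) (e + (0 : ℝ) • a) := by
      simpa using (contDiff_detE.differentiable (by simp) e).hasFDerivAt
    exact h4.comp_hasDerivAt (0 : ℝ) h3
  have hl (μ i : Fin 3) : HasDerivAt (fun t : ℝ => e μ i + t * a μ i) (a μ i) 0 := by
    simpa using ((hasDerivAt_id (0 : ℝ)).mul_const (a μ i)).const_add (e μ i)
  have h5 := ((((((((hl 0 0).mul (hl 1 1)).mul (hl 2 2)).sub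
    (((hl 0 0).mul (hl 1 2)).mul (hl 2 1))).sub
    (((hl 0 1).mul (hl 1 0)).mul (hl 2 2))).add
    (((hl 0 1).mul (hl 1 2)).mul (hl 2 0))).add
    (((hl 0 2).mul (hl 1 0)).mul (hl 2 1))).sub
    (((hl 0 2).mul (hl 1 1)).mul (hl 2 0)))
  have h6 := h2.unique (h5.congr_of_eventuallyEq (Filter.Eventually.of_forall fun t => by
    simp [detE, Matrix.det_fin_three]))
  rw [h6, Finset.mul_sum]
  simp_rw [Finset.mul_sum, ← mul_assoc, detE_mul_invE h]
  simp only [Fin.sum_univ_three, Matrix.adjugate_fin_three, Matrix.of_apply]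
  simp
  ring

/-- Differentiate e⁻¹ e = 1, which holds in a neighbourhood of an invertible e, and multiply by the
inverse from the right. -/
theorem fderiv_invE {e : Vielbein} (h : detE e ≠ 0) (a : Vielbein) (μ i : Fin 3) :
    fderiv ℝ (fun e => invE e μ i) e a = -∑ l, ∑ k, invE e μ k * invE e l i * a l k := by
  have hd (ν j : Fin 3) : DifferentiableAt ℝ (fun e => invE e ν j) e :=
    (contDiffAt_invE h ν j).differentiableAt (by simp)
  have key (k : Fin 3) : ∑ l, (fderiv ℝ (fun e => invE e l i) e a * e l k
      + invE e l i * a l k) = 0 := by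
    have h1 : HasFDerivAt (fun e : Vielbein => ∑ l, invE e l i * e l k)
        (∑ l, (invE e l i • (ContinuousLinearMap.proj (R := ℝ) k).comp
          (ContinuousLinearMap.proj (R := ℝ) (φ := fun _ : Fin 3 => Fin 3 → ℝ) l)
          + e l k • fderiv ℝ (fun e => invE e l i) e)) e :=
      HasFDerivAt.fun_sum fun l _ => (hd l i).hasFDerivAt.mul
        ((ContinuousLinearMap.proj (R := ℝ) k).comp
          (ContinuousLinearMap.proj (R := ℝ) (φ := fun _ : Fin 3 => Fin 3 → ℝ) l)).hasFDerivAt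
    have h2 : HasFDerivAt (fun e : Vielbein => ∑ l, invE e l i * e l k)
        (0 : Vielbein →L[ℝ] ℝ) e := by
      refine (hasFDerivAt_const (kron i k) e).congr_of_eventuallyEq ?_
      filter_upwards [contDiff_detE.continuous.continuousAt.eventually_ne h] with y hy
      exact sum_invE_mul hy i k
    have h3 := DFunLike.congr_fun (h1.unique h2) a
    simp only [sum_apply, add_apply,
      smul_apply, ContinuousLinearMap.comp_apply,
      ContinuousLinearMap.proj_apply, smul_eq_mul, zero_apply] at h3
    rw [← h3]
    exact Finset.sum_congr rfl fun l _ => by ring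
  calc fderiv ℝ (fun e => invE e μ i) e a
      = ∑ l, fderiv ℝ (fun e => invE e l i) e a * kron l μ := by
        simp [kron]
    _ = ∑ l, fderiv ℝ (fun e => invE e l i) e a * ∑ k, e l k * invE e μ k := by
        simp_rw [sum_mul_invE h]
    _ = ∑ k, invE e μ k * ∑ l, (fderiv ℝ (fun e => invE e l i) e a * e l k
          + invE e l i * a l k) - ∑ l, ∑ k, invE e μ k * invE e l i * a l k := by
        simp only [Fin.sum_univ_three]
        ring
    _ = _ := by simp [key]

/-! ### Frame components -/

/-- `e^μ_i e^ν_j ∂_μ e_ν^k`. -/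
def frameDE (J : Jet) (i j k : Fin 3) : ℝ :=
  ∑ μ, ∑ ν, J.de μ ν k * invE J.e μ i * invE J.e ν j

/-- `e^μ_i ω_{μ j}^k`. -/
def frameω (J : Jet) (i j k : Fin 3) : ℝ := ∑ μ, J.ω μ j k * invE J.e μ i

/-- `e^μ_i e^ν_j ∂_μ ω_{ν k}^l`. -/
def frameDω (J : Jet) (i j k l : Fin 3) : ℝ :=
  ∑ μ, ∑ ν, J.dω μ ν k l * invE J.e μ i * invE J.e ν j

/-- In the frame the inverse vielbein disappears: torsion and curvature become polynomials in the
arrays `frameDE`, `frameω`, `frameDω`, so that algebraic identities between Lagrangians can be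
checked with these arrays as free variables. -/
theorem torsionL_eq {J : Jet} (h : detE J.e ≠ 0) (i j k : Fin 3) :
    torsionL J i j k = frameDE J i j k - frameDE J j i k - frameω J j i k + frameω J i j k := by
  have h1 (i j k : Fin 3) : frameω J j i k
      = ∑ μ, ∑ ν, (∑ l, J.e μ l * J.ω ν l k) * invE J.e μ i * invE J.e ν j := by
    calc frameω J j i k = ∑ ν, ∑ l, kron i l * J.ω ν l k * invE J.e ν j := by
          simp [frameω, kron]
      _ = ∑ ν, ∑ l, (∑ μ, invE J.e μ i * J.e μ l) * J.ω ν l k * invE J.e ν j := by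
          simp_rw [sum_invE_mul h]
      _ = _ := by
          simp only [Fin.sum_univ_three]
          ring
  rw [h1 i j k, h1 j i k]
  simp only [torsionL, torsion, frameDE, Fin.sum_univ_three]
  ring

theorem curvatureL_eq (J : Jet) (i j k l : Fin 3) :
    curvatureL J i j k l = (frameDω J i j k l - ∑ m, frameω J i k m * frameω J j m l)
      - (frameDω J j i k l - ∑ m, frameω J j k m * frameω J i m l) := by
  simp only [curvatureL, curvature, frameDω, frameω, Fin.sum_univ_three]
  ring

/-- Jets of configurations. -/
structure Jet.Antisymm (J : Jet) : Prop where
  ω : ∀ μ i j, J.ω μ i j = -J.ω μ j i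
  dω : ∀ ν μ i j, J.dω ν μ i j = -J.dω ν μ j i

theorem Jet.Antisymm.frameω {J : Jet} (h : J.Antisymm) (i j k : Fin 3) :
    frameω J i j k = -frameω J i k j := by
  simp only [RiemannCartan.frameω, ← Finset.sum_neg_distrib]
  exact Finset.sum_congr rfl fun μ _ => by rw [h.ω]; ring

theorem Jet.Antisymm.frameDω {J : Jet} (h : J.Antisymm) (i j k l : Fin 3) :
    frameDω J i j k l = -frameDω J i j l k := by
  simp only [RiemannCartan.frameDω, ← Finset.sum_neg_distrib]
  exact Finset.sum_congr rfl fun μ _ => Finset.sum_congr rfl fun ν _ => by rw [h.dω]; ring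

theorem eq_zero_of_antisymm {f : Fin 3 → Fin 3 → ℝ} (h : ∀ i j, f i j = -f j i) (i : Fin 3) :
    f i i = 0 := by
  linarith [h i i]

/-- The part of the Lagrangian fixed by the first group of relations. -/
def Params.einstein (κ : ℝ) : Params := ⟨κ, -κ, 2 * κ, 4 * κ, 0, 0, 0, 0⟩

/-- The jet with the connection removed. -/
def Jet.dropω (J : Jet) : Jet := ⟨J.e, 0, J.de, 0⟩

/-- `∂_μ (e e^μ_j e^ν_i ω_ν^{ji})` in terms of the frame components. -/
def divTerm (J : Jet) : ℝ :=
  detE J.e * ((∑ i, ∑ j, frameDω J j i j i)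
    + ∑ i, ∑ j, ∑ k, ((frameDE J j k k - frameDE J k j k) * frameω J i j i
      - frameDE J j i k * frameω J k j i))

theorem scalarCurv_eq {J : Jet} (hJ : J.Antisymm) : scalarCurv J =
    2 * (∑ i, ∑ j, frameDω J j i j i)
      - ∑ i, ∑ j, ∑ k, (frameω J i i k * frameω J j k j - frameω J j i k * frameω J i k j) := by
  simp only [scalarCurv, ricci, curvatureL_eq]
  have h1 : ∑ i, ∑ j, frameDω J j i i j = - ∑ i, ∑ j, frameDω J j i j i := by
    simp only [← Finset.sum_neg_distrib]
    exact Finset.sum_congr rfl fun i _ => Finset.sum_congr rfl fun j _ => hJ.frameDω _ _ _ _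
  have h2 : ∑ i, ∑ j, frameDω J i j i j = ∑ i, ∑ j, frameDω J j i j i := Finset.sum_comm
  simp only [Finset.sum_sub_distrib, h1, h2]
  ring

/-- The coefficients -κ, 2κ, 4κ are those for which the terms quadratic in ω cancel between -κR and
the torsion squares. The terms linear in ω then combine with the derivatives of ω into a divergence,
and what remains contains neither. -/
theorem lagrangian_einstein (κ : ℝ) {J : Jet} (h : detE J.e ≠ 0) (hJ : J.Antisymm) :
    lagrangian (Params.einstein κ) J
      = lagrangian (Params.einstein κ) J.dropω - 2 * κ * divTerm J := by
  have hd : detE J.dropω.e ≠ 0 := h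
  have hJd : J.dropω.Antisymm := ⟨fun _ _ _ => by simp [Jet.dropω], fun _ _ _ _ => by simp [Jet.dropω]⟩
  have e1 : frameω J.dropω = 0 := by
    funext i j k; simp [frameω, Jet.dropω]
  have e2 : frameDω J.dropω = 0 := by
    funext i j k l; simp [frameDω, Jet.dropω]
  have e3 : frameDE J.dropω = frameDE J := rfl
  have e4 : J.dropω.e = J.e := rfl
  simp only [lagrangian, Params.einstein, scalarCurv_eq hJ, scalarCurv_eq hJd, torsionL_eq h,
    torsionL_eq hd, tracePart, divTerm, e1, e2, e3, e4]
  generalize hw : frameω J = w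
  have w0 (i j) : w i j j = 0 := by
    rw [← hw]; exact eq_zero_of_antisymm (fun a b => hJ.frameω i a b) j
  have w1 (i) : w i 1 0 = -w i 0 1 := by rw [← hw]; exact hJ.frameω i 1 0
  have w2 (i) : w i 2 0 = -w i 0 2 := by rw [← hw]; exact hJ.frameω i 2 0
  have w3 (i) : w i 2 1 = -w i 1 2 := by rw [← hw]; exact hJ.frameω i 2 1
  generalize frameDE J = c
  simp only [kron]
  simp [Fin.sum_univ_three, w0, w1, w2, w3]
  ring

/-! ### Partial derivatives -/

/-- Differentiability of the Lagrangians follows once and for all from smoothness; with it, a value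
of the Fréchet derivative is found by differentiating along a single line. -/
theorem fderiv_eq_of_line {E : Type*} [NormedAddCommGroup E] [NormedSpace ℝ E] {f : E → ℝ}
    {x h : E} {d : ℝ} (hf : DifferentiableAt ℝ f x)
    (hd : HasDerivAt (fun t : ℝ => f (x + t • h)) d 0) : fderiv ℝ f x h = d := by
  rw [← hf.lineDeriv_eq_fderiv]
  exact hd.deriv

theorem hasDerivAt_line_fderiv {E F : Type*} [NormedAddCommGroup E] [NormedSpace ℝ E]
    [NormedAddCommGroup F] [NormedSpace ℝ F] {f : E → F}
    {x : E} (hf : DifferentiableAt ℝ f x) (h : E) :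
    HasDerivAt (fun t : ℝ => f (x + t • h)) (fderiv ℝ f x h) 0 :=
  hf.hasFDerivAt.hasLineDerivAt h

theorem hasDerivAt_line {E : Type*} [NormedAddCommGroup E] [NormedSpace ℝ E] (x h : E) :
    HasDerivAt (fun t : ℝ => x + t • h) h 0 := by
  simpa using ((hasDerivAt_id (0 : ℝ)).smul_const h).const_add x

theorem pd_eq_of_line {f : Pt → ℝ} {x : Pt} {ν : Fin 3} {d : ℝ} (hf : DifferentiableAt ℝ f x)
    (hd : HasDerivAt (fun t : ℝ => f (x + t • Pi.single ν 1)) d 0) : pd ν f x = d :=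
  fderiv_eq_of_line hf hd

theorem hasDerivAt_line_pd {f : Pt → ℝ} {x : Pt} (hf : DifferentiableAt ℝ f x) (ν : Fin 3) :
    HasDerivAt (fun t : ℝ => f (x + t • Pi.single ν 1)) (pd ν f x) 0 :=
  hasDerivAt_line_fderiv hf _

theorem pd_congr {f g : Pt → ℝ} {U : Set Pt} (hU : IsOpen U) (h : ∀ y ∈ U, f y = g y)
    {x : Pt} (hx : x ∈ U) (ν : Fin 3) : pd ν f x = pd ν g x := by
  unfold pd
  rw [Filter.EventuallyEq.fderiv_eq (Filter.eventually_of_mem (hU.mem_nhds hx) h)]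

theorem pd_const (c : ℝ) (ν : Fin 3) (x : Pt) : pd ν (fun _ => c) x = 0 := by
  simp [pd]

theorem pd_neg (f : Pt → ℝ) (ν : Fin 3) (x : Pt) : pd ν (fun y => -f y) x = -pd ν f x := by
  simp [pd, fderiv_fun_neg]

theorem pd_add {f g : Pt → ℝ} {x : Pt} (hf : DifferentiableAt ℝ f x)
    (hg : DifferentiableAt ℝ g x) (ν : Fin 3) :
    pd ν (fun y => f y + g y) x = pd ν f x + pd ν g x := by
  simp [pd, fderiv_fun_add hf hg]

theorem pd_sub {f g : Pt → ℝ} {x : Pt} (hf : DifferentiableAt ℝ f x)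
    (hg : DifferentiableAt ℝ g x) (ν : Fin 3) :
    pd ν (fun y => f y - g y) x = pd ν f x - pd ν g x := by
  simp [pd, fderiv_fun_sub hf hg]

theorem pd_mul {f g : Pt → ℝ} {x : Pt} (hf : DifferentiableAt ℝ f x)
    (hg : DifferentiableAt ℝ g x) (ν : Fin 3) :
    pd ν (fun y => f y * g y) x = pd ν f x * g x + f x * pd ν g x := by
  simp only [pd, fderiv_fun_mul hf hg]
  simp
  ring

theorem pd_sum {ι : Type*} {s : Finset ι} {f : ι → Pt → ℝ} {x : Pt}
    (hf : ∀ i ∈ s, DifferentiableAt ℝ (f i) x) (ν : Fin 3) :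
    pd ν (fun y => ∑ i ∈ s, f i y) x = ∑ i ∈ s, pd ν (f i) x := by
  simp [pd, fderiv_fun_sum hf]

theorem ContDiffOn.pd {f : Pt → ℝ} {U : Set Pt} (hU : IsOpen U) (hf : ContDiffOn ℝ ∞ f U)
    (ν : Fin 3) : ContDiffOn ℝ ∞ (pd ν f) U :=
  (hf.fderiv_of_isOpen hU (by simp)).clm_apply contDiffOn_const

theorem pd_comm {f : Pt → ℝ} {x : Pt} (hf : ContDiffAt ℝ ∞ f x) (μ ν : Fin 3) :
    pd μ (pd ν f) x = pd ν (pd μ f) x := by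
  have hs : IsSymmSndFDerivAt ℝ f x :=
    (hf.of_le (m := 2) (WithTop.coe_le_coe.mpr (le_top : (2 : ℕ∞) ≤ ⊤))).isSymmSndFDerivAt (by simp)
  have hd : DifferentiableAt ℝ (fderiv ℝ f) x :=
    (hf.fderiv_right (m := ∞) (by simp)).differentiableAt (by simp)
  have key (μ ν : Fin 3) : RiemannCartan.pd μ (RiemannCartan.pd ν f) x
      = fderiv ℝ (fderiv ℝ f) x (Pi.single μ 1) (Pi.single ν 1) := by
    unfold RiemannCartan.pd
    rw [fderiv_clm_apply hd (differentiableAt_const _)]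
    simp
  rw [key, key]
  exact hs _ _

/-! ### Smooth Lagrangians and their Euler–Lagrange expressions -/

/-- Values of a pair of fields. -/
abbrev Fld := Vielbein × Connection

/-- First jets of pairs of fields, as a normed space. -/
abbrev JetSpace := Fld × (Fin 3 → Fld)

/-- The jet with the given entries. -/
def toJet (J : JetSpace) : Jet := ⟨J.1.1, J.1.2, fun ν => (J.2 ν).1, fun ν => (J.2 ν).2⟩

/-- The jet of a pair of fields, as an element of a normed space. -/
def jetMap (e : Pt → Vielbein) (ω : Pt → Connection) (x : Pt) : JetSpace :=
  ((e x, ω x), fun ν => (fun μ i => pd ν (fun y => e y μ i) x,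
    fun μ i j => pd ν (fun y => ω y μ i j) x))

/-- Smoothness at all jets with an invertible vielbein. -/
def SmoothLagr (L : Jet → ℝ) : Prop :=
  ∀ J : JetSpace, detE J.1.1 ≠ 0 → ContDiffAt ℝ ∞ (fun J => L (toJet J)) J

/-- The Euler–Lagrange expression contracted with a variation `δ` of the fields. -/
def EL (L : Jet → ℝ) (e : Pt → Vielbein) (ω : Pt → Connection) (δ : Fld) (x : Pt) : ℝ :=
  fderiv ℝ (fun J => L (toJet J)) (jetMap e ω x) (δ, 0)
    - ∑ ν, pd ν (fun y => fderiv ℝ (fun J => L (toJet J)) (jetMap e ω y) (0, Pi.single ν δ)) x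

namespace SmoothLagr

theorem differentiableAt {L : Jet → ℝ} (hL : SmoothLagr L) {J : JetSpace} (h : detE J.1.1 ≠ 0) :
    DifferentiableAt ℝ (fun J => L (toJet J)) J :=
  (hL J h).differentiableAt (by simp)

theorem const (c : ℝ) : SmoothLagr fun _ => c := fun _ _ => contDiffAt_const

theorem add {L M : Jet → ℝ} (hL : SmoothLagr L) (hM : SmoothLagr M) :
    SmoothLagr fun J => L J + M J := fun J h => (hL J h).add (hM J h)

theorem sub {L M : Jet → ℝ} (hL : SmoothLagr L) (hM : SmoothLagr M) :
    SmoothLagr fun J => L J - M J := fun J h => (hL J h).sub (hM J h)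

theorem mul {L M : Jet → ℝ} (hL : SmoothLagr L) (hM : SmoothLagr M) :
    SmoothLagr fun J => L J * M J := fun J h => (hL J h).mul (hM J h)

theorem sum {ι : Type*} {s : Finset ι} {L : ι → Jet → ℝ} (hL : ∀ i, SmoothLagr (L i)) :
    SmoothLagr fun J => ∑ i ∈ s, L i J := fun J h =>
  ContDiffAt.sum fun i _ => hL i J h

theorem detE : SmoothLagr fun J => detE J.e := fun J _ =>
  contDiff_detE.contDiffAt.comp J (contDiff_fst.comp contDiff_fst).contDiffAt

theorem invE (μ i : Fin 3) : SmoothLagr fun J => invE J.e μ i := fun J h =>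
  (contDiffAt_invE h μ i).comp J (contDiff_fst.comp contDiff_fst).contDiffAt

theorem e (μ i : Fin 3) : SmoothLagr fun J => J.e μ i := fun J _ => by
  unfold toJet; fun_prop

theorem ω (μ i j : Fin 3) : SmoothLagr fun J => J.ω μ i j := fun J _ => by
  unfold toJet; fun_prop

theorem de (ν μ i : Fin 3) : SmoothLagr fun J => J.de ν μ i := fun J _ => by
  unfold toJet; fun_prop

theorem dω (ν μ i j : Fin 3) : SmoothLagr fun J => J.dω ν μ i j := fun J _ => by
  unfold toJet; fun_prop

theorem torsionL (i j k : Fin 3) : SmoothLagr fun J => torsionL J i j k := by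
  unfold RiemannCartan.torsionL torsion
  exact sum fun μ => sum fun ν => ((((de _ _ _).sub (sum fun _ => (e _ _).mul (ω _ _ _))).sub
    ((de _ _ _).sub (sum fun _ => (e _ _).mul (ω _ _ _)))).mul (invE _ _)).mul (invE _ _)

theorem curvatureL (i j k l : Fin 3) : SmoothLagr fun J => curvatureL J i j k l := by
  unfold RiemannCartan.curvatureL curvature
  exact sum fun μ => sum fun ν => ((((dω _ _ _ _).sub (sum fun _ => (ω _ _ _).mul (ω _ _ _))).sub
    ((dω _ _ _ _).sub (sum fun _ => (ω _ _ _).mul (ω _ _ _)))).mul (invE _ _)).mul (invE _ _)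

theorem ricci (i k : Fin 3) : SmoothLagr fun J => ricci J i k :=
  sum fun j => curvatureL i j k j

theorem scalarCurv : SmoothLagr scalarCurv := sum fun i => ricci i i

theorem tracePart (j : Fin 3) : SmoothLagr fun J => tracePart (RiemannCartan.torsionL J) j :=
  sum fun i => torsionL i j i

theorem lagrangian (p : Params) : SmoothLagr (lagrangian p) := by
  unfold RiemannCartan.lagrangian
  refine detE.mul (((((const _).mul scalarCurv).add ((const _).mul ?_)).add
    ((const _).mul ?_)).sub (const _))
  · exact sum fun i => sum fun j => sum fun k => (torsionL _ _ _).mul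
      ((((const _).mul (torsionL _ _ _)).add ((const _).mul (torsionL _ _ _))).add
        (((const _).mul (tracePart _)).mul (const _)))
  · exact sum fun i => sum fun j => sum fun k => sum fun l => (curvatureL _ _ _ _).mul
      ((((const _).mul (curvatureL _ _ _ _)).add ((const _).mul (curvatureL _ _ _ _))).add
        (((const _).mul (ricci _ _)).mul (const _)))

end SmoothLagr

section Configuration

variable {U : Set Pt} {e : Pt → Vielbein} {ω : Pt → Connection}

theorem IsConfiguration.contDiffOn_e (hc : IsConfiguration U e ω) : ContDiffOn ℝ ∞ e U :=
  contDiffOn_pi.mpr fun μ => contDiffOn_pi.mpr fun i => hc.smooth_e μ i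

theorem IsConfiguration.contDiffOn_ω (hc : IsConfiguration U e ω) : ContDiffOn ℝ ∞ ω U :=
  contDiffOn_pi.mpr fun μ => contDiffOn_pi.mpr fun i => contDiffOn_pi.mpr fun j =>
    hc.smooth_ω μ i j

theorem IsConfiguration.contDiffOn_jetMap (hc : IsConfiguration U e ω) (hU : IsOpen U) :
    ContDiffOn ℝ ∞ (jetMap e ω) U := by
  refine (hc.contDiffOn_e.prodMk hc.contDiffOn_ω).prodMk (contDiffOn_pi.mpr fun ν => ?_)
  refine ContDiffOn.prodMk (contDiffOn_pi.mpr fun μ => contDiffOn_pi.mpr fun i => ?_)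
    (contDiffOn_pi.mpr fun μ => contDiffOn_pi.mpr fun i => contDiffOn_pi.mpr fun j => ?_)
  · exact ContDiffOn.pd hU (hc.smooth_e μ i) ν
  · exact ContDiffOn.pd hU (hc.smooth_ω μ i j) ν

theorem IsConfiguration.antisymm_jet (hc : IsConfiguration U e ω) (hU : IsOpen U) {x : Pt}
    (hx : x ∈ U) : (jet e ω x).Antisymm :=
  ⟨hc.antisymm x hx, fun ν μ i j => by
    change pd ν (fun y => ω y μ i j) x = -pd ν (fun y => ω y μ j i) x
    rw [← pd_neg]
    exact pd_congr hU (fun y hy => hc.antisymm y hy μ i j) hx ν⟩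

theorem SmoothLagr.contDiffOn_jet {L : Jet → ℝ} (hL : SmoothLagr L)
    (hc : IsConfiguration U e ω) (hU : IsOpen U) :
    ContDiffOn ℝ ∞ (fun y => L (jet e ω y)) U := fun x hx =>
  (((hL (jetMap e ω x) (hc.det_ne_zero x hx)).comp x
    ((hc.contDiffOn_jetMap hU).contDiffAt (hU.mem_nhds hx)))).contDiffWithinAt

theorem SmoothLagr.differentiableAt_jet {L : Jet → ℝ} (hL : SmoothLagr L)
    (hc : IsConfiguration U e ω) (hU : IsOpen U) {x : Pt} (hx : x ∈ U) :
    DifferentiableAt ℝ (fun y => L (jet e ω y)) x :=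
  ((hL.contDiffOn_jet hc hU).contDiffAt (hU.mem_nhds hx)).differentiableAt (by simp)

theorem SmoothLagr.differentiableAt_fderiv {L : Jet → ℝ} (hL : SmoothLagr L)
    (hc : IsConfiguration U e ω) (hU : IsOpen U) {x : Pt} (hx : x ∈ U) (H : JetSpace) :
    DifferentiableAt ℝ (fun y => fderiv ℝ (fun J => L (toJet J)) (jetMap e ω y) H) x := by
  have h1 : ContDiffAt ℝ ∞ (fderiv ℝ fun J => L (toJet J)) (jetMap e ω x) :=
    (hL (jetMap e ω x) (hc.det_ne_zero x hx)).fderiv_right (by simp)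
  have h2 := (h1.comp x ((hc.contDiffOn_jetMap hU).contDiffAt (hU.mem_nhds hx))).differentiableAt
    (by simp)
  exact h2.clm_apply (differentiableAt_const H)

theorem SmoothLagr.deriv_line {L : Jet → ℝ} (hL : SmoothLagr L) {J : JetSpace}
    (h : RiemannCartan.detE J.1.1 ≠ 0) (H : JetSpace) :
    deriv (fun t : ℝ => L (toJet (J + t • H))) 0 = fderiv ℝ (fun J => L (toJet J)) J H :=
  (hasDerivAt_line_fderiv (hL.differentiableAt h) H).deriv

/-- Passes from the variation of one component to `EL`, whose linearity in the variation permits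
arbitrary directions. -/
theorem elVielbein_eq {L : Jet → ℝ} (hL : SmoothLagr L) (hU : IsOpen U)
    (hc : IsConfiguration U e ω) {x : Pt} (hx : x ∈ U) (μ i : Fin 3) :
    elVielbein L e ω μ i x = EL L e ω (Pi.single μ (Pi.single i 1), 0) x := by
  unfold elVielbein EL
  refine congrArg₂ (· - ·) ?_ (Finset.sum_congr rfl fun ν _ => pd_congr hU (fun y hy => ?_) hx ν)
  · rw [← hL.deriv_line (J := jetMap e ω x) (hc.det_ne_zero x hx)]
    simp [toJet, jetMap, jet]
  · rw [← hL.deriv_line (J := jetMap e ω y) (hc.det_ne_zero y hy)]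
    refine congrArg (fun f => deriv f 0) (funext fun t => congrArg L ?_)
    simp only [toJet, jetMap, jet, Jet.mk.injEq]
    refine ⟨by simp, by simp, ?_, ?_⟩
    · funext ν'
      rcases eq_or_ne ν' ν with rfl | h <;> simp [*]
    · funext ν'
      rcases eq_or_ne ν' ν with rfl | h <;> simp [*]

theorem elConnection_eq {L : Jet → ℝ} (hL : SmoothLagr L) (hU : IsOpen U)
    (hc : IsConfiguration U e ω) {x : Pt} (hx : x ∈ U) (μ i j : Fin 3) :
    elConnection L e ω μ i j x = EL L e ω
      (0, Pi.single μ (Pi.single i (Pi.single j 1) - Pi.single j (Pi.single i 1))) x := by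
  unfold elConnection EL
  refine congrArg₂ (· - ·) ?_ (Finset.sum_congr rfl fun ν _ => pd_congr hU (fun y hy => ?_) hx ν)
  · rw [← hL.deriv_line (J := jetMap e ω x) (hc.det_ne_zero x hx)]
    simp [toJet, jetMap, jet]
  · rw [← hL.deriv_line (J := jetMap e ω y) (hc.det_ne_zero y hy)]
    refine congrArg (fun f => deriv f 0) (funext fun t => congrArg L ?_)
    simp only [toJet, jetMap, jet, Jet.mk.injEq]
    refine ⟨by simp, by simp, ?_, ?_⟩
    · funext ν'
      rcases eq_or_ne ν' ν with rfl | h <;> simp [*]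
    · funext ν'
      rcases eq_or_ne ν' ν with rfl | h <;> simp [*]

end Configuration

section

variable {U : Set Pt} {e : Pt → Vielbein} {ω : Pt → Connection}

/-! ### Linearity of the Euler–Lagrange expression and Lagrangians without Euler–Lagrange expression
-/

theorem EL_add {L M : Jet → ℝ} (hL : SmoothLagr L) (hM : SmoothLagr M) (hU : IsOpen U)
    (hc : IsConfiguration U e ω) {x : Pt} (hx : x ∈ U) (δ : Fld) :
    EL (fun J => L J + M J) e ω δ x = EL L e ω δ x + EL M e ω δ x := by
  have h (y : Pt) (hy : y ∈ U) (H : JetSpace) :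
      fderiv ℝ (fun J => L (toJet J) + M (toJet J)) (jetMap e ω y) H
        = fderiv ℝ (fun J => L (toJet J)) (jetMap e ω y) H
          + fderiv ℝ (fun J => M (toJet J)) (jetMap e ω y) H := by
    rw [fderiv_fun_add (hL.differentiableAt (J := jetMap e ω y) (hc.det_ne_zero y hy))
      (hM.differentiableAt (J := jetMap e ω y) (hc.det_ne_zero y hy))]
    rfl
  unfold EL
  beta_reduce
  rw [h x hx, Finset.sum_congr rfl fun ν _ => (pd_congr hU (fun y hy => h y hy (0, Pi.single ν δ)) hx ν).trans
    (pd_add (hL.differentiableAt_fderiv hc hU hx _) (hM.differentiableAt_fderiv hc hU hx _) ν),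
    Finset.sum_add_distrib]
  ring

theorem EL_const_mul {L : Jet → ℝ} (hL : SmoothLagr L) (hU : IsOpen U)
    (hc : IsConfiguration U e ω) {x : Pt} (hx : x ∈ U) (δ : Fld) (c : ℝ) :
    EL (fun J => c * L J) e ω δ x = c * EL L e ω δ x := by
  have h (y : Pt) (hy : y ∈ U) (H : JetSpace) :
      fderiv ℝ (fun J => c * L (toJet J)) (jetMap e ω y) H
        = c * fderiv ℝ (fun J => L (toJet J)) (jetMap e ω y) H := by
    rw [fderiv_const_mul (hL.differentiableAt (J := jetMap e ω y) (hc.det_ne_zero y hy))]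
    rfl
  unfold EL
  beta_reduce
  rw [h x hx, Finset.sum_congr rfl fun ν _ => (pd_congr hU (fun y hy => h y hy (0, Pi.single ν δ)) hx ν).trans
    (pd_mul (differentiableAt_const c) (hL.differentiableAt_fderiv hc hU hx _) ν)]
  simp only [pd_const, zero_mul, zero_add, ← Finset.mul_sum]
  ring

theorem EL_map_add {L : Jet → ℝ} (hL : SmoothLagr L) (hU : IsOpen U)
    (hc : IsConfiguration U e ω) {x : Pt} (hx : x ∈ U) (δ δ' : Fld) :
    EL L e ω (δ + δ') x = EL L e ω δ x + EL L e ω δ' x := by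
  have h1 : ((δ + δ', 0) : JetSpace) = (δ, 0) + (δ', 0) := by simp
  have h2 (ν) : ((0, Pi.single ν (δ + δ')) : JetSpace)
      = (0, Pi.single ν δ) + (0, Pi.single ν δ') := by simp [Pi.single_add]
  unfold EL
  simp only [h1, h2, map_add]
  rw [Finset.sum_congr rfl fun ν _ =>
    pd_add (hL.differentiableAt_fderiv hc hU hx _) (hL.differentiableAt_fderiv hc hU hx _) ν,
    Finset.sum_add_distrib]
  ring

theorem EL_map_smul {L : Jet → ℝ} (hL : SmoothLagr L) (hU : IsOpen U)
    (hc : IsConfiguration U e ω) {x : Pt} (hx : x ∈ U) (c : ℝ) (δ : Fld) :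
    EL L e ω (c • δ) x = c * EL L e ω δ x := by
  have h1 : ((c • δ, 0) : JetSpace) = c • (δ, 0) := by simp
  have h2 (ν) : ((0, Pi.single ν (c • δ)) : JetSpace) = c • (0, Pi.single ν δ) := by
    simp [Pi.single_smul]
  unfold EL
  simp only [h1, h2, map_smul, smul_eq_mul]
  rw [Finset.sum_congr rfl fun ν _ =>
    pd_mul (differentiableAt_const c) (hL.differentiableAt_fderiv hc hU hx _) ν]
  simp only [pd_const, zero_mul, zero_add, ← Finset.mul_sum]
  ring

/-- Variations of the connection are antisymmetric. -/
def Fld.Antisymm (δ : Fld) : Prop := ∀ μ i j, δ.2 μ i j = -δ.2 μ j i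

theorem Fld.Antisymm.toJet_left {δ : Fld} (h : δ.Antisymm) :
    (toJet ((δ, 0) : JetSpace)).Antisymm :=
  ⟨h, fun _ _ _ _ => by simp [toJet]⟩

theorem Fld.Antisymm.toJet_right {δ : Fld} (h : δ.Antisymm) (ν : Fin 3) :
    (toJet ((0, Pi.single ν δ) : JetSpace)).Antisymm :=
  ⟨fun _ _ _ => by simp [toJet], fun ν' μ i j => by
    rcases eq_or_ne ν' ν with rfl | h'
    · simpa [toJet] using h μ i j
    · simp [toJet, h']⟩

theorem EL_congr {L M : Jet → ℝ} (hU : IsOpen U) {δ : Fld} (hδ : δ.Antisymm)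
    (h : ∀ y ∈ U, ∀ H : JetSpace, (toJet H).Antisymm →
      fderiv ℝ (fun J => L (toJet J)) (jetMap e ω y) H
        = fderiv ℝ (fun J => M (toJet J)) (jetMap e ω y) H) {x : Pt} (hx : x ∈ U) :
    EL L e ω δ x = EL M e ω δ x := by
  unfold EL
  rw [h x hx _ hδ.toJet_left, Finset.sum_congr rfl fun ν _ =>
    pd_congr hU (fun y hy => h y hy _ (hδ.toJet_right ν)) hx ν]

theorem EL_zero (e : Pt → Vielbein) (ω : Pt → Connection) (δ : Fld) (x : Pt) :
    EL (fun _ => 0) e ω δ x = 0 := by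
  simp [EL, pd_const]

/-- Two Lagrangians which agree on jets of configurations have the same Euler–Lagrange
expressions. -/
theorem EL_congr_of_eq {L M : Jet → ℝ} (hL : SmoothLagr L) (hM : SmoothLagr M) (hU : IsOpen U)
    (hc : IsConfiguration U e ω) (h : ∀ J : Jet, detE J.e ≠ 0 → J.Antisymm → L J = M J)
    {δ : Fld} (hδ : δ.Antisymm) {x : Pt} (hx : x ∈ U) : EL L e ω δ x = EL M e ω δ x := by
  refine EL_congr hU hδ (fun y hy H hH => ?_) hx
  have hd : detE (jetMap e ω y).1.1 ≠ 0 := hc.det_ne_zero y hy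
  refine fderiv_eq_of_line (hL.differentiableAt hd) ?_
  refine (hasDerivAt_line_fderiv (hM.differentiableAt hd) H).congr_of_eventuallyEq ?_
  have h1 : ContinuousAt (fun t : ℝ => detE (jetMap e ω y + t • H).1.1) 0 :=
    (contDiff_detE.continuous.comp (by fun_prop)).continuousAt
  filter_upwards [h1.eventually_ne (by simpa using hd)] with t ht
  -- The line through an antisymmetric jet in an antisymmetric direction consists of antisymmetric
  -- jets, so agreement on those alone determines the derivative.
  refine h _ ht ⟨fun μ i j => ?_, fun ν μ i j => ?_⟩
  · have h1 := hc.antisymm y hy μ i j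
    have h2 := hH.ω μ i j
    simp only [toJet] at h2
    simp [toJet, jetMap, h1, h2]
    ring
  · have h1 := (hc.antisymm_jet hU hy).dω ν μ i j
    have h2 := hH.dω ν μ i j
    simp only [toJet] at h2
    simp only [jet] at h1
    simp [toJet, jetMap, h1, h2]
    ring

theorem EL_eq_zero_of_fderiv {L : Jet → ℝ} (hU : IsOpen U)
    (h : ∀ y ∈ U, fderiv ℝ (fun J => L (toJet J)) (jetMap e ω y) = 0) (δ : Fld)
    {x : Pt} (hx : x ∈ U) : EL L e ω δ x = 0 := by
  unfold EL
  rw [h x hx, Finset.sum_congr rfl fun ν _ => (pd_congr hU (g := fun _ => 0)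
    (fun y hy => by rw [h y hy]; rfl) hx ν).trans (pd_const 0 ν x)]
  simp

/-- Terms of second order in quantities that vanish on `U` do not contribute. -/
theorem EL_mul_sum_mul_eq_zero {ι : Type*} {s : Finset ι} {D : Jet → ℝ} {F G : ι → Jet → ℝ}
    (hD : SmoothLagr D) (hF : ∀ i, SmoothLagr (F i)) (hG : ∀ i, SmoothLagr (G i)) (hU : IsOpen U)
    (hc : IsConfiguration U e ω) (hF0 : ∀ y ∈ U, ∀ i, F i (jet e ω y) = 0)
    (hG0 : ∀ y ∈ U, ∀ i, G i (jet e ω y) = 0) (δ : Fld) {x : Pt} (hx : x ∈ U) :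
    EL (fun J => D J * ∑ i ∈ s, F i J * G i J) e ω δ x = 0 := by
  refine EL_eq_zero_of_fderiv hU (fun y hy => ?_) δ hx
  have hd : detE (jetMap e ω y).1.1 ≠ 0 := hc.det_ne_zero y hy
  have hF1 (i) : F i (toJet (jetMap e ω y)) = 0 := hF0 y hy i
  have hG1 (i) : G i (toJet (jetMap e ω y)) = 0 := hG0 y hy i
  have h1 : HasFDerivAt (fun J : JetSpace => ∑ i ∈ s, F i (toJet J) * G i (toJet J))
      (∑ i ∈ s, (0 : JetSpace →L[ℝ] ℝ)) (jetMap e ω y) := by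
    refine HasFDerivAt.fun_sum fun i _ => ?_
    simpa [hF1, hG1] using
      ((hF i).differentiableAt hd).hasFDerivAt.fun_mul ((hG i).differentiableAt hd).hasFDerivAt
  simpa [hF1, hG1] using ((hD.differentiableAt hd).hasFDerivAt.fun_mul h1).fderiv

/-- The Lagrangian `∂_μ V^μ(e, ω)`. -/
def divLagr (V : Fin 3 → Fld → ℝ) (J : Jet) : ℝ :=
  ∑ μ, fderiv ℝ (V μ) (J.e, J.ω) (J.de μ, J.dω μ)

theorem SmoothLagr.divLagr {V : Fin 3 → Fld → ℝ}
    (hV : ∀ μ (φ : Fld), RiemannCartan.detE φ.1 ≠ 0 → ContDiffAt ℝ ∞ (V μ) φ) :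
    SmoothLagr (divLagr V) := fun J h => by
  refine ContDiffAt.sum fun μ _ => ?_
  have h1 : ContDiffAt ℝ ∞ (fderiv ℝ (V μ)) J.1 := (hV μ J.1 h).fderiv_right (by simp)
  exact (h1.comp J contDiff_fst.contDiffAt).clm_apply
    (((contDiff_apply ℝ Fld μ).comp contDiff_snd).contDiffAt)

theorem IsConfiguration.hasDerivAt_fld (hc : IsConfiguration U e ω) (hU : IsOpen U) {x : Pt}
    (hx : x ∈ U) (ν : Fin 3) :
    HasDerivAt (fun t : ℝ => ((e (x + t • Pi.single ν 1), ω (x + t • Pi.single ν 1)) : Fld))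
      ((jetMap e ω x).2 ν) 0 := by
  refine HasDerivAt.prodMk (hasDerivAt_pi.mpr fun μ => hasDerivAt_pi.mpr fun i => ?_)
    (hasDerivAt_pi.mpr fun μ => hasDerivAt_pi.mpr fun i => hasDerivAt_pi.mpr fun j => ?_)
  · exact hasDerivAt_line_pd
      (((hc.smooth_e μ i).contDiffAt (hU.mem_nhds hx)).differentiableAt (by simp)) ν
  · exact hasDerivAt_line_pd
      (((hc.smooth_ω μ i j).contDiffAt (hU.mem_nhds hx)).differentiableAt (by simp)) ν

theorem IsConfiguration.contDiffAt_fld (hc : IsConfiguration U e ω) (hU : IsOpen U) {x : Pt}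
    (hx : x ∈ U) : ContDiffAt ℝ ∞ (fun y => ((e y, ω y) : Fld)) x :=
  (hc.contDiffOn_e.prodMk hc.contDiffOn_ω).contDiffAt (hU.mem_nhds hx)

theorem pd_comp_fld {f : Fld → ℝ} (hU : IsOpen U) (hc : IsConfiguration U e ω) {x : Pt}
    (hx : x ∈ U) (hf : DifferentiableAt ℝ f (e x, ω x)) (ν : Fin 3) :
    pd ν (fun y => f (e y, ω y)) x = fderiv ℝ f (e x, ω x) ((jetMap e ω x).2 ν) := by
  refine pd_eq_of_line (hf.comp x ((hc.contDiffAt_fld hU hx).differentiableAt (by simp))) ?_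
  have hf' : HasFDerivAt f (fderiv ℝ f (e x, ω x))
      (e (x + (0 : ℝ) • Pi.single ν 1), ω (x + (0 : ℝ) • Pi.single ν 1)) := by
    simpa using hf.hasFDerivAt
  exact hf'.comp_hasDerivAt (0 : ℝ) (hc.hasDerivAt_fld hU hx ν)

/-- The Euler–Lagrange expressions of a total divergence vanish. -/
theorem EL_divLagr {V : Fin 3 → Fld → ℝ}
    (hV : ∀ μ (φ : Fld), detE φ.1 ≠ 0 → ContDiffAt ℝ ∞ (V μ) φ) (hU : IsOpen U)
    (hc : IsConfiguration U e ω) (δ : Fld) {x : Pt} (hx : x ∈ U) :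
    EL (divLagr V) e ω δ x = 0 := by
  have hD (φ : Fld) (h : detE φ.1 ≠ 0) (μ) : DifferentiableAt ℝ (fderiv ℝ (V μ)) φ :=
    ((hV μ φ h).fderiv_right (m := ∞) (by simp)).differentiableAt (by simp)
  have key (J : JetSpace) (h : detE J.1.1 ≠ 0) (H : JetSpace) :
      fderiv ℝ (fun J => divLagr V (toJet J)) J H
        = ∑ μ, (fderiv ℝ (fderiv ℝ (V μ)) J.1 H.1 (J.2 μ) + fderiv ℝ (V μ) J.1 (H.2 μ)) := by
    refine fderiv_eq_of_line ((SmoothLagr.divLagr hV).differentiableAt h) ?_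
    refine HasDerivAt.fun_sum fun μ _ => ?_
    have h3 := (hasDerivAt_line_fderiv (hD J.1 h μ) H.1).clm_apply (hasDerivAt_line (J.2 μ) (H.2 μ))
    simp only [zero_smul, add_zero] at h3
    exact h3
  have h0 (y) (hy : y ∈ U) : detE (jetMap e ω y).1.1 ≠ 0 := hc.det_ne_zero y hy
  unfold EL
  rw [key _ (h0 x hx), ← Finset.sum_sub_distrib]
  refine Finset.sum_eq_zero fun ν _ => ?_
  have hx' : DifferentiableAt ℝ (fderiv ℝ (V ν)) (e x, ω x) := hD _ (h0 x hx) ν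
  rw [pd_congr hU (g := fun y => fderiv ℝ (V ν) (e y, ω y) δ) (fun y hy => ?_) hx,
    pd_comp_fld (f := fun φ => fderiv ℝ (V ν) φ δ) hU hc hx
      (hx'.clm_apply (differentiableAt_const _)),
    fderiv_eq_of_line (hx'.clm_apply (differentiableAt_const _))
      ((hasDerivAt_line_fderiv hx' _).clm_apply (hasDerivAt_const _ _))]
  -- The first term of `EL` is the second derivative of V at (δ, ∂_ν φ), where φ is the pair of
  -- fields; the divergence subtracts it at (∂_ν φ, δ).
  · have hs : IsSymmSndFDerivAt ℝ (V ν) (e x, ω x) :=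
      ((hV ν (e x, ω x) (h0 x hx)).of_le (m := 2)
        (WithTop.coe_le_coe.mpr (le_top : (2 : ℕ∞) ≤ ⊤))).isSymmSndFDerivAt (by simp)
    have h5 := hs δ ((jetMap e ω x).2 ν)
    simp only [jetMap] at h5 ⊢
    simp [h5]
  · rw [key _ (h0 y hy), Finset.sum_eq_single ν]
    · simp [jetMap]
    · intro b _ hb
      simp [hb]
    · simp

end

/-! ### The divergence contained in the distinguished Lagrangian -/

theorem hasDerivAt_detE_line {e : Vielbein} (h : detE e ≠ 0) (a : Vielbein) :
    HasDerivAt (fun t : ℝ => detE (e + t • a))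
      (detE e * ∑ μ, ∑ i, invE e μ i * a μ i) 0 := by
  rw [← fderiv_detE h]
  exact hasDerivAt_line_fderiv (contDiff_detE.differentiable (by simp) _) a

theorem hasDerivAt_invE_line {e : Vielbein} (h : detE e ≠ 0) (a : Vielbein) (μ i : Fin 3) :
    HasDerivAt (fun t : ℝ => invE (e + t • a) μ i)
      (-∑ l, ∑ k, invE e μ k * invE e l i * a l k) 0 := by
  rw [← fderiv_invE h]
  exact hasDerivAt_line_fderiv ((contDiffAt_invE h μ i).differentiableAt (by simp)) a

/-- The vector density `e e^μ_j e^ν_i ω_ν^{ji}`. -/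
def divVec (μ : Fin 3) (φ : Fld) : ℝ :=
  detE φ.1 * ∑ ν, ∑ j, ∑ i, invE φ.1 μ j * invE φ.1 ν i * φ.2 ν j i

theorem contDiffAt_divVec (μ : Fin 3) (φ : Fld) (h : detE φ.1 ≠ 0) :
    ContDiffAt ℝ ∞ (divVec μ) φ := by
  have hi (μ i) : ContDiffAt ℝ ∞ (fun φ : Fld => invE φ.1 μ i) φ :=
    (contDiffAt_invE h μ i).comp φ contDiff_fst.contDiffAt
  refine (contDiff_detE.contDiffAt.comp φ contDiff_fst.contDiffAt).mul ?_
  refine ContDiffAt.sum fun ν _ => ContDiffAt.sum fun j _ => ContDiffAt.sum fun i _ => ?_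
  exact ((hi _ _).mul (hi _ _)).mul (by fun_prop)

theorem fderiv_divVec (μ : Fin 3) (φ : Fld) (h : detE φ.1 ≠ 0) (δ : Fld) :
    fderiv ℝ (divVec μ) φ δ = detE φ.1 * ((∑ ν, ∑ i, invE φ.1 ν i * δ.1 ν i)
      * (∑ ν, ∑ j, ∑ i, invE φ.1 μ j * invE φ.1 ν i * φ.2 ν j i)
      + ∑ ν, ∑ j, ∑ i, (invE φ.1 μ j * invE φ.1 ν i * δ.2 ν j i
        - (∑ l, ∑ k, invE φ.1 μ k * invE φ.1 l j * δ.1 l k) * invE φ.1 ν i * φ.2 ν j i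
        - invE φ.1 μ j * (∑ l, ∑ k, invE φ.1 ν k * invE φ.1 l i * δ.1 l k) * φ.2 ν j i)) := by
  refine fderiv_eq_of_line ((contDiffAt_divVec μ φ h).differentiableAt (by simp)) ?_
  have hω (ν j i) : HasDerivAt (fun t : ℝ => (φ + t • δ).2 ν j i) (δ.2 ν j i) 0 := by
    simpa using ((hasDerivAt_id (0 : ℝ)).mul_const (δ.2 ν j i)).const_add (φ.2 ν j i)
  have h1 := (hasDerivAt_detE_line h δ.1).fun_mul (HasDerivAt.fun_sum
    (u := Finset.univ) fun ν _ => HasDerivAt.fun_sum (u := Finset.univ) fun j _ =>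
    HasDerivAt.fun_sum (u := Finset.univ) fun i _ =>
    (((hasDerivAt_invE_line h δ.1 μ j).fun_mul (hasDerivAt_invE_line h δ.1 ν i)).fun_mul
      (hω ν j i)))
  refine h1.congr_deriv ?_
  simp only [zero_smul, add_zero]
  rw [mul_add (detE φ.1), ← mul_assoc]
  congr 2
  refine Finset.sum_congr rfl fun ν _ => Finset.sum_congr rfl fun j _ =>
    Finset.sum_congr rfl fun i _ => ?_
  ring

theorem divLagr_divVec (J : Jet) (h : detE J.e ≠ 0) : divLagr divVec J = divTerm J := by
  simp only [divLagr, divTerm, fderiv_divVec _ (J.e, J.ω) h, ← Finset.mul_sum]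
  congr 1
  simp only [frameDE, frameω, frameDω]
  generalize invE J.e = v
  generalize J.ω = w
  generalize J.de = d
  generalize J.dω = dw
  simp only [Fin.sum_univ_three]
  ring

/-! ### The terms of the Lagrangian -/

/-- Only the scalar curvature. -/
def Params.hilbert (κ : ℝ) : Params := ⟨κ, 0, 0, 0, 0, 0, 0, 0⟩

/-- Only the terms quadratic in torsion. -/
def Params.torsionTerms (b₁ b₂ b₃ : ℝ) : Params := ⟨0, b₁, b₂, b₃, 0, 0, 0, 0⟩

/-- Only the terms quadratic in curvature. -/
def Params.curvatureTerms (c₁ c₂ c₃ : ℝ) : Params := ⟨0, 0, 0, 0, c₁, c₂, c₃, 0⟩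

/-- Only the cosmological constant. -/
def Params.cosmological (Λ : ℝ) : Params := ⟨0, 0, 0, 0, 0, 0, 0, Λ⟩

theorem lagrangian_hilbert (κ : ℝ) (J : Jet) :
    lagrangian (Params.hilbert κ) J = -κ * (detE J.e * scalarCurv J) := by
  simp [lagrangian, Params.hilbert]
  ring

theorem lagrangian_cosmological (Λ : ℝ) (J : Jet) :
    lagrangian (Params.cosmological Λ) J = -Λ * detE J.e := by
  simp [lagrangian, Params.cosmological]
  ring

theorem lagrangian_torsionTerms (b₁ b₂ b₃ : ℝ) (J : Jet) :
    lagrangian (Params.torsionTerms b₁ b₂ b₃) J = detE J.e * ∑ x : Fin 3 × Fin 3 × Fin 3,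
      torsionL J x.1 x.2.1 x.2.2 * ((1 / 4) * (b₁ * torsionL J x.1 x.2.1 x.2.2
        + b₂ * torsionL J x.2.2 x.1 x.2.1
        + b₃ * (tracePart (torsionL J) x.2.1 * kron x.1 x.2.2))) := by
  simp only [lagrangian, Params.torsionTerms, Fintype.sum_prod_type, Finset.mul_sum]
  simp only [neg_zero, zero_mul, add_zero, mul_zero, Finset.sum_const_zero, zero_add, sub_zero,
    Finset.mul_sum]
  refine Finset.sum_congr rfl fun _ _ => Finset.sum_congr rfl fun _ _ =>
    Finset.sum_congr rfl fun _ _ => ?_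
  ring

theorem lagrangian_curvatureTerms (c₁ c₂ c₃ : ℝ) (J : Jet) :
    lagrangian (Params.curvatureTerms c₁ c₂ c₃) J =
      detE J.e * ∑ x : Fin 3 × Fin 3 × Fin 3 × Fin 3,
      curvatureL J x.1 x.2.1 x.2.2.1 x.2.2.2 *
        ((1 / 4) * (c₁ * curvatureL J x.1 x.2.1 x.2.2.1 x.2.2.2
        + c₂ * curvatureL J x.2.2.1 x.2.2.2 x.1 x.2.1
        + c₃ * (ricci J x.1 x.2.2.1 * kron x.2.1 x.2.2.2))) := by
  simp only [lagrangian, Params.curvatureTerms, Fintype.sum_prod_type, Finset.mul_sum]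
  simp only [neg_zero, zero_mul, add_zero, mul_zero, Finset.sum_const_zero, zero_add, sub_zero,
    Finset.mul_sum]
  refine Finset.sum_congr rfl fun _ _ => Finset.sum_congr rfl fun _ _ =>
    Finset.sum_congr rfl fun _ _ => Finset.sum_congr rfl fun _ _ => ?_
  ring

theorem lagrangian_einstein_eq (κ : ℝ) (J : Jet) : lagrangian (Params.einstein κ) J =
    lagrangian (Params.hilbert κ) J
      + lagrangian (Params.torsionTerms (-κ) (2 * κ) (4 * κ)) J := by
  simp [lagrangian, Params.einstein, Params.hilbert, Params.torsionTerms]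
  ring

theorem lagrangian_eq (p : Params) (J : Jet) : lagrangian p J =
    lagrangian (Params.einstein p.κ) J
      + lagrangian (Params.torsionTerms (p.β₁ + p.κ) (p.β₂ - 2 * p.κ) (p.β₃ - 4 * p.κ)) J
      + lagrangian (Params.curvatureTerms p.γ₁ p.γ₂ p.γ₃) J
      + lagrangian (Params.cosmological p.Λ) J := by
  have h : ∀ i j k, torsionL J i j k * (p.β₁ * torsionL J i j k + p.β₂ * torsionL J k i j
        + p.β₃ * tracePart (torsionL J) j * kron i k)
      = torsionL J i j k * (-p.κ * torsionL J i j k + 2 * p.κ * torsionL J k i j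
        + 4 * p.κ * tracePart (torsionL J) j * kron i k)
      + torsionL J i j k * ((p.β₁ + p.κ) * torsionL J i j k
        + (p.β₂ - 2 * p.κ) * torsionL J k i j
        + (p.β₃ - 4 * p.κ) * tracePart (torsionL J) j * kron i k) := fun i j k => by ring
  simp only [lagrangian, Params.einstein, Params.torsionTerms, Params.curvatureTerms,
    Params.cosmological, h, Finset.sum_add_distrib]
  simp
  ring

section

variable {U : Set Pt} {e : Pt → Vielbein} {ω : Pt → Connection}

/-! ### The Euler–Lagrange expressions of the separate terms -/

theorem IsConfiguration.detE_ne_zero (hc : IsConfiguration U e ω) {x : Pt} (hx : x ∈ U) :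
    detE (e x) ≠ 0 := hc.det_ne_zero x hx

theorem EL_lagrangian (p : Params) (hU : IsOpen U) (hc : IsConfiguration U e ω) (δ : Fld)
    {x : Pt} (hx : x ∈ U) : EL (lagrangian p) e ω δ x =
    EL (lagrangian (Params.einstein p.κ)) e ω δ x
      + EL (lagrangian (Params.torsionTerms (p.β₁ + p.κ) (p.β₂ - 2 * p.κ) (p.β₃ - 4 * p.κ)))
        e ω δ x
      + EL (lagrangian (Params.curvatureTerms p.γ₁ p.γ₂ p.γ₃)) e ω δ x
      + EL (lagrangian (Params.cosmological p.Λ)) e ω δ x := by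
  have s := SmoothLagr.lagrangian
  rw [← EL_add (s _) (s _) hU hc hx, ← EL_add ((s _).add (s _)) (s _) hU hc hx,
    ← EL_add (((s _).add (s _)).add (s _)) (s _) hU hc hx]
  exact congrArg (fun L => EL L e ω δ x) (funext fun J => lagrangian_eq p J)

theorem EL_einstein (κ : ℝ) (hU : IsOpen U) (hc : IsConfiguration U e ω) (δ : Fld)
    {x : Pt} (hx : x ∈ U) : EL (lagrangian (Params.einstein κ)) e ω δ x =
    EL (lagrangian (Params.hilbert κ)) e ω δ x
      + EL (lagrangian (Params.torsionTerms (-κ) (2 * κ) (4 * κ))) e ω δ x := by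
  have s := SmoothLagr.lagrangian
  rw [← EL_add (s _) (s _) hU hc hx]
  exact congrArg (fun L => EL L e ω δ x) (funext fun J => lagrangian_einstein_eq κ J)

theorem TorsionFree.torsionL (hT : TorsionFree U e ω) {x : Pt} (hx : x ∈ U) (i j k : Fin 3) :
    torsionL (jet e ω x) i j k = 0 := by
  simp [RiemannCartan.torsionL, hT x hx]

theorem CurvatureFree.curvatureL (hR : CurvatureFree U e ω) {x : Pt} (hx : x ∈ U)
    (i j k l : Fin 3) : curvatureL (jet e ω x) i j k l = 0 := by
  simp [RiemannCartan.curvatureL, hR x hx]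

theorem EL_torsionTerms_eq_zero (hT : TorsionFree U e ω) (hU : IsOpen U)
    (hc : IsConfiguration U e ω) (b₁ b₂ b₃ : ℝ) (δ : Fld) {x : Pt} (hx : x ∈ U) :
    EL (lagrangian (Params.torsionTerms b₁ b₂ b₃)) e ω δ x = 0 := by
  rw [funext (lagrangian_torsionTerms b₁ b₂ b₃)]
  refine EL_mul_sum_mul_eq_zero SmoothLagr.detE (fun i => SmoothLagr.torsionL _ _ _) (fun i => ?_)
    hU hc (fun y hy i => hT.torsionL hy _ _ _) (fun y hy i => ?_) δ hx
  · exact .mul (.const _) (.add (.add (.mul (.const _) (.torsionL _ _ _))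
      (.mul (.const _) (.torsionL _ _ _))) (.mul (.const _) (.mul (.tracePart _) (.const _))))
  · simp [hT.torsionL hy, tracePart]

theorem EL_curvatureTerms_eq_zero (hR : CurvatureFree U e ω) (hU : IsOpen U)
    (hc : IsConfiguration U e ω) (c₁ c₂ c₃ : ℝ) (δ : Fld) {x : Pt} (hx : x ∈ U) :
    EL (lagrangian (Params.curvatureTerms c₁ c₂ c₃)) e ω δ x = 0 := by
  rw [funext (lagrangian_curvatureTerms c₁ c₂ c₃)]
  refine EL_mul_sum_mul_eq_zero SmoothLagr.detE (fun i => SmoothLagr.curvatureL _ _ _ _)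
    (fun i => ?_) hU hc (fun y hy i => hR.curvatureL hy _ _ _ _) (fun y hy i => ?_) δ hx
  · exact .mul (.const _) (.add (.add (.mul (.const _) (.curvatureL _ _ _ _))
      (.mul (.const _) (.curvatureL _ _ _ _))) (.mul (.const _) (.mul (.ricci _ _) (.const _))))
  · simp [hR.curvatureL hy, ricci]

theorem SmoothLagr.dropω {L : Jet → ℝ} (hL : SmoothLagr L) : SmoothLagr fun J => L J.dropω := by
  intro J h
  have h1 : ContDiffAt ℝ ∞ (fun J : JetSpace => (((J.1.1, 0), fun ν => ((J.2 ν).1, 0)) : JetSpace))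
      J := by fun_prop
  exact ContDiffAt.comp J (g := fun J => L (toJet J)) (hL ((J.1.1, 0), fun ν => ((J.2 ν).1, 0)) h) h1

theorem EL_einstein_eq_dropω (κ : ℝ) (hU : IsOpen U) (hc : IsConfiguration U e ω) {δ : Fld}
    (hδ : δ.Antisymm) {x : Pt} (hx : x ∈ U) :
    EL (lagrangian (Params.einstein κ)) e ω δ x
      = EL (fun J => lagrangian (Params.einstein κ) J.dropω) e ω δ x := by
  have s := SmoothLagr.lagrangian (Params.einstein κ)
  have sd := SmoothLagr.divLagr contDiffAt_divVec
  rw [EL_congr_of_eq s (s.dropω.add ((SmoothLagr.const (-2 * κ)).mul sd)) hU hc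
    (fun J h hJ => ?_) hδ hx, EL_add s.dropω ((SmoothLagr.const _).mul sd) hU hc hx,
    EL_const_mul sd hU hc hx, EL_divLagr contDiffAt_divVec hU hc δ hx]
  · ring
  · rw [lagrangian_einstein κ h hJ, divLagr_divVec J h]
    ring

/-- The connection equation of the distinguished first-order Lagrangian is an identity. -/
theorem EL_einstein_connection (κ : ℝ) (hU : IsOpen U) (hc : IsConfiguration U e ω)
    {b : Connection} (hb : Fld.Antisymm (0, b)) {x : Pt} (hx : x ∈ U) :
    EL (lagrangian (Params.einstein κ)) e ω (0, b) x = 0 := by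
  rw [EL_einstein_eq_dropω κ hU hc hb hx]
  have s := (SmoothLagr.lagrangian (Params.einstein κ)).dropω
  have h1 (y) (hy : y ∈ U) (H : JetSpace) (h0 : H.1.1 = 0) (h2 : ∀ ν, (H.2 ν).1 = 0) :
      fderiv ℝ (fun J => lagrangian (Params.einstein κ) (toJet J).dropω) (jetMap e ω y) H = 0 := by
    refine fderiv_eq_of_line (s.differentiableAt (J := jetMap e ω y) (hc.det_ne_zero y hy)) ?_
    refine (hasDerivAt_const (0 : ℝ) (lagrangian (Params.einstein κ)
      (toJet (jetMap e ω y)).dropω)).congr_of_eventuallyEq (Filter.Eventually.of_forall fun t => ?_)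
    simp [toJet, Jet.dropω, h0, h2]
  unfold EL
  rw [h1 x hx _ rfl fun _ => rfl, Finset.sum_congr rfl fun ν _ => (pd_congr hU (g := fun _ => 0)
    (fun y hy => h1 y hy _ rfl fun ν' => ?_) hx ν).trans (pd_const 0 ν x)]
  · simp
  · rcases eq_or_ne ν' ν with rfl | h <;> simp [*]

/-- The vielbein equation of the distinguished first-order Lagrangian does not involve the
connection. -/
theorem EL_einstein_vielbein (κ : ℝ) (hU : IsOpen U) {ω' : Pt → Connection}
    (hc : IsConfiguration U e ω) (hc' : IsConfiguration U e ω') (a : Vielbein) {x : Pt}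
    (hx : x ∈ U) : EL (lagrangian (Params.einstein κ)) e ω (a, 0) x
      = EL (lagrangian (Params.einstein κ)) e ω' (a, 0) x := by
  have ha : Fld.Antisymm (a, 0) := fun _ _ _ => by simp
  rw [EL_einstein_eq_dropω κ hU hc ha hx, EL_einstein_eq_dropω κ hU hc' ha hx]
  have s := (SmoothLagr.lagrangian (Params.einstein κ)).dropω
  have h1 (y) (hy : y ∈ U) (H : JetSpace) :
      fderiv ℝ (fun J => lagrangian (Params.einstein κ) (toJet J).dropω) (jetMap e ω y) H
        = fderiv ℝ (fun J => lagrangian (Params.einstein κ) (toJet J).dropω) (jetMap e ω' y) H := by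
    refine fderiv_eq_of_line (s.differentiableAt (J := jetMap e ω y) (hc.det_ne_zero y hy)) ?_
    exact hasDerivAt_line_fderiv
      (s.differentiableAt (J := jetMap e ω' y) (hc'.det_ne_zero y hy)) H
  unfold EL
  beta_reduce
  rw [h1 x hx, Finset.sum_congr rfl fun ν _ => pd_congr hU (fun y hy => h1 y hy _) hx ν]

/-- A Lagrangian that does not depend on the derivatives. -/
theorem EL_vielbein_of_line {L : Jet → ℝ} (hL : SmoothLagr L) (hU : IsOpen U)
    (hc : IsConfiguration U e ω) (hde : ∀ J d, L { J with de := d } = L J) (a : Vielbein) {x : Pt}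
    (hx : x ∈ U) {d : ℝ}
    (hd : HasDerivAt (fun t : ℝ => L { jet e ω x with e := e x + t • a }) d 0) :
    EL L e ω (a, 0) x = d := by
  have h1 (y) (hy : y ∈ U) (ν : Fin 3) :
      fderiv ℝ (fun J => L (toJet J)) (jetMap e ω y) (0, Pi.single ν (a, 0)) = 0 := by
    refine fderiv_eq_of_line (hL.differentiableAt (J := jetMap e ω y) (hc.det_ne_zero y hy)) ?_
    refine (hasDerivAt_const (0 : ℝ) (L (toJet (jetMap e ω y)))).congr_of_eventuallyEq
      (Filter.Eventually.of_forall fun t => ?_)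
    rw [← hde (toJet (jetMap e ω y)) (toJet (jetMap e ω y + t • (0, Pi.single ν (a, 0)))).de]
    refine congrArg L ?_
    simp only [toJet, Jet.mk.injEq]
    refine ⟨by simp, by simp, trivial, ?_⟩
    funext ν'
    rcases eq_or_ne ν' ν with rfl | h <;> simp [*]
  have h2 : fderiv ℝ (fun J => L (toJet J)) (jetMap e ω x) ((a, 0), 0) = d := by
    refine fderiv_eq_of_line (hL.differentiableAt (J := jetMap e ω x) (hc.det_ne_zero x hx)) ?_
    refine hd.congr_of_eventuallyEq (Filter.Eventually.of_forall fun t => ?_)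
    simp [toJet, jetMap, jet]
  unfold EL
  rw [h2, Finset.sum_congr rfl fun ν _ => (pd_congr hU (g := fun _ => 0)
    (fun y hy => h1 y hy ν) hx ν).trans (pd_const 0 ν x)]
  simp

theorem EL_cosmological (Λ : ℝ) (hU : IsOpen U) (hc : IsConfiguration U e ω) (a : Vielbein)
    {x : Pt} (hx : x ∈ U) : EL (lagrangian (Params.cosmological Λ)) e ω (a, 0) x
      = -Λ * (detE (e x) * ∑ μ, ∑ i, invE (e x) μ i * a μ i) := by
  refine EL_vielbein_of_line (SmoothLagr.lagrangian _) hU hc (fun J d => ?_) a hx ?_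
  · simp only [lagrangian_cosmological]
  · simp only [lagrangian_cosmological]
    exact (hasDerivAt_detE_line (hc.detE_ne_zero hx) a).const_mul _

theorem EL_cosmological_connection (Λ : ℝ) (hU : IsOpen U) (hc : IsConfiguration U e ω)
    (b : Connection) {x : Pt} (hx : x ∈ U) :
    EL (lagrangian (Params.cosmological Λ)) e ω (0, b) x = 0 := by
  have h1 (y) (hy : y ∈ U) (H : JetSpace) (hH : H.1.1 = 0) :
      fderiv ℝ (fun J => lagrangian (Params.cosmological Λ) (toJet J)) (jetMap e ω y) H = 0 := by
    refine fderiv_eq_of_line ((SmoothLagr.lagrangian _).differentiableAt (J := jetMap e ω y)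
      (hc.det_ne_zero y hy)) ?_
    refine (hasDerivAt_const (0 : ℝ) (-Λ * detE (e y))).congr_of_eventuallyEq
      (Filter.Eventually.of_forall fun t => ?_)
    simp [lagrangian_cosmological, toJet, jetMap, hH]
  unfold EL
  rw [h1 x hx _ rfl, Finset.sum_congr rfl fun ν _ => (pd_congr hU (g := fun _ => 0)
    (fun y hy => h1 y hy _ rfl) hx ν).trans (pd_const 0 ν x)]
  simp

theorem curvatureL_antisymm_left (J : Jet) (i j k l : Fin 3) :
    curvatureL J i j k l = -curvatureL J j i k l := by
  rw [curvatureL_eq, curvatureL_eq]; ring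

theorem Jet.Antisymm.curvatureL {J : Jet} (h : J.Antisymm) (i j k l : Fin 3) :
    curvatureL J i j k l = -curvatureL J i j l k := by
  rw [curvatureL_eq, curvatureL_eq, h.frameDω i j k l, h.frameDω j i k l]
  have h1 (i j k l : Fin 3) : ∑ m, RiemannCartan.frameω J i k m * RiemannCartan.frameω J j m l
      = ∑ m, RiemannCartan.frameω J j l m * RiemannCartan.frameω J i m k :=
    Finset.sum_congr rfl fun m _ => by rw [h.frameω i k m, h.frameω j m l]; ring
  rw [h1 i j k l, h1 j i k l]
  ring

/-- At fixed ω the vielbein enters through its determinant and the two inverse vielbeins that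
contract the curvature, and not through its derivatives, so the variation is algebraic. The
antisymmetry of the curvature in both index pairs makes the two inverse vielbeins contribute
equally, whence the factor 2. -/
theorem EL_hilbert (κ : ℝ) (hU : IsOpen U) (hc : IsConfiguration U e ω) (a : Vielbein)
    {x : Pt} (hx : x ∈ U) : EL (lagrangian (Params.hilbert κ)) e ω (a, 0) x
      = -κ * (detE (e x) * ((∑ μ, ∑ i, invE (e x) μ i * a μ i) * scalarCurv (jet e ω x)
        - 2 * ∑ i, ∑ k, (∑ μ, invE (e x) μ i * a μ k) * ricci (jet e ω x) k i)) := by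
  have h := hc.detE_ne_zero hx
  refine EL_vielbein_of_line (SmoothLagr.lagrangian _) hU hc (fun J d => ?_) a hx ?_
  · simp only [lagrangian_hilbert]
    rfl
  · simp only [lagrangian_hilbert]
    have h1 := (hasDerivAt_detE_line h a).fun_mul (HasDerivAt.fun_sum
      (u := Finset.univ) fun i _ => HasDerivAt.fun_sum (u := Finset.univ) fun j _ =>
      HasDerivAt.fun_sum (u := Finset.univ) fun μ _ =>
      HasDerivAt.fun_sum (u := Finset.univ) fun ν _ =>
      (((hasDerivAt_const (0 : ℝ) (curvature (jet e ω x) μ ν i j)).fun_mul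
        (hasDerivAt_invE_line h a μ i)).fun_mul (hasDerivAt_invE_line h a ν j)))
    refine (h1.const_mul (-κ)).congr_deriv ?_
    simp only [zero_smul, add_zero]
    have h2 : ∑ i, ∑ j, ∑ μ, ∑ ν, curvature (jet e ω x) μ ν i j * invE (e x) μ i * invE (e x) ν j
        = scalarCurv (jet e ω x) := rfl
    have h3 : ∑ i, ∑ k, (∑ μ, invE (e x) μ i * a μ k) * ricci (jet e ω x) k i
        = ∑ i, ∑ j, ∑ μ, ∑ ν, curvature (jet e ω x) μ ν i j
          * (∑ l, ∑ k, invE (e x) μ k * invE (e x) l i * a l k) * invE (e x) ν j := by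
      simp only [ricci, curvatureL]
      change ∑ i, ∑ k, (∑ μ, invE (e x) μ i * a μ k) * ∑ j, ∑ μ, ∑ ν,
        curvature (jet e ω x) μ ν i j * invE (e x) μ k * invE (e x) ν j = _
      generalize curvature (jet e ω x) = R
      generalize invE (e x) = v
      simp only [Fin.sum_univ_three]
      ring
    have h4 : ∑ i, ∑ k, (∑ μ, invE (e x) μ i * a μ k) * ricci (jet e ω x) k i
        = ∑ i, ∑ j, ∑ μ, ∑ ν, curvature (jet e ω x) μ ν i j * invE (e x) μ i
          * (∑ l, ∑ k, invE (e x) ν k * invE (e x) l j * a l k) := by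
      have h5 (i k) : ricci (jet e ω x) k i = ∑ j, curvatureL (jet e ω x) j k j i :=
        Finset.sum_congr rfl fun j _ => by
          rw [curvatureL_antisymm_left, (hc.antisymm_jet hU hx).curvatureL]; ring
      simp only [h5, curvatureL]
      change ∑ i, ∑ k, (∑ μ, invE (e x) μ i * a μ k) * ∑ j, ∑ μ, ∑ ν,
        curvature (jet e ω x) μ ν j i * invE (e x) μ j * invE (e x) ν k = _
      generalize curvature (jet e ω x) = R
      generalize invE (e x) = v
      simp only [Fin.sum_univ_three]
      ring
    rw [h2, two_mul]
    nth_rewrite 1 [h3]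
    rw [h4]
    simp only [zero_mul, mul_neg, neg_mul, zero_add, Finset.sum_add_distrib,
      Finset.sum_neg_distrib]
    ring

end

section

variable {U : Set Pt} {e : Pt → Vielbein} {ω : Pt → Connection}

/-! ### The Levi-Civita connection -/

theorem invMetric_eq (e : Pt → Vielbein) (x : Pt) (μ ν : Fin 3) :
    invMetric e x μ ν = ∑ i, invE (e x) μ i * invE (e x) ν i := by
  have h1 : Matrix.of (metric e x) = Matrix.of (e x) * (Matrix.of (e x)).transpose := by
    ext μ ν
    simp [metric, Matrix.mul_apply]
  unfold invMetric invE
  rw [h1, Matrix.mul_inv_rev, ← Matrix.transpose_nonsing_inv, Matrix.mul_apply]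
  simp [Matrix.transpose_apply]

theorem IsConfiguration.differentiableAt_e (hc : IsConfiguration U e ω) (hU : IsOpen U) {x : Pt}
    (hx : x ∈ U) (μ i : Fin 3) : DifferentiableAt ℝ (fun y => e y μ i) x :=
  ((hc.smooth_e μ i).contDiffAt (hU.mem_nhds hx)).differentiableAt (by simp)

theorem IsConfiguration.differentiableAt_ω (hc : IsConfiguration U e ω) (hU : IsOpen U) {x : Pt}
    (hx : x ∈ U) (μ i j : Fin 3) : DifferentiableAt ℝ (fun y => ω y μ i j) x :=
  ((hc.smooth_ω μ i j).contDiffAt (hU.mem_nhds hx)).differentiableAt (by simp)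

theorem pd_metric (hU : IsOpen U) (hc : IsConfiguration U e ω) {x : Pt} (hx : x ∈ U)
    (l μ ν : Fin 3) : pd l (fun y => metric e y μ ν) x
      = ∑ i, (pd l (fun y => e y μ i) x * e x ν i + e x μ i * pd l (fun y => e y ν i) x) := by
  have hd := hc.differentiableAt_e hU hx
  unfold metric
  rw [pd_sum fun i _ => (hd μ i).fun_mul (hd ν i)]
  exact Finset.sum_congr rfl fun i _ => pd_mul (hd μ i) (hd ν i) l

/-- For zero torsion the Christoffel symbols are the connection `ω` in the coordinate basis. -/
theorem christoffel_eq (hT : TorsionFree U e ω) (hU : IsOpen U) (hc : IsConfiguration U e ω)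
    {x : Pt} (hx : x ∈ U) (μ ν ρ : Fin 3) : christoffel e x μ ν ρ =
      ∑ i, (pd μ (fun y => e y ν i) x + ∑ j, e x ν j * ω x μ j i) * invE (e x) ρ i := by
  have h := hc.detE_ne_zero hx
  have key (σ : Fin 3) : (1 / 2) * (pd μ (fun y => metric e y ν σ) x
      + pd ν (fun y => metric e y μ σ) x - pd σ (fun y => metric e y μ ν) x)
      = ∑ i, (pd μ (fun y => e y ν i) x + ∑ j, e x ν j * ω x μ j i) * e x σ i := by
    simp only [pd_metric hU hc hx]
    -- The Koszul combination of torsion components. Once the antisymmetry of ω, that is,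
    -- compatibility with the metric, has been substituted, half of it is exactly the difference of
    -- the two sides.
    have t : ∑ i, (e x ν i * torsion (jet e ω x) μ σ i + e x μ i * torsion (jet e ω x) ν σ i
        - e x σ i * torsion (jet e ω x) μ ν i) = 0 := by simp [hT x hx]
    simp only [torsion, jet] at t
    have w0 (i j) : ω x i j j = 0 := by linarith [hc.antisymm x hx i j j]
    have w1 (i) := hc.antisymm x hx i 1 0
    have w2 (i) := hc.antisymm x hx i 2 0
    have w3 (i) := hc.antisymm x hx i 2 1
    simp only [Fin.sum_univ_three, w0, w1, w2, w3] at t ⊢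
    linear_combination (1 / 2) * t
  unfold christoffel
  simp only [key, invMetric_eq]
  calc ∑ σ, (∑ i, (pd μ (fun y => e y ν i) x + ∑ j, e x ν j * ω x μ j i) * e x σ i)
        * ∑ k, invE (e x) σ k * invE (e x) ρ k
      = ∑ i, ∑ k, (pd μ (fun y => e y ν i) x + ∑ j, e x ν j * ω x μ j i)
          * (∑ σ, invE (e x) σ k * e x σ i) * invE (e x) ρ k := by
        simp only [Fin.sum_univ_three]
        ring
    _ = _ := by
        simp only [sum_invE_mul h]
        simp [kron]

theorem sum_christoffel_mul (hT : TorsionFree U e ω) (hU : IsOpen U) (hc : IsConfiguration U e ω)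
    {x : Pt} (hx : x ∈ U) (μ ν i : Fin 3) : ∑ ρ, christoffel e x μ ν ρ * e x ρ i
      = pd μ (fun y => e y ν i) x + ∑ j, e x ν j * ω x μ j i := by
  simp only [christoffel_eq hT hU hc hx]
  calc ∑ ρ, (∑ i, (pd μ (fun y => e y ν i) x + ∑ j, e x ν j * ω x μ j i) * invE (e x) ρ i)
        * e x ρ i
      = ∑ k, (pd μ (fun y => e y ν k) x + ∑ j, e x ν j * ω x μ j k)
          * (∑ ρ, invE (e x) ρ k * e x ρ i) := by
        simp only [Fin.sum_univ_three]
        ring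
    _ = _ := by
        simp only [sum_invE_mul (hc.detE_ne_zero hx)]
        simp [kron]

theorem IsConfiguration.differentiableAt_pd_e (hc : IsConfiguration U e ω) (hU : IsOpen U) {x : Pt}
    (hx : x ∈ U) (ν μ i : Fin 3) : DifferentiableAt ℝ (pd ν fun y => e y μ i) x :=
  ((ContDiffOn.pd hU (hc.smooth_e μ i) ν).contDiffAt (hU.mem_nhds hx)).differentiableAt (by simp)

theorem IsConfiguration.differentiableAt_invE (hc : IsConfiguration U e ω) (hU : IsOpen U)
    {x : Pt} (hx : x ∈ U) (μ i : Fin 3) : DifferentiableAt ℝ (fun y => invE (e y) μ i) x :=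
  (SmoothLagr.invE μ i).differentiableAt_jet hc hU hx

theorem differentiableAt_christoffel (hT : TorsionFree U e ω) (hU : IsOpen U)
    (hc : IsConfiguration U e ω) {x : Pt} (hx : x ∈ U) (μ ν ρ : Fin 3) :
    DifferentiableAt ℝ (fun y => christoffel e y μ ν ρ) x := by
  refine DifferentiableAt.congr_of_eventuallyEq (f := fun y =>
    ∑ i, (pd μ (fun y => e y ν i) y + ∑ j, e y ν j * ω y μ j i) * invE (e y) ρ i) ?_
    (Filter.eventually_of_mem (hU.mem_nhds hx) fun y hy => christoffel_eq hT hU hc hy μ ν ρ)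
  refine DifferentiableAt.fun_sum fun i _ => ((hc.differentiableAt_pd_e hU hx _ _ _).fun_add
    (DifferentiableAt.fun_sum fun j _ => ?_)).fun_mul (hc.differentiableAt_invE hU hx _ _)
  exact (hc.differentiableAt_e hU hx _ _).fun_mul (hc.differentiableAt_ω hU hx _ _ _)

/-- For zero torsion the Riemann tensor of the metric is the curvature of `ω`. -/
theorem sum_riemann_mul (hT : TorsionFree U e ω) (hU : IsOpen U) (hc : IsConfiguration U e ω)
    {x : Pt} (hx : x ∈ U) (μ ν ρ i : Fin 3) : ∑ σ, riemann e x μ ν ρ σ * e x σ i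
      = ∑ j, e x ρ j * curvature (jet e ω x) μ ν j i := by
  have hΓ := differentiableAt_christoffel hT hU hc hx
  have he := hc.differentiableAt_e hU hx
  have hω := hc.differentiableAt_ω hU hx
  -- The derivative of Γ_{νρ}^σ e_σ^i = ∂_ν e_ρ^i + e_ρ^j ω_{νj}^i. After antisymmetrization in μ, ν
  -- the second derivatives of e cancel, and the same relation, undifferentiated, eliminates the
  -- first derivatives.
  have h1 (μ ν : Fin 3) : ∑ σ, (pd μ (fun y => christoffel e y ν ρ σ) x * e x σ i
      + christoffel e x ν ρ σ * pd μ (fun y => e y σ i) x)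
      = pd μ (pd ν fun y => e y ρ i) x + ∑ j, (pd μ (fun y => e y ρ j) x * ω x ν j i
        + e x ρ j * pd μ (fun y => ω y ν j i) x) := by
    have h2 := pd_congr hU (fun y hy => sum_christoffel_mul hT hU hc hy ν ρ i) hx μ
    rw [pd_sum fun σ _ => (hΓ ν ρ σ).fun_mul (he σ i), pd_add (hc.differentiableAt_pd_e hU hx ν ρ i)
      (DifferentiableAt.fun_sum fun j _ => (he ρ j).fun_mul (hω ν j i)),
      pd_sum fun j _ => (he ρ j).fun_mul (hω ν j i)] at h2
    rw [Finset.sum_congr rfl fun σ _ => (pd_mul (hΓ ν ρ σ) (he σ i) μ).symm, h2]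
    exact congrArg _ (Finset.sum_congr rfl fun j _ => pd_mul (he ρ j) (hω ν j i) μ)
  have hcomm := pd_comm ((hc.smooth_e ρ i).contDiffAt (hU.mem_nhds hx)) μ ν
  have S := sum_christoffel_mul hT hU hc hx
  have hμν := h1 μ ν
  have hνμ := h1 ν μ
  have S1 (l) := S ν l i
  have S2 (l) := S μ l i
  have S3 (j) := S μ ρ j
  have S4 (j) := S ν ρ j
  simp only [riemann, curvature, jet]
  simp only [Fin.sum_univ_three] at hμν hνμ S1 S2 S3 S4 ⊢
  linear_combination hμν - hνμ + hcomm
    - christoffel e x μ ρ 0 * S1 0 - christoffel e x μ ρ 1 * S1 1 - christoffel e x μ ρ 2 * S1 2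
    + christoffel e x ν ρ 0 * S2 0 + christoffel e x ν ρ 1 * S2 1 + christoffel e x ν ρ 2 * S2 2
    - ω x ν 0 i * S3 0 - ω x ν 1 i * S3 1 - ω x ν 2 i * S3 2
    + ω x μ 0 i * S4 0 + ω x μ 1 i * S4 1 + ω x μ 2 i * S4 2

theorem riemann_eq (hT : TorsionFree U e ω) (hU : IsOpen U) (hc : IsConfiguration U e ω)
    {x : Pt} (hx : x ∈ U) (μ ν ρ σ : Fin 3) : riemann e x μ ν ρ σ
      = ∑ i, ∑ j, e x ρ j * curvature (jet e ω x) μ ν j i * invE (e x) σ i := by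
  calc riemann e x μ ν ρ σ = ∑ l, riemann e x μ ν ρ l * kron l σ := by simp [kron]
    _ = ∑ l, riemann e x μ ν ρ l * ∑ i, e x l i * invE (e x) σ i := by
        simp only [sum_mul_invE (hc.detE_ne_zero hx)]
    _ = ∑ i, (∑ l, riemann e x μ ν ρ l * e x l i) * invE (e x) σ i := by
        simp only [Fin.sum_univ_three]
        ring
    _ = _ := by
        simp only [sum_riemann_mul hT hU hc hx, Finset.sum_mul]

theorem ricciLC_eq (hT : TorsionFree U e ω) (hU : IsOpen U) (hc : IsConfiguration U e ω)
    {x : Pt} (hx : x ∈ U) (μ ν : Fin 3) : ricciLC e x μ ν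
      = ∑ a, ∑ c, e x μ a * e x ν c * ricci (jet e ω x) a c := by
  have h := hc.detE_ne_zero hx
  have h1 (c : Fin 3) : ∑ a, e x μ a * ricci (jet e ω x) a c
      = ∑ b, ∑ β, curvature (jet e ω x) μ β c b * invE (e x) β b := by
    calc ∑ a, e x μ a * ricci (jet e ω x) a c
        = ∑ b, ∑ α, ∑ β, (∑ a, e x μ a * invE (e x) α a) * curvature (jet e ω x) α β c b
            * invE (e x) β b := by
          simp only [ricci, curvatureL]
          change ∑ a, e x μ a * ∑ b, ∑ α, ∑ β, curvature (jet e ω x) α β c b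
            * invE (e x) α a * invE (e x) β b = _
          simp only [Fin.sum_univ_three]
          ring
      _ = _ := by
          simp only [sum_mul_invE h]
          refine Finset.sum_congr rfl fun b _ => ?_
          rw [Finset.sum_eq_single μ]
          · simp [kron]
          · intro α _ hα
            simp [kron, hα.symm]
          · simp
  calc ricciLC e x μ ν = ∑ c, e x ν c * ∑ a, e x μ a * ricci (jet e ω x) a c := by
        simp only [ricciLC, riemann_eq hT hU hc hx, h1]
        generalize curvature (jet e ω x) = R
        simp only [Fin.sum_univ_three]
        ring
    _ = _ := by
        simp only [Fin.sum_univ_three]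
        ring

theorem sum_invE_invE_mul {e : Vielbein} (h : detE e ≠ 0) (X : Fin 3 → Fin 3 → ℝ) (m k : Fin 3) :
    ∑ μ, ∑ ν, invE e μ m * invE e ν k * ∑ a, ∑ c, e μ a * e ν c * X a c = X m k := by
  calc ∑ μ, ∑ ν, invE e μ m * invE e ν k * ∑ a, ∑ c, e μ a * e ν c * X a c
      = ∑ a, ∑ c, (∑ μ, invE e μ m * e μ a) * (∑ ν, invE e ν k * e ν c) * X a c := by
        simp only [Fin.sum_univ_three]
        ring
    _ = _ := by
        simp only [sum_invE_mul h]
        simp [kron]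

theorem scalarLC_eq (hT : TorsionFree U e ω) (hU : IsOpen U) (hc : IsConfiguration U e ω)
    {x : Pt} (hx : x ∈ U) : scalarLC e x = scalarCurv (jet e ω x) := by
  have h := hc.detE_ne_zero hx
  unfold scalarLC scalarCurv
  simp only [ricciLC_eq hT hU hc hx, invMetric_eq]
  rw [Finset.sum_congr rfl fun i _ =>
    (sum_invE_invE_mul h (fun a c => ricci (jet e ω x) a c) i i).symm]
  simp only [Finset.sum_mul]
  symm
  exact Finset.sum_comm.trans (Finset.sum_congr rfl fun μ _ => Finset.sum_comm)

/-- The Einstein equations in the frame. -/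
theorem einsteinEq_iff (κ Λ : ℝ) (hT : TorsionFree U e ω) (hU : IsOpen U)
    (hc : IsConfiguration U e ω) : EinsteinEq κ Λ U e ↔ ∀ x ∈ U, ∀ a c,
      κ * (ricci (jet e ω x) a c - (1 / 2) * kron a c * scalarCurv (jet e ω x))
        - (Λ / 2) * kron a c = 0 := by
  have key (x) (hx : x ∈ U) (μ ν : Fin 3) :
      κ * (ricciLC e x μ ν - (1 / 2) * metric e x μ ν * scalarLC e x) - (Λ / 2) * metric e x μ ν
      = ∑ a, ∑ c, e x μ a * e x ν c * (κ * (ricci (jet e ω x) a c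
        - (1 / 2) * kron a c * scalarCurv (jet e ω x)) - (Λ / 2) * kron a c) := by
    rw [ricciLC_eq hT hU hc hx, scalarLC_eq hT hU hc hx]
    simp only [metric, kron]
    simp [Fin.sum_univ_three]
    ring
  refine forall₂_congr fun x hx => ⟨fun h m k => ?_, fun h μ ν => ?_⟩
  · rw [← sum_invE_invE_mul (hc.detE_ne_zero hx) (fun a c => κ * (ricci (jet e ω x) a c
        - (1 / 2) * kron a c * scalarCurv (jet e ω x)) - (Λ / 2) * kron a c) m k]
    simp only [← key x hx, h, mul_zero, Finset.sum_const_zero]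
  · rw [key x hx]
    simp only [h, mul_zero, Finset.sum_const_zero]

/-! ### Existence of the torsion-free connection -/

/-- The torsion-free connection of a vielbein. -/
def lcConnection (e : Pt → Vielbein) (x : Pt) : Connection := fun μ j k =>
  ∑ i, e x μ i * ((1 / 2) * (-(frameDE (jet e 0 x) i j k - frameDE (jet e 0 x) j i k)
    + (frameDE (jet e 0 x) j k i - frameDE (jet e 0 x) k j i)
    - (frameDE (jet e 0 x) k i j - frameDE (jet e 0 x) i k j)))

theorem SmoothLagr.frameDE (i j k : Fin 3) : SmoothLagr fun J => frameDE J i j k :=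
  .sum fun _ => .sum fun _ => .mul (.mul (.de _ _ _) (.invE _ _)) (.invE _ _)

theorem IsConfiguration.zero (hc : IsConfiguration U e ω) : IsConfiguration U e 0 :=
  ⟨hc.smooth_e, fun _ _ _ => contDiffOn_const, hc.det_ne_zero, fun _ _ _ _ _ => by simp⟩

theorem IsConfiguration.lcConnection (hc : IsConfiguration U e ω) (hU : IsOpen U) :
    IsConfiguration U e (lcConnection e) := by
  refine ⟨hc.smooth_e, fun μ j k => ?_, hc.det_ne_zero, fun x _ μ j k => ?_⟩
  · refine ContDiffOn.sum fun i _ => (hc.smooth_e μ i).mul (contDiffOn_const.mul ?_)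
    have h (i j k) := (SmoothLagr.frameDE i j k).contDiffOn_jet hc.zero hU
    exact (((h _ _ _).sub (h _ _ _)).neg.add ((h _ _ _).sub (h _ _ _))).sub
      ((h _ _ _).sub (h _ _ _))
  · simp only [RiemannCartan.lcConnection, ← Finset.sum_neg_distrib]
    exact Finset.sum_congr rfl fun i _ => by ring

theorem torsion_eq_sum (J : Jet) (h : detE J.e ≠ 0) (μ ν k : Fin 3) :
    torsion J μ ν k = ∑ i, ∑ j, J.e μ i * J.e ν j * torsionL J i j k := by
  symm
  calc ∑ i, ∑ j, J.e μ i * J.e ν j * torsionL J i j k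
      = ∑ α, ∑ β, (∑ i, J.e μ i * invE J.e α i) * (∑ j, J.e ν j * invE J.e β j)
          * torsion J α β k := by
        simp only [torsionL, Fin.sum_univ_three]
        ring
    _ = _ := by
        simp only [sum_mul_invE h]
        simp [kron]

/-- Adding a connection with frame components B_{ijk} = -B_{ikj} changes the torsion by B_{ijk} -
B_{jik}. The equation B_{ijk} - B_{jik} = E_{ijk} is solved by ½(E_{ijk} - E_{jki} + E_{kij}), and
`lcConnection` is this solution for E equal to minus the torsion of ω = 0. -/
theorem torsionFree_lcConnection (hc : IsConfiguration U e ω) :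
    TorsionFree U e (lcConnection e) := by
  intro x hx μ ν k
  have h := hc.detE_ne_zero hx
  have hω (i j k) : frameω (jet e (lcConnection e) x) i j k = (1 / 2) *
      (-(frameDE (jet e 0 x) i j k - frameDE (jet e 0 x) j i k)
      + (frameDE (jet e 0 x) j k i - frameDE (jet e 0 x) k j i)
      - (frameDE (jet e 0 x) k i j - frameDE (jet e 0 x) i k j)) := by
    generalize hX : (fun i => (1 / 2) *
      (-(frameDE (jet e 0 x) i j k - frameDE (jet e 0 x) j i k)
      + (frameDE (jet e 0 x) j k i - frameDE (jet e 0 x) k j i)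
      - (frameDE (jet e 0 x) k i j - frameDE (jet e 0 x) i k j))) = X
    have h1 (μ) : lcConnection e x μ j k = ∑ l, e x μ l * X l := by rw [← hX]; rfl
    have h2 := congrFun hX i
    refine Eq.trans ?_ h2.symm
    calc frameω (jet e (lcConnection e) x) i j k
        = ∑ μ, (∑ l, e x μ l * X l) * invE (e x) μ i := by simp only [← h1]; rfl
      _ = ∑ l, (∑ μ, invE (e x) μ i * e x μ l) * X l := by
          simp only [Fin.sum_univ_three]
          ring
      _ = X i := by
          simp only [sum_invE_mul h]
          simp [kron]
  have hde (i j k) : frameDE (jet e (lcConnection e) x) i j k = frameDE (jet e 0 x) i j k := rfl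
  rw [torsion_eq_sum _ h]
  refine Finset.sum_eq_zero fun i _ => Finset.sum_eq_zero fun j _ => ?_
  rw [torsionL_eq h, hω, hω, hde, hde]
  ring

end

section

variable {U : Set Pt} {e : Pt → Vielbein} {ω : Pt → Connection}

/-! ### The first Bianchi identity -/

/-- The cyclic sum of the derivatives of the vanishing torsion: second derivatives of e cancel, and
the first derivatives of e that remain, each multiplied by ω, are removed with the torsion equations
themselves. -/
theorem bianchi_first_coord (hT : TorsionFree U e ω) (hU : IsOpen U) (hc : IsConfiguration U e ω)
    {x : Pt} (hx : x ∈ U) (l μ ν i : Fin 3) :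
    ∑ j, (e x l j * curvature (jet e ω x) μ ν j i + e x μ j * curvature (jet e ω x) ν l j i
      + e x ν j * curvature (jet e ω x) l μ j i) = 0 := by
  have he := hc.differentiableAt_e hU hx
  have hω := hc.differentiableAt_ω hU hx
  have hpe := hc.differentiableAt_pd_e hU hx
  have H (l μ ν : Fin 3) : (pd l (pd μ fun y => e y ν i) x
      - ∑ j, (pd l (fun y => e y μ j) x * ω x ν j i + e x μ j * pd l (fun y => ω y ν j i) x))
      - (pd l (pd ν fun y => e y μ i) x
      - ∑ j, (pd l (fun y => e y ν j) x * ω x μ j i + e x ν j * pd l (fun y => ω y μ j i) x))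
      = 0 := by
    have hs (μ ν : Fin 3) : DifferentiableAt ℝ (fun y => ∑ j, e y μ j * ω y ν j i) x :=
      DifferentiableAt.fun_sum fun j _ => (he μ j).fun_mul (hω ν j i)
    have hd (μ ν : Fin 3) : pd l (fun y => pd μ (fun z => e z ν i) y - ∑ j, e y μ j * ω y ν j i) x
        = pd l (pd μ fun y => e y ν i) x
          - ∑ j, (pd l (fun y => e y μ j) x * ω x ν j i
            + e x μ j * pd l (fun y => ω y ν j i) x) := by
      rw [pd_sub (hpe μ ν i) (hs μ ν), pd_sum fun j _ => (he μ j).fun_mul (hω ν j i)]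
      exact congrArg _ (Finset.sum_congr rfl fun j _ => pd_mul (he μ j) (hω ν j i) l)
    rw [← hd, ← hd, ← pd_sub ((hpe μ ν i).fun_sub (hs μ ν)) ((hpe ν μ i).fun_sub (hs ν μ))]
    exact (pd_congr hU (g := fun _ => 0) (fun y hy => hT y hy μ ν i) hx l).trans (pd_const 0 l x)
  have hcomm (ρ) := pd_comm ((hc.smooth_e ρ i).contDiffAt (hU.mem_nhds hx))
  have t : ∑ j, (torsion (jet e ω x) l μ j * ω x ν j i + torsion (jet e ω x) μ ν j * ω x l j i
      + torsion (jet e ω x) ν l j * ω x μ j i) = 0 := by simp [hT x hx]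
  have h1 := H l μ ν
  have h2 := H μ ν l
  have h3 := H ν l μ
  simp only [torsion, curvature, jet] at t ⊢
  simp only [Fin.sum_univ_three] at h1 h2 h3 t ⊢
  linear_combination h1 + h2 + h3 + t - hcomm ν l μ - hcomm l μ ν - hcomm μ ν l

theorem bianchi_first (hT : TorsionFree U e ω) (hU : IsOpen U) (hc : IsConfiguration U e ω)
    {x : Pt} (hx : x ∈ U) (a b c d : Fin 3) : curvatureL (jet e ω x) a b c d
      + curvatureL (jet e ω x) b c a d + curvatureL (jet e ω x) c a b d = 0 := by
  have h := hc.detE_ne_zero hx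
  have h1 (i j k l) : curvatureL (jet e ω x) i j k l = ∑ m, ∑ μ, ∑ ν, (∑ α, invE (e x) α k
      * e x α m) * curvature (jet e ω x) μ ν m l * invE (e x) μ i * invE (e x) ν j := by
    simp only [sum_invE_mul h]
    rw [Finset.sum_eq_single k]
    · simp [kron, curvatureL, jet]
    · intro m _ hm
      simp [kron, hm.symm]
    · simp
  rw [h1, h1, h1]
  have h2 : ∑ α, ∑ μ, ∑ ν, invE (e x) α c * invE (e x) μ a * invE (e x) ν b *
    ∑ j, (e x α j * curvature (jet e ω x) μ ν j d + e x μ j * curvature (jet e ω x) ν α j d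
      + e x ν j * curvature (jet e ω x) α μ j d) = 0 := by
    simp only [bianchi_first_coord hT hU hc hx, mul_zero, Finset.sum_const_zero]
  rw [← h2]
  generalize curvature (jet e ω x) = R
  generalize invE (e x) = v
  generalize e x = E
  simp only [Fin.sum_univ_three]
  ring

/-- The usual consequence of four instances of the cyclic identity and the antisymmetry in each
pair. It makes the Ricci tensor symmetric and lets the curvature squares collapse. -/
theorem curvatureL_symm (hT : TorsionFree U e ω) (hU : IsOpen U) (hc : IsConfiguration U e ω)
    {x : Pt} (hx : x ∈ U) (a b c d : Fin 3) :
    curvatureL (jet e ω x) a b c d = curvatureL (jet e ω x) c d a b := by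
  have B := bianchi_first hT hU hc hx
  have A := curvatureL_antisymm_left (jet e ω x)
  have A' := (hc.antisymm_jet hU hx).curvatureL
  linarith [B a b c d, B b c d a, B c d a b, B d a b c, A a b c d, A b c a d, A c a b d,
    A b c d a, A c d b a, A d b c a, A c d a b, A d a c b, A a c d b, A d a b c, A a b d c,
    A b d a c, A' a b c d, A' b c a d, A' c a b d, A' b c d a, A' c d b a, A' d b c a,
    A' c d a b, A' d a c b, A' a c d b, A' d a b c, A' a b d c, A' b d a c]

theorem ricci_symm (hT : TorsionFree U e ω) (hU : IsOpen U) (hc : IsConfiguration U e ω)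
    {x : Pt} (hx : x ∈ U) (a c : Fin 3) : ricci (jet e ω x) a c = ricci (jet e ω x) c a :=
  Finset.sum_congr rfl fun b _ => curvatureL_symm hT hU hc hx a b c b

/-! ### The terms quadratic in curvature -/

/-- With two antisymmetric pairs in three dimensions, the curvature is a 3 × 3 matrix G, equivalent
to the Ricci tensor, and R_{ijkl}R^{ijkl} = 4 R_{ij}R^{ij} - R² even without pair symmetry. The
product R_{ijkl}R^{klij} differs from this by -½ times the square of R_{ijkl} - R_{klij}, which is
the remainder on the right. -/
theorem Jet.Antisymm.curvatureTerms {J : Jet} (hJ : J.Antisymm) (c₁ c₂ c₃ : ℝ) :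
    lagrangian (Params.curvatureTerms c₁ c₂ c₃) J =
      detE J.e * ((c₁ + c₂ + c₃ / 4) * (∑ i, ∑ k, ricci J i k ^ 2)
        - (c₁ + c₂) / 4 * scalarCurv J ^ 2)
      + detE J.e * ∑ x : Fin 3 × Fin 3 × Fin 3 × Fin 3,
        (RiemannCartan.curvatureL J x.1 x.2.1 x.2.2.1 x.2.2.2
          - RiemannCartan.curvatureL J x.2.2.1 x.2.2.2 x.1 x.2.1) *
        (-c₂ / 8 * (RiemannCartan.curvatureL J x.1 x.2.1 x.2.2.1 x.2.2.2
          - RiemannCartan.curvatureL J x.2.2.1 x.2.2.2 x.1 x.2.1)) := by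
  rw [lagrangian_curvatureTerms, ← mul_add]
  congr 1
  simp only [scalarCurv, ricci]
  have A := curvatureL_antisymm_left J
  have A' := hJ.curvatureL
  generalize RiemannCartan.curvatureL J = R at *
  have a0 (i k l) : R i i k l = 0 := by linarith [A i i k l]
  have a1 (k l) := A 1 0 k l
  have a2 (k l) := A 2 0 k l
  have a3 (k l) := A 2 1 k l
  have b0 (i k l) : R k l i i = 0 := by linarith [A' k l i i]
  have b1 (k l) := A' k l 1 0
  have b2 (k l) := A' k l 2 0
  have b3 (k l) := A' k l 2 1
  simp only [Fintype.sum_prod_type, kron]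
  simp [Fin.sum_univ_three, a0, a1, a2, a3, b0, b1, b2, b3]
  ring

/-- For opposite coefficients only the antisymmetric part of the matrix G representing the curvature
survives, and it is the antisymmetric part of the Ricci tensor up to sign. -/
theorem Jet.Antisymm.sum_ricciA_sq {J : Jet} (hJ : J.Antisymm) (c : ℝ) :
    lagrangian (Params.curvatureTerms c (-c) 0) J
      = detE J.e * (2 * c * ∑ i, ∑ j, ricciA J i j ^ 2) := by
  rw [lagrangian_curvatureTerms]
  congr 1
  simp only [ricciA, ricci]
  have A := curvatureL_antisymm_left J
  have A' := hJ.curvatureL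
  generalize RiemannCartan.curvatureL J = R at *
  have a0 (i k l) : R i i k l = 0 := by linarith [A i i k l]
  have a1 (k l) := A 1 0 k l
  have a2 (k l) := A 2 0 k l
  have a3 (k l) := A 2 1 k l
  have b0 (i k l) : R k l i i = 0 := by linarith [A' k l i i]
  have b1 (k l) := A' k l 1 0
  have b2 (k l) := A' k l 2 0
  have b3 (k l) := A' k l 2 1
  simp only [Fintype.sum_prod_type, kron]
  simp [Fin.sum_univ_three, a0, a1, a2, a3, b0, b1, b2, b3]
  ring

/-- The Lagrangian quadratic in the Ricci tensor to which the terms quadratic in curvature reduce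
for zero torsion. -/
def ricciLagr (s t : ℝ) (J : Jet) : ℝ :=
  detE J.e * (s * (∑ i, ∑ k, ricci J i k ^ 2) + t * scalarCurv J ^ 2)

theorem SmoothLagr.ricciLagr (s t : ℝ) : SmoothLagr (ricciLagr s t) := by
  unfold RiemannCartan.ricciLagr
  simp only [pow_two]
  exact .mul .detE (.add (.mul (.const _) (.sum fun _ => .sum fun _ => .mul (.ricci _ _)
    (.ricci _ _))) (.mul (.const _) (.mul .scalarCurv .scalarCurv)))

/-- The two Lagrangians differ by a term quadratic in R_{ijkl} - R_{klij}, which vanishes on `U`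
when the torsion does. -/
theorem EL_curvatureTerms (hT : TorsionFree U e ω) (hU : IsOpen U) (hc : IsConfiguration U e ω)
    (c₁ c₂ c₃ : ℝ) {δ : Fld} (hδ : δ.Antisymm) {x : Pt} (hx : x ∈ U) :
    EL (lagrangian (Params.curvatureTerms c₁ c₂ c₃)) e ω δ x
      = EL (ricciLagr (c₁ + c₂ + c₃ / 4) (-(c₁ + c₂) / 4)) e ω δ x := by
  have s1 := SmoothLagr.ricciLagr (c₁ + c₂ + c₃ / 4) (-(c₁ + c₂) / 4)
  have s2 (i : Fin 3 × Fin 3 × Fin 3 × Fin 3) : SmoothLagr fun J =>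
      curvatureL J i.1 i.2.1 i.2.2.1 i.2.2.2 - curvatureL J i.2.2.1 i.2.2.2 i.1 i.2.1 :=
    .sub (.curvatureL _ _ _ _) (.curvatureL _ _ _ _)
  have s3 (i) := (SmoothLagr.const (-c₂ / 8)).mul (s2 i)
  rw [EL_congr_of_eq (SmoothLagr.lagrangian _)
    (s1.add (SmoothLagr.detE.mul (.sum (s := Finset.univ) fun i => (s2 i).mul (s3 i)))) hU hc
    (fun J _ hJ => ?_) hδ hx, EL_add s1 (SmoothLagr.detE.mul (.sum fun i => (s2 i).mul (s3 i)))
    hU hc hx, EL_mul_sum_mul_eq_zero SmoothLagr.detE s2 s3 hU hc _ _ δ hx, add_zero]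
  · intro y hy i
    rw [curvatureL_symm hT hU hc hy, sub_self]
  · intro y hy i
    rw [curvatureL_symm hT hU hc hy, sub_self, mul_zero]
  · rw [hJ.curvatureTerms, ricciLagr]
    ring

end

section

variable {U : Set Pt} {e : Pt → Vielbein} {ω : Pt → Connection}

/-! ### The second Bianchi identity -/

theorem SmoothLagr.curvature (μ ν j i : Fin 3) : SmoothLagr fun J => curvature J μ ν j i := by
  unfold RiemannCartan.curvature
  exact .sub (.sub (.dω _ _ _ _) (.sum fun _ => .mul (.ω _ _ _) (.ω _ _ _)))
    (.sub (.dω _ _ _ _) (.sum fun _ => .mul (.ω _ _ _) (.ω _ _ _)))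

/-- The cyclic sum of the derivatives of the definition of curvature: second derivatives of ω
commute and the commutator terms compensate the rest. It is kept in coordinates, where no vielbein
is differentiated. -/
theorem bianchi_second_coord (hU : IsOpen U) (hc : IsConfiguration U e ω)
    {x : Pt} (hx : x ∈ U) (l μ ν j i : Fin 3) :
    (pd l (fun y => curvature (jet e ω y) μ ν j i) x
      + ∑ k, (curvature (jet e ω x) μ ν j k * ω x l k i
        - ω x l j k * curvature (jet e ω x) μ ν k i))
    + (pd μ (fun y => curvature (jet e ω y) ν l j i) x
      + ∑ k, (curvature (jet e ω x) ν l j k * ω x μ k i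
        - ω x μ j k * curvature (jet e ω x) ν l k i))
    + (pd ν (fun y => curvature (jet e ω y) l μ j i) x
      + ∑ k, (curvature (jet e ω x) l μ j k * ω x ν k i
        - ω x ν j k * curvature (jet e ω x) l μ k i)) = 0 := by
  have hω := hc.differentiableAt_ω hU hx
  have hpω (ν μ i j : Fin 3) : DifferentiableAt ℝ (pd ν fun y => ω y μ i j) x :=
    ((ContDiffOn.pd hU (hc.smooth_ω μ i j) ν).contDiffAt
      (hU.mem_nhds hx)).differentiableAt (by simp)
  have hs (μ ν) : DifferentiableAt ℝ (fun y => ∑ k, ω y μ j k * ω y ν k i) x :=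
    DifferentiableAt.fun_sum fun k _ => (hω μ j k).fun_mul (hω ν k i)
  have hd (l μ ν : Fin 3) : pd l (fun y => pd μ (fun z => ω z ν j i) y
      - ∑ k, ω y μ j k * ω y ν k i) x = pd l (pd μ fun y => ω y ν j i) x
        - ∑ k, (pd l (fun y => ω y μ j k) x * ω x ν k i
          + ω x μ j k * pd l (fun y => ω y ν k i) x) := by
    rw [pd_sub (hpω μ ν j i) (hs μ ν), pd_sum fun k _ => (hω μ j k).fun_mul (hω ν k i)]
    exact congrArg _ (Finset.sum_congr rfl fun k _ => pd_mul (hω μ j k) (hω ν k i) l)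
  have hK (l μ ν : Fin 3) : pd l (fun y => curvature (jet e ω y) μ ν j i) x
      = (pd l (pd μ fun y => ω y ν j i) x - ∑ k, (pd l (fun y => ω y μ j k) x * ω x ν k i
          + ω x μ j k * pd l (fun y => ω y ν k i) x))
        - (pd l (pd ν fun y => ω y μ j i) x - ∑ k, (pd l (fun y => ω y ν j k) x * ω x μ k i
          + ω x ν j k * pd l (fun y => ω y μ k i) x)) := by
    rw [← hd, ← hd, ← pd_sub ((hpω μ ν j i).fun_sub (hs μ ν)) ((hpω ν μ j i).fun_sub (hs ν μ))]
    rfl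
  have hcomm (ρ) := pd_comm ((hc.smooth_ω ρ j i).contDiffAt (hU.mem_nhds hx))
  rw [hK, hK, hK]
  simp only [curvature, jet, Fin.sum_univ_three]
  linear_combination hcomm ν l μ + hcomm l μ ν + hcomm μ ν l

/-- `e^λ_d ∂_λ f`. -/
def framePd (e : Pt → Vielbein) (f : Pt → ℝ) (d : Fin 3) (x : Pt) : ℝ :=
  ∑ l, invE (e x) l d * pd l f x

/-- The covariant derivative `∇_d R_{abck}` of the curvature of a torsion-free connection. -/
def covCurvature (e : Pt → Vielbein) (ω : Pt → Connection) (x : Pt) (d a b c k : Fin 3) : ℝ :=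
  (∑ l, ∑ μ, ∑ ν, invE (e x) l d * invE (e x) μ a * invE (e x) ν b
      * pd l (fun y => curvature (jet e ω y) μ ν c k) x)
    + ∑ m, (-(frameDE (jet e ω x) d a m + frameω (jet e ω x) d a m)
        * curvatureL (jet e ω x) m b c k
      - (frameDE (jet e ω x) d b m + frameω (jet e ω x) d b m) * curvatureL (jet e ω x) a m c k
      + frameω (jet e ω x) d m k * curvatureL (jet e ω x) a b c m
      - frameω (jet e ω x) d c m * curvatureL (jet e ω x) a b m k)

theorem frameω_symm (hT : TorsionFree U e ω) (hc : IsConfiguration U e ω) {x : Pt} (hx : x ∈ U)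
    (a b m : Fin 3) : frameDE (jet e ω x) a b m + frameω (jet e ω x) a b m
      = frameDE (jet e ω x) b a m + frameω (jet e ω x) b a m := by
  have h1 := hT.torsionL hx a b m
  rw [torsionL_eq (hc.detE_ne_zero hx)] at h1
  linarith

/-- The coefficients `frameDE` + `frameω` in `covCurvature` are the Christoffel symbols referred to
the frame. Zero torsion makes them symmetric in the lower indices, so their contribution cancels in
the cyclic sum and the coordinate Bianchi identity remains. -/
theorem covCurvature_cyclic (hT : TorsionFree U e ω) (hU : IsOpen U) (hc : IsConfiguration U e ω)
    {x : Pt} (hx : x ∈ U) (d a b c k : Fin 3) : covCurvature e ω x d a b c k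
      + covCurvature e ω x a b d c k + covCurvature e ω x b d a c k = 0 := by
  have h1 : ∑ l, ∑ μ, ∑ ν, invE (e x) l d * invE (e x) μ a * invE (e x) ν b *
    ((pd l (fun y => curvature (jet e ω y) μ ν c k) x
      + ∑ m, (curvature (jet e ω x) μ ν c m * ω x l m k
        - ω x l c m * curvature (jet e ω x) μ ν m k))
    + (pd μ (fun y => curvature (jet e ω y) ν l c k) x
      + ∑ m, (curvature (jet e ω x) ν l c m * ω x μ m k
        - ω x μ c m * curvature (jet e ω x) ν l m k))
    + (pd ν (fun y => curvature (jet e ω y) l μ c k) x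
      + ∑ m, (curvature (jet e ω x) l μ c m * ω x ν m k
        - ω x ν c m * curvature (jet e ω x) l μ m k))) = 0 := by
    simp only [bianchi_second_coord hU hc hx, mul_zero, Finset.sum_const_zero]
  have hw (d a b : Fin 3) : ∑ m, (frameω (jet e ω x) d m k * curvatureL (jet e ω x) a b c m
      - frameω (jet e ω x) d c m * curvatureL (jet e ω x) a b m k)
      = ∑ l, ∑ μ, ∑ ν, invE (e x) l d * invE (e x) μ a * invE (e x) ν b *
        ∑ m, (curvature (jet e ω x) μ ν c m * ω x l m k
          - ω x l c m * curvature (jet e ω x) μ ν m k) := by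
    simp only [frameω, curvatureL]
    change ∑ m, ((∑ μ, ω x μ m k * invE (e x) μ d) * (∑ μ, ∑ ν, curvature (jet e ω x) μ ν c m
      * invE (e x) μ a * invE (e x) ν b) - (∑ μ, ω x μ c m * invE (e x) μ d) *
      (∑ μ, ∑ ν, curvature (jet e ω x) μ ν m k * invE (e x) μ a * invE (e x) ν b)) = _
    generalize curvature (jet e ω x) = R
    generalize invE (e x) = v
    generalize ω x = w
    simp only [Fin.sum_univ_three]
    ring
  have key (d a b : Fin 3) : covCurvature e ω x d a b c k
      = (∑ l, ∑ μ, ∑ ν, invE (e x) l d * invE (e x) μ a * invE (e x) ν b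
        * (pd l (fun y => curvature (jet e ω y) μ ν c k) x
          + ∑ m, (curvature (jet e ω x) μ ν c m * ω x l m k
            - ω x l c m * curvature (jet e ω x) μ ν m k)))
      + ∑ m, (-(frameDE (jet e ω x) d a m + frameω (jet e ω x) d a m)
        * curvatureL (jet e ω x) m b c k
      - (frameDE (jet e ω x) d b m + frameω (jet e ω x) d b m)
        * curvatureL (jet e ω x) a m c k) := by
    simp only [mul_add (_ * _ * _ : ℝ), Finset.sum_add_distrib, ← hw]
    unfold covCurvature
    simp only [Finset.sum_add_distrib, Finset.sum_sub_distrib]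
    ring
  have c1 : ∀ F : Fin 3 → Fin 3 → Fin 3 → ℝ, ∑ l, ∑ μ, ∑ ν, invE (e x) l a * invE (e x) μ b
      * invE (e x) ν d * F l μ ν
      = ∑ l, ∑ μ, ∑ ν, invE (e x) l d * invE (e x) μ a * invE (e x) ν b * F μ ν l := fun F => by
    simp only [Fin.sum_univ_three]
    ring
  have c2 : ∀ F : Fin 3 → Fin 3 → Fin 3 → ℝ, ∑ l, ∑ μ, ∑ ν, invE (e x) l b * invE (e x) μ d
      * invE (e x) ν a * F l μ ν
      = ∑ l, ∑ μ, ∑ ν, invE (e x) l d * invE (e x) μ a * invE (e x) ν b * F ν l μ := fun F => by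
    simp only [Fin.sum_univ_three]
    ring
  simp only [mul_add (_ * _ * _ : ℝ) (_ + _) _, Finset.sum_add_distrib] at h1
  rw [key, key, key, c1, c2]
  have s (m) := frameω_symm hT hc hx d a m
  have s' (m) := frameω_symm hT hc hx a b m
  have s'' (m) := frameω_symm hT hc hx b d m
  have A (m i) := curvatureL_antisymm_left (jet e ω x) m i c k
  have h2 : ∑ m, ((-(frameDE (jet e ω x) d a m + frameω (jet e ω x) d a m)
        * curvatureL (jet e ω x) m b c k
      - (frameDE (jet e ω x) d b m + frameω (jet e ω x) d b m) * curvatureL (jet e ω x) a m c k)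
      + (-(frameDE (jet e ω x) a b m + frameω (jet e ω x) a b m) * curvatureL (jet e ω x) m d c k
      - (frameDE (jet e ω x) a d m + frameω (jet e ω x) a d m) * curvatureL (jet e ω x) b m c k)
      + (-(frameDE (jet e ω x) b d m + frameω (jet e ω x) b d m) * curvatureL (jet e ω x) m a c k
      - (frameDE (jet e ω x) b a m + frameω (jet e ω x) b a m) * curvatureL (jet e ω x) d m c k))
      = 0 := by
    refine Finset.sum_eq_zero fun m _ => ?_
    rw [s m, s' m, s'' m, A m b, A m d, A m a]
    ring
  simp only [Finset.sum_add_distrib (ι := Fin 3)] at h2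
  linarith

theorem pd_invE (hU : IsOpen U) (hc : IsConfiguration U e ω) {x : Pt} (hx : x ∈ U)
    (ν μ i : Fin 3) : pd ν (fun y => invE (e y) μ i) x
      = -∑ l, ∑ k, invE (e x) μ k * invE (e x) l i * pd ν (fun y => e y l k) x := by
  have h := hc.detE_ne_zero hx
  have h1 := pd_comp_fld (f := fun φ => invE φ.1 μ i) hU hc hx
    (((contDiffAt_invE h μ i).comp (e x, ω x) contDiff_fst.contDiffAt).differentiableAt
      (by simp)) ν
  refine h1.trans ?_
  refine fderiv_eq_of_line (((contDiffAt_invE h μ i).comp (e x, ω x)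
    contDiff_fst.contDiffAt).differentiableAt (by simp)) ?_
  exact hasDerivAt_invE_line h _ μ i

theorem pd_detE (hU : IsOpen U) (hc : IsConfiguration U e ω) {x : Pt} (hx : x ∈ U)
    (ν : Fin 3) : pd ν (fun y => detE (e y)) x
      = detE (e x) * ∑ μ, ∑ i, invE (e x) μ i * pd ν (fun y => e y μ i) x := by
  have h := hc.detE_ne_zero hx
  have hd : DifferentiableAt ℝ (fun φ : Fld => detE φ.1) (e x, ω x) :=
    (contDiff_detE.comp contDiff_fst).contDiffAt.differentiableAt (by simp)
  refine (pd_comp_fld (f := fun φ => detE φ.1) hU hc hx hd ν).trans ?_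
  exact fderiv_eq_of_line hd (hasDerivAt_detE_line h _)

theorem curvatureL_jet (e : Pt → Vielbein) (ω : Pt → Connection) (x : Pt) (i j k l : Fin 3) :
    curvatureL (jet e ω x) i j k l = ∑ μ, ∑ ν, curvature (jet e ω x) μ ν k l * invE (e x) μ i
      * invE (e x) ν j := rfl

/-- Contraction commutes with covariant differentiation: the derivatives of the inverse vielbeins
produce the `frameDE` terms, and the ω terms on the contracted pair of indices cancel by
antisymmetry. -/
theorem covRicci_eq (hU : IsOpen U) (hc : IsConfiguration U e ω)
    {x : Pt} (hx : x ∈ U) (d a c : Fin 3) :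
    covRicci e ω x d a c = ∑ b, covCurvature e ω x d a b c b := by
  have hv := hc.differentiableAt_invE hU hx
  have hR (μ ν j i) := (SmoothLagr.curvature μ ν j i).differentiableAt_jet hc hU hx
  have h1 (l : Fin 3) : pd l (fun y => ricci (jet e ω y) a c) x = ∑ b, ∑ μ, ∑ ν,
      ((pd l (fun y => curvature (jet e ω y) μ ν c b) x * invE (e x) μ a
        + curvature (jet e ω x) μ ν c b * pd l (fun y => invE (e y) μ a) x) * invE (e x) ν b
        + curvature (jet e ω x) μ ν c b * invE (e x) μ a
          * pd l (fun y => invE (e y) ν b) x) := by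
    have hm (μ ν b) := ((hR μ ν c b).fun_mul (hv μ a)).fun_mul (hv ν b)
    change pd l (fun y => ∑ b, ∑ μ, ∑ ν, curvature (jet e ω y) μ ν c b * invE (e y) μ a
      * invE (e y) ν b) x = _
    rw [pd_sum fun b _ => .fun_sum fun μ _ => .fun_sum fun ν _ => hm μ ν b]
    refine Finset.sum_congr rfl fun b _ => ?_
    rw [pd_sum fun μ _ => .fun_sum fun ν _ => hm μ ν b]
    refine Finset.sum_congr rfl fun μ _ => ?_
    rw [pd_sum fun ν _ => hm μ ν b]
    refine Finset.sum_congr rfl fun ν _ => ?_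
    rw [pd_mul ((hR μ ν c b).fun_mul (hv μ a)) (hv ν b), pd_mul (hR μ ν c b) (hv μ a)]
  have h2 (i μ : Fin 3) : ∑ l, invE (e x) l d * pd l (fun y => invE (e y) μ i) x
      = -∑ m, frameDE (jet e ω x) d i m * invE (e x) μ m := by
    simp only [pd_invE hU hc hx, frameDE]
    change _ = -∑ m, (∑ l, ∑ ν, pd l (fun y => e y ν m) x * invE (e x) l d * invE (e x) ν i)
      * invE (e x) μ m
    simp only [Fin.sum_univ_three]
    ring
  have h3 : ∑ l, invE (e x) l d * pd l (fun y => ricci (jet e ω y) a c) x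
      = ∑ b, ((∑ l, ∑ μ, ∑ ν, invE (e x) l d * invE (e x) μ a * invE (e x) ν b
          * pd l (fun y => curvature (jet e ω y) μ ν c b) x)
        - ∑ m, (frameDE (jet e ω x) d a m * curvatureL (jet e ω x) m b c b
          + frameDE (jet e ω x) d b m * curvatureL (jet e ω x) a m c b)) := by
    have h4 (b : Fin 3) : ∑ m, frameDE (jet e ω x) d a m * curvatureL (jet e ω x) m b c b
        = -∑ μ, ∑ ν, curvature (jet e ω x) μ ν c b * invE (e x) ν b
          * ∑ l, invE (e x) l d * pd l (fun y => invE (e y) μ a) x := by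
      simp only [h2, curvatureL_jet]
      generalize frameDE (jet e ω x) = C
      simp only [Fin.sum_univ_three]
      ring
    have h5 (b : Fin 3) : ∑ m, frameDE (jet e ω x) d b m * curvatureL (jet e ω x) a m c b
        = -∑ μ, ∑ ν, curvature (jet e ω x) μ ν c b * invE (e x) μ a
          * ∑ l, invE (e x) l d * pd l (fun y => invE (e y) ν b) x := by
      simp only [h2, curvatureL_jet]
      generalize frameDE (jet e ω x) = C
      simp only [Fin.sum_univ_three]
      ring
    simp only [h1, Finset.sum_add_distrib, h4, h5]
    simp only [Fin.sum_univ_three]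
    ring
  have h6 : covRicci e ω x d a c = ∑ l, invE (e x) l d * pd l (fun y => ricci (jet e ω y) a c) x
      - ∑ m, (frameω (jet e ω x) d a m * ricci (jet e ω x) m c
        + frameω (jet e ω x) d c m * ricci (jet e ω x) a m) := by
    unfold covRicci frameω
    change _ = _ - ∑ m, ((∑ μ, ω x μ a m * invE (e x) μ d) * ricci (jet e ω x) m c
        + (∑ μ, ω x μ c m * invE (e x) μ d) * ricci (jet e ω x) a m)
    simp only [Fin.sum_univ_three]
    ring
  have w (i j) := (hc.antisymm_jet hU hx).frameω d i j
  rw [h6, h3]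
  unfold covCurvature ricci
  have w0 := eq_zero_of_antisymm w
  have w1 := w 1 0
  have w2 := w 2 0
  have w3 := w 2 1
  simp only [Fin.sum_univ_three, w0, w1, w2, w3]
  ring

theorem framePd_scalarCurv (hU : IsOpen U) (hc : IsConfiguration U e ω)
    {x : Pt} (hx : x ∈ U) (d : Fin 3) :
    framePd e (fun y => scalarCurv (jet e ω y)) d x = ∑ i, covRicci e ω x d i i := by
  have h1 (l : Fin 3) : pd l (fun y => scalarCurv (jet e ω y)) x
      = ∑ i, pd l (fun y => ricci (jet e ω y) i i) x :=
    pd_sum (fun i _ => (SmoothLagr.ricci i i).differentiableAt_jet hc hU hx) l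
  unfold framePd covRicci
  rw [Finset.sum_comm]
  refine Finset.sum_congr rfl fun μ _ => ?_
  have w := hc.antisymm x hx μ
  have w0 := eq_zero_of_antisymm w
  have w1 := w 1 0
  have w2 := w 2 0
  have w3 := w 2 1
  rw [h1]
  simp only [Fin.sum_univ_three, w0, w1, w2, w3]
  ring

theorem covRicci_symm (hT : TorsionFree U e ω) (hU : IsOpen U) (hc : IsConfiguration U e ω)
    {x : Pt} (hx : x ∈ U) (d a c : Fin 3) : covRicci e ω x d a c = covRicci e ω x d c a := by
  refine Finset.sum_congr rfl fun μ _ => ?_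
  rw [pd_congr hU (fun y hy => ricci_symm hT hU hc hy a c) hx]
  simp only [ricci_symm hT hU hc hx a, ricci_symm hT hU hc hx c]
  ring

/-- Double contraction of the cyclic identity; the antisymmetries turn each of the last two terms
into minus the divergence of the Ricci tensor. -/
theorem bianchi_contracted (hT : TorsionFree U e ω) (hU : IsOpen U) (hc : IsConfiguration U e ω)
    {x : Pt} (hx : x ∈ U) (d : Fin 3) :
    ∑ i, covRicci e ω x d i i = 2 * ∑ a, covRicci e ω x a a d := by
  have A (d a b c k) : covCurvature e ω x d a b c k = -covCurvature e ω x d b a c k := by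
    have h1 (l μ ν) : pd l (fun y => curvature (jet e ω y) μ ν c k) x
        = -pd l (fun y => curvature (jet e ω y) ν μ c k) x := by
      rw [← pd_neg]
      exact congrArg (fun f => pd l f x) (funext fun y => by simp only [curvature]; ring)
    have h2 (i j m n) := curvatureL_antisymm_left (jet e ω x) i j m n
    unfold covCurvature
    rw [neg_add, ← Finset.sum_neg_distrib, ← Finset.sum_neg_distrib]
    refine congrArg₂ _ (Finset.sum_congr rfl fun l _ => ?_) (Finset.sum_congr rfl fun m _ => ?_)
    · rw [Finset.sum_comm, ← Finset.sum_neg_distrib]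
      refine Finset.sum_congr rfl fun μ _ => ?_
      rw [← Finset.sum_neg_distrib]
      refine Finset.sum_congr rfl fun ν _ => ?_
      rw [h1 l ν μ]
      ring
    · rw [h2 m b, h2 a m, h2 a b c m, h2 a b m k]
      ring
  have A' (d a b c k) : covCurvature e ω x d a b c k = -covCurvature e ω x d a b k c := by
    have h1 (l μ ν) : pd l (fun y => curvature (jet e ω y) μ ν c k) x
        = -pd l (fun y => curvature (jet e ω y) μ ν k c) x := by
      rw [← pd_neg]
      refine pd_congr hU (fun y hy => ?_) hx l
      have hJ := hc.antisymm_jet hU hy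
      simp only [curvature, hJ.dω _ _ c k]
      have h3 (μ ν) : ∑ m, (jet e ω y).ω μ c m * (jet e ω y).ω ν m k
          = ∑ m, (jet e ω y).ω ν k m * (jet e ω y).ω μ m c :=
        Finset.sum_congr rfl fun m _ => by rw [hJ.ω μ c m, hJ.ω ν m k]; ring
      rw [h3, h3]
      ring
    have h2 (i j m n) := (hc.antisymm_jet hU hx).curvatureL i j m n
    have w (i j) := (hc.antisymm_jet hU hx).frameω d i j
    unfold covCurvature
    rw [neg_add, ← Finset.sum_neg_distrib, ← Finset.sum_neg_distrib]
    refine congrArg₂ _ (Finset.sum_congr rfl fun l _ => ?_) (Finset.sum_congr rfl fun m _ => ?_)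
    · rw [← Finset.sum_neg_distrib]
      refine Finset.sum_congr rfl fun μ _ => ?_
      rw [← Finset.sum_neg_distrib]
      refine Finset.sum_congr rfl fun ν _ => ?_
      rw [h1]
      ring
    · rw [h2 m b c k, h2 a m c k, h2 a b c m, h2 a b m k, w m k, w c m]
      ring
  have h1 (c) : ∑ a, covRicci e ω x a a c = ∑ a, covRicci e ω x a c a :=
    Finset.sum_congr rfl fun a _ => covRicci_symm hT hU hc hx a a c
  have h2 : ∑ a, ∑ b, (covCurvature e ω x d a b a b + covCurvature e ω x a b d a b
      + covCurvature e ω x b d a a b) = 0 := by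
    simp only [covCurvature_cyclic hT hU hc hx, Finset.sum_const_zero]
  have h3 (a b) : covCurvature e ω x a b d a b = -covCurvature e ω x a d b a b := A _ _ _ _ _
  have h4 (a b) : covCurvature e ω x b d a a b = -covCurvature e ω x b d a b a := A' _ _ _ _ _
  simp only [h3, h4, Finset.sum_add_distrib, Finset.sum_neg_distrib] at h2
  rw [Finset.sum_comm (f := fun a b => covCurvature e ω x b d a b a)] at h2
  rw [h1]
  simp only [covRicci_eq hU hc hx]
  linarith

end

section

variable {U : Set Pt} {e : Pt → Vielbein} {ω : Pt → Connection}

/-! ### The connection equation for zero torsion -/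

/-- The first variation of the curvature. -/
def varCurvature (w : Connection) (b : Connection) (db : Fin 3 → Connection) (μ ν j i : Fin 3) :
    ℝ :=
  (db μ ν j i - ∑ k, (b μ j k * w ν k i + w μ j k * b ν k i))
    - (db ν μ j i - ∑ k, (b ν j k * w μ k i + w ν j k * b μ k i))

/-- The derivative of the Lagrangian `ricciLagr` with respect to the Ricci tensor. -/
def ricciStress (s t : ℝ) (J : Jet) (a c : Fin 3) : ℝ :=
  2 * s * ricci J a c + 2 * t * kron a c * scalarCurv J

theorem SmoothLagr.ricciStress (s t : ℝ) (a c : Fin 3) :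
    SmoothLagr fun J => ricciStress s t J a c :=
  .add (.mul (.const _) (.ricci _ _)) (.mul (.const _) .scalarCurv)

theorem fderiv_ricciLagr (s t : ℝ) {J : JetSpace} (h : detE J.1.1 ≠ 0) (b : Connection)
    (d : Fin 3 → Fld) :
    fderiv ℝ (fun J => ricciLagr s t (toJet J)) J ((0, b), d)
      = detE J.1.1 * ∑ a, ∑ c, ricciStress s t (toJet J) a c * ∑ k, ∑ μ, ∑ ν,
        varCurvature J.1.2 b (fun ν => (d ν).2) μ ν c k * invE J.1.1 μ a * invE J.1.1 ν k := by
  refine fderiv_eq_of_line ((SmoothLagr.ricciLagr s t).differentiableAt h) ?_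
  have hl (c m : ℝ) : HasDerivAt (fun r : ℝ => c + r * m) m 0 := by
    simpa using ((hasDerivAt_id (0 : ℝ)).mul_const m).const_add c
  have h1 (μ ν j i : Fin 3) : HasDerivAt
      (fun r : ℝ => curvature (toJet (J + r • ((0, b), d))) μ ν j i)
      (varCurvature J.1.2 b (fun ν => (d ν).2) μ ν j i) 0 := by
    have h2 := ((hl ((J.2 μ).2 ν j i) ((d μ).2 ν j i)).fun_sub (HasDerivAt.fun_sum
      (u := Finset.univ) fun k _ => (hl (J.1.2 μ j k) (b μ j k)).fun_mul
        (hl (J.1.2 ν k i) (b ν k i)))).fun_sub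
      ((hl ((J.2 ν).2 μ j i) ((d ν).2 μ j i)).fun_sub (HasDerivAt.fun_sum
      (u := Finset.univ) fun k _ => (hl (J.1.2 ν j k) (b ν j k)).fun_mul
        (hl (J.1.2 μ k i) (b μ k i))))
    simp only [zero_mul, add_zero] at h2
    exact h2
  have h3 (a c : Fin 3) : HasDerivAt (fun r : ℝ => ricci (toJet (J + r • ((0, b), d))) a c)
      (∑ k, ∑ μ, ∑ ν, varCurvature J.1.2 b (fun ν => (d ν).2) μ ν c k * invE J.1.1 μ a
        * invE J.1.1 ν k) 0 := by
    have h4 := HasDerivAt.fun_sum (u := Finset.univ) fun k _ => HasDerivAt.fun_sum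
      (u := Finset.univ) fun μ _ => HasDerivAt.fun_sum (u := Finset.univ) fun ν _ =>
      ((h1 μ ν c k).mul_const (invE J.1.1 μ a)).mul_const (invE J.1.1 ν k)
    refine h4.congr_of_eventuallyEq (Filter.Eventually.of_forall fun r => ?_)
    simp [ricci, curvatureL, toJet]
  -- The variation of the Ricci tensor enters linearly, so it is replaced by an arbitrary X before
  -- the squares are expanded.
  suffices key : ∀ X : Fin 3 → Fin 3 → ℝ,
      (∀ a c, HasDerivAt (fun r : ℝ => ricci (toJet (J + r • ((0, b), d))) a c) (X a c) 0) →
      HasDerivAt (fun r : ℝ => ricciLagr s t (toJet (J + r • ((0, b), d))))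
        (detE J.1.1 * ∑ a, ∑ c, ricciStress s t (toJet J) a c * X a c) 0 from key _ h3
  intro X h3
  have h5 := (((HasDerivAt.fun_sum (u := Finset.univ) fun i _ => HasDerivAt.fun_sum
    (u := Finset.univ) fun k _ => (h3 i k).fun_pow 2).const_mul s).fun_add
    (((HasDerivAt.fun_sum (u := Finset.univ) fun i _ => h3 i i).fun_pow 2).const_mul t)).const_mul
    (detE J.1.1)
  refine (h5.congr_of_eventuallyEq (Filter.Eventually.of_forall fun r => ?_)).congr_deriv ?_
  · simp [ricciLagr, toJet, scalarCurv]
  · simp only [ricciStress, scalarCurv, kron, zero_smul, add_zero]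
    simp [Fin.sum_univ_three, -mul_eq_mul_left_iff]
    ring

/-- The divergence that appears on integrating by parts. Differentiating the determinant and the
inverse vielbeins gives only the antisymmetrized frame derivatives and one uncontracted `frameDE`
term. -/
theorem sum_pd_frame (hU : IsOpen U) (hc : IsConfiguration U e ω) {x : Pt} (hx : x ∈ U)
    {f : Pt → ℝ} (hf : DifferentiableAt ℝ f x) (a k l : Fin 3) :
    ∑ ν, pd ν (fun y => detE (e y) * (invE (e y) ν a * invE (e y) l k * f y)) x
      = detE (e x) * ((∑ m, (frameDE (jet e ω x) a m m - frameDE (jet e ω x) m a m))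
        * (invE (e x) l k * f x) - (∑ m, frameDE (jet e ω x) a k m * invE (e x) l m) * f x
        + invE (e x) l k * framePd e f a x) := by
  have hv := hc.differentiableAt_invE hU hx
  have hd : DifferentiableAt ℝ (fun y => detE (e y)) x :=
    SmoothLagr.detE.differentiableAt_jet hc hU hx
  have h1 (ν : Fin 3) : pd ν (fun y => detE (e y) * (invE (e y) ν a * invE (e y) l k * f y)) x
      = pd ν (fun y => detE (e y)) x * (invE (e x) ν a * invE (e x) l k * f x)
        + detE (e x) * ((pd ν (fun y => invE (e y) ν a) x * invE (e x) l k
          + invE (e x) ν a * pd ν (fun y => invE (e y) l k) x) * f x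
          + invE (e x) ν a * invE (e x) l k * pd ν f x) := by
    rw [pd_mul hd (((hv ν a).fun_mul (hv l k)).fun_mul hf), pd_mul ((hv ν a).fun_mul (hv l k)) hf,
      pd_mul (hv ν a) (hv l k)]
  have hD (i j k) : frameDE (jet e ω x) i j k = ∑ μ, ∑ ν, pd μ (fun y => e y ν k) x
    * invE (e x) μ i * invE (e x) ν j := rfl
  simp only [h1, pd_detE hU hc hx, pd_invE hU hc hx, hD, framePd]
  simp only [Fin.sum_univ_three]
  ring

/-- The covariant derivative `∇_d S_{ac}` of the tensor `ricciStress`. -/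
def covStress (s t : ℝ) (e : Pt → Vielbein) (ω : Pt → Connection) (x : Pt) (d a c : Fin 3) : ℝ :=
  framePd e (fun y => ricciStress s t (jet e ω y) a c) d x
    - ∑ l, (frameω (jet e ω x) d a l * ricciStress s t (jet e ω x) l c
      + frameω (jet e ω x) d c l * ricciStress s t (jet e ω x) a l)

theorem sum_varCurvature_zero (w b : Connection) (v : Fin 3 → Fin 3 → ℝ) (a c k : Fin 3) :
    ∑ μ, ∑ ν, varCurvature w b 0 μ ν c k * v μ a * v ν k
      = ∑ n, (-((∑ l, b l c n * v l a) * ∑ l, w l n k * v l k)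
        - (∑ l, w l c n * v l a) * (∑ l, b l n k * v l k)
        + (∑ l, b l c n * v l k) * (∑ l, w l n k * v l a)
        + (∑ l, w l c n * v l k) * ∑ l, b l n k * v l a) := by
  simp only [varCurvature, Fin.sum_univ_three]
  simp
  ring

theorem sum_varCurvature_single (w b : Connection) (v : Fin 3 → Fin 3 → ℝ) (n a c k : Fin 3) :
    ∑ μ, ∑ ν, varCurvature w 0 (Pi.single n b) μ ν c k * v μ a * v ν k
      = ∑ l, b l c k * (v n a * v l k - v n k * v l a) := by
  simp only [varCurvature]
  fin_cases n <;> simp [Fin.sum_univ_three] <;> ring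

/-- The Palatini variation of the Ricci tensor, integrated by parts. With zero torsion the
derivatives of the vielbein turn into frame components of ω, and together with the algebraic terms
in ω they complete the derivatives of S = `ricciStress` to covariant ones. -/
theorem EL_ricciLagr (hT : TorsionFree U e ω) (hU : IsOpen U) (hc : IsConfiguration U e ω)
    (s t : ℝ) {b : Connection} (hb : Fld.Antisymm (0, b)) {x : Pt} (hx : x ∈ U) :
    EL (ricciLagr s t) e ω (0, b) x = -(detE (e x) * ∑ m, ∑ c, ∑ k, (∑ l, b l c k * invE (e x) l m)
      * (kron m k * (∑ a, covStress s t e ω x a a c) - covStress s t e ω x k m c)) := by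
  have hS (a c) : DifferentiableAt ℝ (fun y => ricciStress s t (jet e ω y) a c) x :=
    (SmoothLagr.ricciStress s t a c).differentiableAt_jet hc hU hx
  have hv := hc.differentiableAt_invE hU hx
  have hd : DifferentiableAt ℝ (fun y => detE (e y)) x :=
    SmoothLagr.detE.differentiableAt_jet hc hU hx
  have h1 : fderiv ℝ (fun J => ricciLagr s t (toJet J)) (jetMap e ω x) ((0, b), 0)
      = detE (e x) * ∑ a, ∑ c, ricciStress s t (jet e ω x) a c * ∑ k, ∑ n,
        (-((∑ l, b l c n * invE (e x) l a) * frameω (jet e ω x) k n k)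
        - frameω (jet e ω x) a c n * (∑ l, b l n k * invE (e x) l k)
        + (∑ l, b l c n * invE (e x) l k) * frameω (jet e ω x) a n k
        + frameω (jet e ω x) k c n * ∑ l, b l n k * invE (e x) l a) := by
    rw [fderiv_ricciLagr s t (J := jetMap e ω x) (hc.detE_ne_zero hx)]
    exact congrArg _ (Finset.sum_congr rfl fun a _ => Finset.sum_congr rfl fun c _ =>
      congrArg _ (Finset.sum_congr rfl fun k _ => sum_varCurvature_zero (ω x) b (invE (e x)) a c k))
  have h2 (y : Pt) (hy : y ∈ U) (ν : Fin 3) : fderiv ℝ (fun J => ricciLagr s t (toJet J))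
      (jetMap e ω y) (0, Pi.single ν (0, b)) = ∑ a, ∑ c, ∑ k, ∑ l, b l c k *
        (detE (e y) * (invE (e y) ν a * invE (e y) l k * ricciStress s t (jet e ω y) a c)
        - detE (e y) * (invE (e y) ν k * invE (e y) l a * ricciStress s t (jet e ω y) a c)) := by
    have h3 := fderiv_ricciLagr s t (J := jetMap e ω y) (hc.detE_ne_zero hy) 0 (Pi.single ν (0, b))
    have h4 : (fun ν' => ((Pi.single ν (0, b) : Fin 3 → Fld) ν').2) = Pi.single ν b := by
      funext ν'
      rcases eq_or_ne ν' ν with rfl | h <;> simp [*]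
    rw [h4] at h3
    refine h3.trans ?_
    rw [Finset.mul_sum]
    refine Finset.sum_congr rfl fun a _ => ?_
    rw [Finset.mul_sum]
    refine Finset.sum_congr rfl fun c _ => ?_
    rw [Finset.mul_sum, Finset.mul_sum]
    refine Finset.sum_congr rfl fun k _ => ?_
    rw [sum_varCurvature_single, Finset.mul_sum, Finset.mul_sum]
    refine Finset.sum_congr rfl fun l _ => ?_
    simp only [jetMap, toJet, jet]
    ring
  have h5 (ν : Fin 3) : pd ν (fun y => fderiv ℝ (fun J => ricciLagr s t (toJet J))
      (jetMap e ω y) (0, Pi.single ν (0, b))) x = ∑ a, ∑ c, ∑ k, ∑ l, b l c k *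
        (pd ν (fun y => detE (e y) * (invE (e y) ν a * invE (e y) l k
          * ricciStress s t (jet e ω y) a c)) x
        - pd ν (fun y => detE (e y) * (invE (e y) ν k * invE (e y) l a
          * ricciStress s t (jet e ω y) a c)) x) := by
    have d1 (a c k l) : DifferentiableAt ℝ (fun y => detE (e y) * (invE (e y) ν a * invE (e y) l k
          * ricciStress s t (jet e ω y) a c)) x :=
      hd.fun_mul (((hv ν a).fun_mul (hv l k)).fun_mul (hS a c))
    have d2 (a c k l) : DifferentiableAt ℝ (fun y => detE (e y) * (invE (e y) ν k * invE (e y) l a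
          * ricciStress s t (jet e ω y) a c)) x :=
      hd.fun_mul (((hv ν k).fun_mul (hv l a)).fun_mul (hS a c))
    have d3 (a c k l) := (differentiableAt_const (b l c k)).fun_mul
      ((d1 a c k l).fun_sub (d2 a c k l))
    rw [pd_congr hU (fun y hy => h2 y hy ν) hx, pd_sum fun a _ => .fun_sum fun c _ =>
      .fun_sum fun k _ => .fun_sum fun l _ => d3 a c k l]
    refine Finset.sum_congr rfl fun a _ => ?_
    rw [pd_sum fun c _ => .fun_sum fun k _ => .fun_sum fun l _ => d3 a c k l]
    refine Finset.sum_congr rfl fun c _ => ?_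
    rw [pd_sum fun k _ => .fun_sum fun l _ => d3 a c k l]
    refine Finset.sum_congr rfl fun k _ => ?_
    rw [pd_sum fun l _ => d3 a c k l]
    refine Finset.sum_congr rfl fun l _ => ?_
    rw [pd_mul (differentiableAt_const _) ((d1 a c k l).fun_sub (d2 a c k l)),
      pd_sub (d1 a c k l) (d2 a c k l), pd_const, zero_mul, zero_add]
  have h6 : ∑ ν, pd ν (fun y => fderiv ℝ (fun J => ricciLagr s t (toJet J))
      (jetMap e ω y) (0, Pi.single ν (0, b))) x = ∑ a, ∑ c, ∑ k, ∑ l, b l c k *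
        ((∑ ν, pd ν (fun y => detE (e y) * (invE (e y) ν a * invE (e y) l k
          * ricciStress s t (jet e ω y) a c)) x)
        - ∑ ν, pd ν (fun y => detE (e y) * (invE (e y) ν k * invE (e y) l a
          * ricciStress s t (jet e ω y) a c)) x) := by
    simp only [h5, ← Finset.sum_sub_distrib, Finset.mul_sum]
    rw [Finset.sum_comm]
    refine Finset.sum_congr rfl fun a _ => ?_
    rw [Finset.sum_comm]
    refine Finset.sum_congr rfl fun c _ => ?_
    rw [Finset.sum_comm]
    refine Finset.sum_congr rfl fun k _ => ?_
    rw [Finset.sum_comm]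
  have h7 : ∑ a, ∑ c, ∑ k, ∑ l, b l c k *
        ((∑ ν, pd ν (fun y => detE (e y) * (invE (e y) ν a * invE (e y) l k
          * ricciStress s t (jet e ω y) a c)) x)
        - ∑ ν, pd ν (fun y => detE (e y) * (invE (e y) ν k * invE (e y) l a
          * ricciStress s t (jet e ω y) a c)) x)
      = detE (e x) * ∑ a, ∑ c, ∑ k, ((∑ l, b l c k * invE (e x) l k)
          * ((∑ m, (frameω (jet e ω x) m a m - frameω (jet e ω x) a m m))
            * ricciStress s t (jet e ω x) a c
            + framePd e (fun y => ricciStress s t (jet e ω y) a c) a x)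
        - (∑ m, (∑ l, b l c k * invE (e x) l m)
          * (frameω (jet e ω x) k a m - frameω (jet e ω x) a k m))
          * ricciStress s t (jet e ω x) a c
        - (∑ l, b l c k * invE (e x) l a)
          * ((∑ m, (frameω (jet e ω x) m k m - frameω (jet e ω x) k m m))
            * ricciStress s t (jet e ω x) a c
            + framePd e (fun y => ricciStress s t (jet e ω y) a c) k x)) := by
    -- Here zero torsion is used to trade the antisymmetrized `frameDE` for `frameω`. The
    -- uncontracted `frameDE` terms occur only antisymmetrized, because the integrand is
    -- antisymmetric in the two inverse vielbeins.
    have hw (a b m) := frameω_symm hT hc hx a b m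
    have hw1 (a) : ∑ m, (frameDE (jet e ω x) a m m - frameDE (jet e ω x) m a m)
        = ∑ m, (frameω (jet e ω x) m a m - frameω (jet e ω x) a m m) :=
      Finset.sum_congr rfl fun m _ => by linarith [hw a m m]
    have hw2 (a k m) : frameω (jet e ω x) k a m - frameω (jet e ω x) a k m
        = frameDE (jet e ω x) a k m - frameDE (jet e ω x) k a m := by linarith [hw a k m]
    rw [Finset.mul_sum]
    refine Finset.sum_congr rfl fun a _ => ?_
    rw [Finset.mul_sum]
    refine Finset.sum_congr rfl fun c _ => ?_
    rw [Finset.mul_sum]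
    refine Finset.sum_congr rfl fun k _ => ?_
    simp only [sum_pd_frame hU hc hx (hS a c), hw1, hw2]
    simp only [Fin.sum_univ_three]
    ring
  unfold EL
  rw [h1, h6, h7, ← mul_sub, ← mul_neg]
  congr 1
  unfold covStress
  clear h1 h2 h5 h6 h7
  have w0 (d) := eq_zero_of_antisymm fun i j => (hc.antisymm_jet hU hx).frameω d i j
  have w1 (d) := (hc.antisymm_jet hU hx).frameω d 1 0
  have w2 (d) := (hc.antisymm_jet hU hx).frameω d 2 0
  have w3 (d) := (hc.antisymm_jet hU hx).frameω d 2 1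
  have hb' : ∀ l i j, b l i j = -b l j i := hb
  have hB (m i j) : ∑ l, b l i j * invE (e x) l m = -∑ l, b l j i * invE (e x) l m := by
    rw [← Finset.sum_neg_distrib]
    exact Finset.sum_congr rfl fun l _ => by rw [hb' l i j]; ring
  generalize frameω (jet e ω x) = w at *
  generalize ricciStress s t (jet e ω x) = S
  -- The variation and the derivatives of S are replaced by arbitrary arrays B and D; what is left
  -- is a polynomial identity in B, D, S and the frame components of ω.
  have hBB : ∃ B : Fin 3 → Fin 3 → Fin 3 → ℝ, ∀ m i j, ∑ l, b l i j * invE (e x) l m = B m i j :=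
    ⟨_, fun _ _ _ => rfl⟩
  obtain ⟨B, hB'⟩ := hBB
  have hDD : ∃ D : Fin 3 → Fin 3 → Fin 3 → ℝ, ∀ d a c,
      framePd e (fun y => ricciStress s t (jet e ω y) a c) d x = D d a c := ⟨_, fun _ _ _ => rfl⟩
  obtain ⟨D, hD'⟩ := hDD
  simp only [hB', hD'] at *
  have B0 (d) := eq_zero_of_antisymm (hB d)
  have B1 (d) := hB d 1 0
  have B2 (d) := hB d 2 0
  have B3 (d) := hB d 2 1
  simp only [Fin.sum_univ_three, kron, w0, w1, w2, w3, B0, B1, B2, B3]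
  simp
  ring

end

section

variable {U : Set Pt} {e : Pt → Vielbein} {ω : Pt → Connection}

/-! ### Arbitrary variations -/

theorem EL_map_sum {L : Jet → ℝ} (hL : SmoothLagr L) (hU : IsOpen U)
    (hc : IsConfiguration U e ω) {x : Pt} (hx : x ∈ U) {ι : Type*} (s : Finset ι) (δ : ι → Fld) :
    EL L e ω (∑ i ∈ s, δ i) x = ∑ i ∈ s, EL L e ω (δ i) x := by
  classical
  induction s using Finset.induction_on with
  | empty => simpa using EL_map_smul hL hU hc hx 0 0
  | insert i s hi ih => rw [Finset.sum_insert hi, EL_map_add hL hU hc hx, ih, Finset.sum_insert hi]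

theorem vielbeinEq_iff (p : Params) (hU : IsOpen U) (hc : IsConfiguration U e ω) :
    VielbeinEq p U e ω ↔
      ∀ x ∈ U, ∀ a : Vielbein, EL (lagrangian p) e ω (a, 0) x = 0 := by
  have s := SmoothLagr.lagrangian p
  refine forall₂_congr fun x hx => ⟨fun h a => ?_, fun h μ i => ?_⟩
  · have h1 : ((a, 0) : Fld) = ∑ y : Fin 3 × Fin 3,
        a y.1 y.2 • ((Pi.single y.1 (Pi.single y.2 1), 0) : Fld) := by
      refine Prod.ext ?_ ?_
      · rw [Prod.fst_sum]
        funext μ i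
        fin_cases μ <;> fin_cases i <;>
          simp [Fintype.sum_prod_type, Fin.sum_univ_three]
      · rw [Prod.snd_sum]
        simp
    rw [h1, EL_map_sum s hU hc hx]
    refine Finset.sum_eq_zero fun y _ => ?_
    rw [EL_map_smul s hU hc hx, ← elVielbein_eq s hU hc hx, h, mul_zero]
  · rw [elVielbein_eq s hU hc hx]
    exact h _

theorem antisymm_single (μ i j : Fin 3) : Fld.Antisymm
    (0, Pi.single μ (Pi.single i (Pi.single j 1) - Pi.single j (Pi.single i 1))) := by
  intro ν k l
  rcases eq_or_ne ν μ with rfl | h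
  · simp [Pi.single_apply, ite_apply]
    split_ifs <;> simp_all
  · simp [h]

theorem connectionEq_iff (p : Params) (hU : IsOpen U) (hc : IsConfiguration U e ω) :
    ConnectionEq p U e ω ↔
      ∀ x ∈ U, ∀ b : Connection, Fld.Antisymm (0, b) → EL (lagrangian p) e ω (0, b) x = 0 := by
  have s := SmoothLagr.lagrangian p
  refine forall₂_congr fun x hx => ⟨fun h b hb => ?_, fun h μ i j => ?_⟩
  -- The factor 1/2 appears because the pairs (i, j) and (j, i) give the same contribution.
  · have h1 : ((0, b) : Fld) = ∑ y : Fin 3 × Fin 3 × Fin 3, ((1 / 2) * b y.1 y.2.1 y.2.2) •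
        ((0, Pi.single y.1 (Pi.single y.2.1 (Pi.single y.2.2 1)
          - Pi.single y.2.2 (Pi.single y.2.1 1))) : Fld) := by
      have hb' : ∀ l i j, b l i j = -b l j i := hb
      have b0 (l) := eq_zero_of_antisymm (hb' l)
      have b1 (l) := hb' l 1 0
      have b2 (l) := hb' l 2 0
      have b3 (l) := hb' l 2 1
      refine Prod.ext ?_ ?_
      · rw [Prod.fst_sum]
        simp
      · rw [Prod.snd_sum]
        funext μ i j
        fin_cases μ <;> fin_cases i <;> fin_cases j <;>
          simp [Fintype.sum_prod_type, Fin.sum_univ_three, b0, b1, b2, b3] <;> ring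
    rw [h1, EL_map_sum s hU hc hx]
    refine Finset.sum_eq_zero fun y _ => ?_
    rw [EL_map_smul s hU hc hx, ← elConnection_eq s hU hc hx, h, mul_zero]
  · rw [elConnection_eq s hU hc hx]
    exact h _ (antisymm_single μ i j)

/-- The connection with the given frame components. -/
def ofFrame (e : Vielbein) (B : Fin 3 → Fin 3 → Fin 3 → ℝ) : Connection := fun l j k =>
  ∑ i, e l i * B i j k

theorem sum_ofFrame {e : Vielbein} (h : detE e ≠ 0) (B : Fin 3 → Fin 3 → Fin 3 → ℝ)
    (m j k : Fin 3) : ∑ l, ofFrame e B l j k * invE e l m = B m j k := by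
  calc ∑ l, ofFrame e B l j k * invE e l m = ∑ i, (∑ l, invE e l m * e l i) * B i j k := by
        simp only [ofFrame, Fin.sum_univ_three]
        ring
    _ = _ := by
        simp only [sum_invE_mul h]
        simp [kron]

theorem antisymm_ofFrame (e : Vielbein) {B : Fin 3 → Fin 3 → Fin 3 → ℝ}
    (hB : ∀ i j k, B i j k = -B i k j) : Fld.Antisymm (0, ofFrame e B) := fun l j k => by
  simp only [ofFrame, ← Finset.sum_neg_distrib]
  exact Finset.sum_congr rfl fun i _ => by rw [hB i j k]; ring

/-! ### Necessity of the relations between the `β`s -/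

/-- The derivative of the terms quadratic in torsion with respect to the torsion. -/
def torsionStress (b₁ b₂ b₃ : ℝ) (T : Fin 3 → Fin 3 → Fin 3 → ℝ) (i j k : Fin 3) : ℝ :=
  b₁ * T i j k + b₂ / 2 * (T k i j + T j k i)
    + b₃ / 2 * (kron i k * tracePart T j - kron j k * tracePart T i)

theorem EL_connection_of_line {L : Jet → ℝ} (hL : SmoothLagr L) (hU : IsOpen U)
    (hc : IsConfiguration U e ω) (hdω : ∀ J d, L { J with dω := d } = L J) (b : Connection) {x : Pt}
    (hx : x ∈ U) {d : ℝ}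
    (hd : HasDerivAt (fun t : ℝ => L { jet e ω x with ω := ω x + t • b }) d 0) :
    EL L e ω (0, b) x = d := by
  have h1 (y) (hy : y ∈ U) (ν : Fin 3) :
      fderiv ℝ (fun J => L (toJet J)) (jetMap e ω y) (0, Pi.single ν (0, b)) = 0 := by
    refine fderiv_eq_of_line (hL.differentiableAt (J := jetMap e ω y) (hc.det_ne_zero y hy)) ?_
    refine (hasDerivAt_const (0 : ℝ) (L (toJet (jetMap e ω y)))).congr_of_eventuallyEq
      (Filter.Eventually.of_forall fun t => ?_)
    rw [← hdω (toJet (jetMap e ω y)) (toJet (jetMap e ω y + t • (0, Pi.single ν (0, b)))).dω]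
    refine congrArg L ?_
    simp only [toJet, Jet.mk.injEq]
    refine ⟨by simp, by simp, ?_, trivial⟩
    funext ν'
    rcases eq_or_ne ν' ν with rfl | h <;> simp [*]
  have h2 : fderiv ℝ (fun J => L (toJet J)) (jetMap e ω x) ((0, b), 0) = d := by
    refine fderiv_eq_of_line (hL.differentiableAt (J := jetMap e ω x) (hc.det_ne_zero x hx)) ?_
    refine hd.congr_of_eventuallyEq (Filter.Eventually.of_forall fun t => ?_)
    simp [toJet, jetMap, jet]
  unfold EL
  rw [h2, Finset.sum_congr rfl fun ν _ => (pd_congr hU (g := fun _ => 0)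
    (fun y hy => h1 y hy ν) hx ν).trans (pd_const 0 ν x)]
  simp

theorem torsionL_antisymm (J : Jet) (i j k : Fin 3) : torsionL J i j k = -torsionL J j i k := by
  simp only [torsionL, torsion, Fin.sum_univ_three]
  ring

/-- The connection enters the torsion algebraically, through the shift B_{ijk} - B_{jik} in the
frame, so no integration by parts is needed and `torsionStress` appears as the gradient of the
quadratic form. -/
theorem EL_torsionTerms (hU : IsOpen U) (hc : IsConfiguration U e ω) (b₁ b₂ b₃ : ℝ)
    (B : Fin 3 → Fin 3 → Fin 3 → ℝ) {x : Pt} (hx : x ∈ U) :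
    EL (lagrangian (Params.torsionTerms b₁ b₂ b₃)) e ω (0, ofFrame (e x) B) x
      = detE (e x) * ((1 / 2) * ∑ i, ∑ j, ∑ k, (B i j k - B j i k)
        * torsionStress b₁ b₂ b₃ (torsionL (jet e ω x)) i j k) := by
  have h := hc.detE_ne_zero hx
  refine EL_connection_of_line (SmoothLagr.lagrangian _) hU hc (fun J d => ?_) _ hx ?_
  · simp only [lagrangian_torsionTerms]
    rfl
  have h1 (r : ℝ) (i j k : Fin 3) :
      torsionL { jet e ω x with ω := ω x + r • ofFrame (e x) B } i j k
        = torsionL (jet e ω x) i j k + r * (B i j k - B j i k) := by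
    have h2 (i j k : Fin 3) : frameω { jet e ω x with ω := ω x + r • ofFrame (e x) B } i j k
        = frameω (jet e ω x) i j k + r * B i j k := by
      rw [← sum_ofFrame h B, Finset.mul_sum]
      simp only [frameω, ← Finset.sum_add_distrib]
      refine Finset.sum_congr rfl fun μ _ => ?_
      simp [jet]
      ring
    have h3 (i j k : Fin 3) : frameDE { jet e ω x with ω := ω x + r • ofFrame (e x) B } i j k
        = frameDE (jet e ω x) i j k := rfl
    rw [torsionL_eq (J := { jet e ω x with ω := ω x + r • ofFrame (e x) B }) h, torsionL_eq h,
      h2, h2, h3, h3]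
    ring
  have hl (c m : ℝ) : HasDerivAt (fun r : ℝ => c + r * m) m 0 := by
    simpa using ((hasDerivAt_id (0 : ℝ)).mul_const m).const_add c
  have A := torsionL_antisymm (jet e ω x)
  simp only [lagrangian_torsionTerms, h1, tracePart]
  generalize torsionL (jet e ω x) = T at *
  have h4 := (HasDerivAt.fun_sum (u := (Finset.univ : Finset (Fin 3 × Fin 3 × Fin 3))) fun y _ =>
    (hl (T y.1 y.2.1 y.2.2) (B y.1 y.2.1 y.2.2 - B y.2.1 y.1 y.2.2)).fun_mul
    (((((hl (T y.1 y.2.1 y.2.2) (B y.1 y.2.1 y.2.2 - B y.2.1 y.1 y.2.2)).const_mul b₁).fun_add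
      ((hl (T y.2.2 y.1 y.2.1) (B y.2.2 y.1 y.2.1 - B y.1 y.2.2 y.2.1)).const_mul b₂)).fun_add
      (((HasDerivAt.fun_sum (u := Finset.univ) fun i _ => hl (T i y.2.1 i)
        (B i y.2.1 i - B y.2.1 i i)).mul_const (kron y.1 y.2.2)).const_mul b₃)).const_mul
      (1 / 4))).const_mul (detE (e x))
  refine h4.congr_deriv ?_
  congr 1
  have a0 (i k) := eq_zero_of_antisymm (fun i j => A i j k) i
  have a1 (k) := A 1 0 k
  have a2 (k) := A 2 0 k
  have a3 (k) := A 2 1 k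
  simp only [Fintype.sum_prod_type, torsionStress, tracePart, zero_mul, add_zero, kron]
  simp [Fin.sum_univ_three, a0, a1, a2, a3]
  ring

theorem torsionStress_antisymm {T : Fin 3 → Fin 3 → Fin 3 → ℝ}
    (A : ∀ i j k, T i j k = -T j i k) (b₁ b₂ b₃ : ℝ) (i j k : Fin 3) :
    torsionStress b₁ b₂ b₃ T i j k = -torsionStress b₁ b₂ b₃ T j i k := by
  unfold torsionStress
  rw [A i j k, A k i j, A j k i]
  ring

end

section

variable {U : Set Pt} {e : Pt → Vielbein} {ω : Pt → Connection}

theorem axialPart_torsionStress {T : Fin 3 → Fin 3 → Fin 3 → ℝ}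
    (A : ∀ i j k, T i j k = -T j i k) (b₁ b₂ b₃ : ℝ) :
    axialPart (torsionStress b₁ b₂ b₃ T) = (b₁ + b₂) * axialPart T := by
  have a0 (i k) := eq_zero_of_antisymm (fun i j => A i j k) i
  have a1 (k) := A 1 0 k
  have a2 (k) := A 2 0 k
  have a3 (k) := A 2 1 k
  simp [axialPart, torsionStress, tracePart, eps, kron, Fin.sum_univ_three, a0, a1, a2, a3]
  ring

theorem tracePart_torsionStress {T : Fin 3 → Fin 3 → Fin 3 → ℝ}
    (A : ∀ i j k, T i j k = -T j i k) (b₁ b₂ b₃ : ℝ) (j : Fin 3) :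
    tracePart (torsionStress b₁ b₂ b₃ T) j = (b₁ - b₂ / 2 + b₃) * tracePart T j := by
  have a0 (i k) := eq_zero_of_antisymm (fun i j => A i j k) i
  have a1 (k) := A 1 0 k
  have a2 (k) := A 2 0 k
  have a3 (k) := A 2 1 k
  fin_cases j <;>
    simp [torsionStress, tracePart, kron, Fin.sum_univ_three, a0, a1, a2, a3] <;> ring

theorem mixedPart_torsionStress {T : Fin 3 → Fin 3 → Fin 3 → ℝ}
    (A : ∀ i j k, T i j k = -T j i k) (b₁ b₂ b₃ : ℝ) (i j k : Fin 3) :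
    mixedPart (torsionStress b₁ b₂ b₃ T) i j k = (b₁ - b₂ / 2) * mixedPart T i j k := by
  have h := axialPart_torsionStress A b₁ b₂ b₃
  have h' := tracePart_torsionStress A b₁ b₂ b₃
  -- The cyclic sum of T_{ijk} is totally antisymmetric, hence 3 T* ε_{ijk}; the trace terms listed
  -- after it add up to zero.
  have key : b₂ / 2 * (T k i j + T j k i + T i j k - 3 * axialPart T * eps i j k
      - (kron i k * tracePart T j - kron j k * tracePart T i)
      + (1 / 2) * (kron i k * tracePart T j - kron j k * tracePart T i)
      + (1 / 2) * (kron j i * tracePart T k - kron k i * tracePart T j)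
      + (1 / 2) * (kron k j * tracePart T i - kron i j * tracePart T k)
      + (kron i k * tracePart T j - kron j k * tracePart T i)) = 0 := by
    have a0 (i k) := eq_zero_of_antisymm (fun i j => A i j k) i
    have a1 (k) := A 1 0 k
    have a2 (k) := A 2 0 k
    have a3 (k) := A 2 1 k
    refine mul_eq_zero_of_right _ ?_
    fin_cases i <;> fin_cases j <;> fin_cases k <;>
      simp [axialPart, tracePart, eps, kron, Fin.sum_univ_three, a0, a1, a2, a3] <;> ring
  have k1 (i j) : kron i j = kron j i := by simp [kron, eq_comm]
  rw [k1 j i, k1 k i, k1 k j] at key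
  unfold mixedPart
  rw [h, h' i, h' j]
  unfold torsionStress
  linear_combination key

/-- For zero curvature all other terms drop out of the connection equation, which says that the
stress is orthogonal to every B_{ijk} - B_{jik} with B antisymmetric in its last two indices. Those
tensors exhaust the ones antisymmetric in the first two. -/
theorem torsionStress_eq_zero (hR : CurvatureFree U e ω) (hU : IsOpen U)
    (hc : IsConfiguration U e ω) {p : Params} (hω : ConnectionEq p U e ω) {x : Pt} (hx : x ∈ U)
    (i j k : Fin 3) : torsionStress (p.β₁ + p.κ) (p.β₂ - 2 * p.κ) (p.β₃ - 4 * p.κ)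
      (torsionL (jet e ω x)) i j k = 0 := by
  have A := torsionL_antisymm (jet e ω x)
  have A' := torsionStress_antisymm A (p.β₁ + p.κ) (p.β₂ - 2 * p.κ) (p.β₃ - 4 * p.κ)
  have h1 (B : Fin 3 → Fin 3 → Fin 3 → ℝ) (hB : ∀ i j k, B i j k = -B i k j) :
      ∑ i, ∑ j, ∑ k, (B i j k - B j i k) * torsionStress (p.β₁ + p.κ) (p.β₂ - 2 * p.κ)
        (p.β₃ - 4 * p.κ) (torsionL (jet e ω x)) i j k = 0 := by
    have hb := antisymm_ofFrame (e x) hB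
    have h2 := (connectionEq_iff p hU hc).1 hω x hx _ hb
    rw [EL_lagrangian p hU hc _ hx, EL_einstein_connection _ hU hc hb hx,
      EL_curvatureTerms_eq_zero hR hU hc _ _ _ _ hx, EL_cosmological_connection _ hU hc _ hx,
      EL_torsionTerms hU hc _ _ _ _ hx] at h2
    have h3 := hc.detE_ne_zero hx
    simpa [h3] using h2
  generalize torsionStress (p.β₁ + p.κ) (p.β₂ - 2 * p.κ) (p.β₃ - 4 * p.κ)
    (torsionL (jet e ω x)) = E at *
  -- This B satisfies B_{ijk} - B_{jik} = E_{ijk}, so the equation states that the sum of the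
  -- squares of E is zero.
  have h2 := h1 (fun i j k => (1 / 2) * (E i j k - E j k i + E k i j)) fun i j k => by
    rw [A' i j k, A' j k i, A' k i j]; ring
  have h3 : ∑ i, ∑ j, ∑ k, E i j k ^ 2 = 0 := by
    rw [← h2]
    refine Finset.sum_congr rfl fun i _ => Finset.sum_congr rfl fun j _ =>
      Finset.sum_congr rfl fun k _ => ?_
    rw [A' j i k, A' i k j, A' k j i]
    ring
  have h4 := (Finset.sum_eq_zero_iff_of_nonneg fun i _ => Finset.sum_nonneg fun j _ =>
    Finset.sum_nonneg fun k _ => sq_nonneg (E i j k)).1 h3 i (Finset.mem_univ _)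
  have h5 := (Finset.sum_eq_zero_iff_of_nonneg fun j _ =>
    Finset.sum_nonneg fun k _ => sq_nonneg (E i j k)).1 h4 j (Finset.mem_univ _)
  have h6 := (Finset.sum_eq_zero_iff_of_nonneg fun k _ => sq_nonneg (E i j k)).1 h5 k
    (Finset.mem_univ _)
  exact pow_eq_zero_iff two_ne_zero |>.1 h6

theorem betaRel_of_admitsDislocations {p : Params} (hU : IsOpen U)
    (h : AdmitsDislocations p U) : p.BetaRel := by
  obtain ⟨e, ω, hc, hR, ⟨⟨x, hx, i, h1⟩, ⟨y, hy, h2⟩, ⟨z, hz, a, b, c, h3⟩⟩, -, hω⟩ := h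
  have E (x) (hx : x ∈ U) : torsionStress (p.β₁ + p.κ) (p.β₂ - 2 * p.κ) (p.β₃ - 4 * p.κ)
      (torsionL (jet e ω x)) = 0 := by
    funext i j k
    exact torsionStress_eq_zero hR hU hc hω hx i j k
  have g1 := tracePart_torsionStress (torsionL_antisymm (jet e ω x)) (p.β₁ + p.κ)
    (p.β₂ - 2 * p.κ) (p.β₃ - 4 * p.κ) i
  have g2 := axialPart_torsionStress (torsionL_antisymm (jet e ω y)) (p.β₁ + p.κ)
    (p.β₂ - 2 * p.κ) (p.β₃ - 4 * p.κ)
  have g3 := mixedPart_torsionStress (torsionL_antisymm (jet e ω z)) (p.β₁ + p.κ)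
    (p.β₂ - 2 * p.κ) (p.β₃ - 4 * p.κ) a b c
  rw [E x hx] at g1
  rw [E y hy] at g2
  rw [E z hz] at g3
  have f1 := (mul_eq_zero.1 (g1.symm.trans (by simp [tracePart]))).resolve_right h1
  have f2 := (mul_eq_zero.1 (g2.symm.trans (by simp [axialPart]))).resolve_right h2
  have f3 := (mul_eq_zero.1 (g3.symm.trans
    (by simp [mixedPart, axialPart, tracePart]))).resolve_right h3
  -- The factors b₁ - b₂/2 + b₃, b₁ + b₂, b₁ - b₂/2 vanish only for b₁ = b₂ = b₃ = 0.
  refine ⟨?_, ?_, ?_⟩ <;> linarith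

/-! ### Necessity of the relations between the `γ`s -/

theorem framePd_ricciStress (hU : IsOpen U) (hc : IsConfiguration U e ω) {x : Pt} (hx : x ∈ U)
    (s t : ℝ) (d a c : Fin 3) : framePd e (fun y => ricciStress s t (jet e ω y) a c) d x
      = 2 * s * framePd e (fun y => ricci (jet e ω y) a c) d x
        + 2 * t * kron a c * framePd e (fun y => scalarCurv (jet e ω y)) d x := by
  have h1 := (SmoothLagr.ricci a c).differentiableAt_jet hc hU hx
  have h2 := SmoothLagr.scalarCurv.differentiableAt_jet hc hU hx
  have h3 (l : Fin 3) : pd l (fun y => ricciStress s t (jet e ω y) a c) x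
      = 2 * s * pd l (fun y => ricci (jet e ω y) a c) x
        + 2 * t * kron a c * pd l (fun y => scalarCurv (jet e ω y)) x := by
    unfold ricciStress
    rw [pd_add (h1.const_mul _) (h2.const_mul _), pd_mul (differentiableAt_const _) h1,
      pd_mul (differentiableAt_const _) h2]
    simp [pd_const]
  simp only [framePd, h3, Finset.mul_sum, ← Finset.sum_add_distrib]
  exact Finset.sum_congr rfl fun l _ => by ring

theorem covStress_eq (hU : IsOpen U) (hc : IsConfiguration U e ω) {x : Pt} (hx : x ∈ U)
    (s t : ℝ) (d a c : Fin 3) : covStress s t e ω x d a c = 2 * s * covRicci e ω x d a c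
      + 2 * t * kron a c * ∑ i, covRicci e ω x d i i := by
  have w (i j) := (hc.antisymm_jet hU hx).frameω d i j
  have h1 : covRicci e ω x d a c = framePd e (fun y => ricci (jet e ω y) a c) d x
      - ∑ l, (frameω (jet e ω x) d a l * ricci (jet e ω x) l c
        + frameω (jet e ω x) d c l * ricci (jet e ω x) a l) := by
    unfold covRicci frameω framePd
    change _ = _ - ∑ m, ((∑ μ, ω x μ a m * invE (e x) μ d) * ricci (jet e ω x) m c
        + (∑ μ, ω x μ c m * invE (e x) μ d) * ricci (jet e ω x) a m)
    simp only [Fin.sum_univ_three]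
    ring
  have h2 : ∑ l, (frameω (jet e ω x) d a l * kron l c + frameω (jet e ω x) d c l * kron a l)
      = 0 := by
    simp [kron, Finset.sum_add_distrib, w a c]
  rw [← framePd_scalarCurv hU hc hx, h1, covStress, framePd_ricciStress hU hc hx]
  unfold ricciStress
  have h3 : ∑ l, (frameω (jet e ω x) d a l * (2 * s * ricci (jet e ω x) l c
        + 2 * t * kron l c * scalarCurv (jet e ω x))
      + frameω (jet e ω x) d c l * (2 * s * ricci (jet e ω x) a l
        + 2 * t * kron a l * scalarCurv (jet e ω x)))
      = 2 * s * ∑ l, (frameω (jet e ω x) d a l * ricci (jet e ω x) l c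
        + frameω (jet e ω x) d c l * ricci (jet e ω x) a l)
      + 2 * t * scalarCurv (jet e ω x)
        * ∑ l, (frameω (jet e ω x) d a l * kron l c + frameω (jet e ω x) d c l * kron a l) := by
    rw [Finset.mul_sum, Finset.mul_sum, ← Finset.sum_add_distrib]
    exact Finset.sum_congr rfl fun l _ => by ring
  rw [h3, h2]
  ring

theorem mixedPart_smul (c : ℝ) (t : Fin 3 → Fin 3 → Fin 3 → ℝ) (i j k : Fin 3) :
    mixedPart (fun i j k => c * t i j k) i j k = c * mixedPart t i j k := by
  simp only [mixedPart, axialPart, tracePart, mul_assoc, ← Finset.mul_sum]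
  ring

theorem mixedPart_trace (v : Fin 3 → ℝ) (i j k : Fin 3) :
    mixedPart (fun i j k => kron i k * v j - kron j k * v i) i j k = 0 := by
  have h1 (j) : tracePart (fun i j k => kron i k * v j - kron j k * v i) j = 2 * v j := by
    fin_cases j <;> simp [tracePart, kron] <;> ring
  have h2 : axialPart (fun i j k => kron i k * v j - kron j k * v i) = 0 := by
    simp [axialPart, eps, kron, Fin.sum_univ_three]
  simp only [mixedPart, h1, h2]
  ring

theorem gammaRel_of_admitsDisclinations {p : Params} (hU : IsOpen U)
    (h : AdmitsDisclinations p U) : p.GammaRel := by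
  obtain ⟨e, ω, hc, hT, ⟨⟨x, hx, μ, h1⟩, ⟨y, hy, a, b, c, h2⟩⟩, hω⟩ := h
  obtain ⟨s, hs⟩ : ∃ s, s = p.γ₁ + p.γ₂ + p.γ₃ / 4 := ⟨_, rfl⟩
  obtain ⟨t, ht⟩ : ∃ t, t = -(p.γ₁ + p.γ₂) / 4 := ⟨_, rfl⟩
  have Z (x) (hx : x ∈ U) (m i j : Fin 3) :
      (kron m j * (∑ a, covStress s t e ω x a a i) - covStress s t e ω x j m i)
      - (kron m i * (∑ a, covStress s t e ω x a a j) - covStress s t e ω x i m j) = 0 := by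
    -- The variation with a single antisymmetric pair of frame components, which isolates one
    -- component of the field equation.
    have hB (n k l : Fin 3) : (fun n k l => kron n m * (kron k i * kron l j - kron k j * kron l i))
        n k l = -(fun n k l => kron n m * (kron k i * kron l j - kron k j * kron l i)) n l k := by
      simp only
      ring
    have hb := antisymm_ofFrame (e x) hB
    have h3 := (connectionEq_iff p hU hc).1 hω x hx _ hb
    rw [EL_lagrangian p hU hc _ hx, EL_einstein_connection _ hU hc hb hx,
      EL_torsionTerms_eq_zero hT hU hc _ _ _ _ hx, EL_cosmological_connection _ hU hc _ hx,
      EL_curvatureTerms hT hU hc _ _ _ hb hx, ← hs, ← ht, EL_ricciLagr hT hU hc s t hb hx] at h3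
    have h4 := hc.detE_ne_zero hx
    simp only [sum_ofFrame h4] at h3
    simp only [zero_add, add_zero, neg_eq_zero, mul_eq_zero, h4, false_or] at h3
    rw [← h3]
    simp [kron, mul_sub, sub_mul, Finset.sum_sub_distrib]
    simp only [eq_comm (a := j) (b := m), eq_comm (a := i) (b := m)]
    ring
  -- The divergence of S: the contracted Bianchi identity turns 2s ∇_a R_{ai} into s ∇_i R.
  have X (x) (hx : x ∈ U) (i : Fin 3) : ∑ a, covStress s t e ω x a a i
      = (s + 2 * t) * ∑ k, covRicci e ω x i k k := by
    have h3 := bianchi_contracted hT hU hc hx i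
    simp only [covStress_eq hU hc hx, Finset.sum_add_distrib, ← Finset.mul_sum]
    have h4 : ∑ a, 2 * t * kron a i * ∑ k, covRicci e ω x a k k
        = 2 * t * ∑ k, covRicci e ω x i k k := by simp [kron]
    rw [h4]
    linear_combination -s * h3
  have f1 : 3 * s + 8 * t = 0 := by
    have h3 (i : Fin 3) : (3 * s + 8 * t) * ∑ k, covRicci e ω x i k k = 0 := by
      -- The trace of the equation over m = j, where each term becomes a multiple of ∇_i R: 3(s +
      -- 2t) - 2(s + 2t) + (2s + 6t) = 3s + 8t.
      have h4 : ∑ m, ((kron m m * (∑ a, covStress s t e ω x a a i) - covStress s t e ω x m m i)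
          - (kron m i * (∑ a, covStress s t e ω x a a m) - covStress s t e ω x i m m)) = 0 :=
        Finset.sum_eq_zero fun m _ => Z x hx m i m
      simp only [Finset.sum_sub_distrib, X x hx] at h4
      have h5 : ∑ m, covStress s t e ω x i m m = (2 * s + 6 * t) * ∑ k, covRicci e ω x i k k := by
        simp only [covStress_eq hU hc hx, Finset.sum_add_distrib, ← Finset.mul_sum,
          ← Finset.sum_mul]
        simp [kron]
        ring
      rw [h5] at h4
      simp [kron] at h4
      linear_combination h4
    by_contra hne
    refine h1 ?_
    have h4 (i) : framePd e (fun y => scalarCurv (jet e ω y)) i x = 0 := by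
      rw [framePd_scalarCurv hU hc hx]
      exact (mul_eq_zero.1 (h3 i)).resolve_left hne
    calc pd μ (fun y => scalarCurv (jet e ω y)) x
        = ∑ l, kron μ l * pd l (fun y => scalarCurv (jet e ω y)) x := by simp [kron]
      _ = ∑ l, (∑ i, e x μ i * invE (e x) l i) * pd l (fun y => scalarCurv (jet e ω y)) x := by
          simp only [sum_mul_invE (hc.detE_ne_zero hx)]
      _ = ∑ i, e x μ i * framePd e (fun y => scalarCurv (jet e ω y)) i x := by
          simp only [framePd, Fin.sum_univ_three]
          ring
      _ = 0 := by simp [h4]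
  have f2 : s = 0 := by
    have h3 : 2 * s * cotton e ω y a b c = 0 := by
      unfold cotton
      -- The equation equates 2s (∇_i R_{jk} - ∇_j R_{ik}) with a pure trace built from (s + 4t) ∇R,
      -- whose mixed part vanishes.
      rw [← mixedPart_smul, ← mixedPart_trace (fun j => (s + 4 * t) * ∑ k, covRicci e ω y j k k)
        a b c]
      refine congrArg (fun f => mixedPart f a b c) ?_
      funext i j k
      have h4 := Z y hy k i j
      rw [X y hy, X y hy, covStress_eq hU hc hy, covStress_eq hU hc hy,
        covRicci_symm hT hU hc hy j k i, covRicci_symm hT hU hc hy i k j] at h4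
      have k1 (i j) : kron i j = kron j i := by simp [kron, eq_comm]
      rw [k1 k j, k1 k i] at h4
      linear_combination h4
    simpa [h2] using h3
  refine ⟨?_, ?_⟩ <;> linarith

theorem cosmological_eq_zero {p : Params} (hU : IsOpen U) (hne : U.Nonempty)
    (h : AdmitsDefectFree p U) : p.Λ = 0 := by
  obtain ⟨e, ω, hc, hR, hT, he, -⟩ := h
  obtain ⟨x, hx⟩ := hne
  -- The vielbein is varied along itself, that is, rescaled: only -3Λ e survives.
  have h1 := (vielbeinEq_iff p hU hc).1 he x hx (e x)
  have h0 := hc.detE_ne_zero hx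
  have hL (i k) : ricci (jet e ω x) i k = 0 := by simp [ricci, hR.curvatureL hx]
  rw [EL_lagrangian p hU hc _ hx, EL_einstein _ hU hc _ hx, EL_hilbert _ hU hc _ hx,
    EL_torsionTerms_eq_zero hT hU hc _ _ _ _ hx, EL_torsionTerms_eq_zero hT hU hc _ _ _ _ hx,
    EL_curvatureTerms_eq_zero hR hU hc _ _ _ _ hx, EL_cosmological _ hU hc _ hx] at h1
  rw [Finset.sum_comm] at h1
  simp only [sum_invE_mul h0, scalarCurv, hL] at h1
  simpa [h0, kron] using h1

end

section

variable {U : Set Pt} {e : Pt → Vielbein} {ω : Pt → Connection}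

/-! ### Reduction to the Einstein equations -/

theorem hilbert_add_cosmological_iff (κ Λ : ℝ) (hT : TorsionFree U e ω) (hU : IsOpen U)
    (hc : IsConfiguration U e ω) :
    (∀ x ∈ U, ∀ a : Vielbein, EL (lagrangian (Params.hilbert κ)) e ω (a, 0) x
      + EL (lagrangian (Params.cosmological Λ)) e ω (a, 0) x = 0) ↔ EinsteinEq κ Λ U e := by
  rw [einsteinEq_iff κ Λ hT hU hc]
  refine forall₂_congr fun x hx => ?_
  have h := hc.detE_ne_zero hx
  have key (a : Vielbein) : EL (lagrangian (Params.hilbert κ)) e ω (a, 0) x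
      + EL (lagrangian (Params.cosmological Λ)) e ω (a, 0) x
      = 2 * (detE (e x) * ∑ i, ∑ k, (∑ μ, invE (e x) μ i * a μ k)
        * (κ * (ricci (jet e ω x) k i - (1 / 2) * kron k i * scalarCurv (jet e ω x))
          - (Λ / 2) * kron k i)) := by
    rw [EL_hilbert κ hU hc a hx, EL_cosmological Λ hU hc a hx]
    simp [Fin.sum_univ_three, kron, -mul_eq_mul_left_iff]
    ring
  simp only [key]
  refine ⟨fun h1 m n => ?_, fun h1 a => by
    simp only [h1, mul_zero, Finset.sum_const_zero]⟩
  -- The variation whose only nonzero frame component is (n, m); it extracts one frame component of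
  -- the Einstein equations.
  have h2 := h1 (fun μ k => e x μ n * kron k m)
  have h3 (i k) : ∑ μ, invE (e x) μ i * (e x μ n * kron k m) = kron i n * kron k m := by
    rw [← sum_invE_mul h i n, Finset.sum_mul]
    exact Finset.sum_congr rfl fun μ _ => by ring
  simp only [h3, mul_eq_zero, h, false_or, two_ne_zero] at h2
  rw [← h2]
  simp [kron]

/-- The relations between the γ's mean s = t = 0, so the curvature squares have no Euler–Lagrange
expression at zero torsion, although they do not vanish identically as a Lagrangian. -/
theorem reduction_of_torsionFree {p : Params} (hp : p.GammaRel) (hU : IsOpen U)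
    (hc : IsConfiguration U e ω) (hT : TorsionFree U e ω) :
    ConnectionEq p U e ω ∧ (VielbeinEq p U e ω ↔ EinsteinEq p.κ p.Λ U e) := by
  have hγ (δ : Fld) (hδ : δ.Antisymm) (x) (hx : x ∈ U) :
      EL (lagrangian (Params.curvatureTerms p.γ₁ p.γ₂ p.γ₃)) e ω δ x = 0 := by
    rw [EL_curvatureTerms hT hU hc _ _ _ hδ hx, hp.1, hp.2]
    have h : ricciLagr (p.γ₁ + -p.γ₁ + 0 / 4) (-(p.γ₁ + -p.γ₁) / 4) = fun _ => 0 := by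
      funext J
      simp [ricciLagr]
    rw [h, EL_zero]
  refine ⟨(connectionEq_iff p hU hc).2 fun x hx b hb => ?_, ?_⟩
  · rw [EL_lagrangian p hU hc _ hx, EL_einstein_connection _ hU hc hb hx,
      EL_torsionTerms_eq_zero hT hU hc _ _ _ _ hx, EL_cosmological_connection _ hU hc _ hx,
      hγ _ hb x hx]
    simp
  · rw [vielbeinEq_iff p hU hc, ← hilbert_add_cosmological_iff _ _ hT hU hc]
    refine forall₂_congr fun x hx => forall_congr' fun a => ?_
    rw [EL_lagrangian p hU hc _ hx, EL_einstein _ hU hc _ hx,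
      EL_torsionTerms_eq_zero hT hU hc _ _ _ _ hx, EL_torsionTerms_eq_zero hT hU hc _ _ _ _ hx,
      hγ _ (fun _ _ _ => by simp) x hx]
    simp

/-- The given flat connection is exchanged for the torsion-free one, at which the distinguished part
reduces to the Hilbert variation; curvature-freeness is used, before the exchange, to drop the
curvature squares. -/
theorem reduction_of_curvatureFree {p : Params} (hp : p.BetaRel) (hU : IsOpen U)
    (hc : IsConfiguration U e ω) (hR : CurvatureFree U e ω) :
    ConnectionEq p U e ω ∧ (VielbeinEq p U e ω ↔ EinsteinEq p.κ p.Λ U e) := by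
  have hβ (δ : Fld) (x) : EL (lagrangian (Params.torsionTerms (p.β₁ + p.κ) (p.β₂ - 2 * p.κ)
      (p.β₃ - 4 * p.κ))) e ω δ x = 0 := by
    have h : lagrangian (Params.torsionTerms (p.β₁ + p.κ) (p.β₂ - 2 * p.κ) (p.β₃ - 4 * p.κ))
        = fun _ => 0 := by
      funext J
      simp [lagrangian_torsionTerms, hp.1, hp.2.1, hp.2.2]
    rw [h, EL_zero]
  have hc' := hc.lcConnection hU
  have hT' := torsionFree_lcConnection hc
  refine ⟨(connectionEq_iff p hU hc).2 fun x hx b hb => ?_, ?_⟩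
  · rw [EL_lagrangian p hU hc _ hx, EL_einstein_connection _ hU hc hb hx, hβ,
      EL_curvatureTerms_eq_zero hR hU hc _ _ _ _ hx, EL_cosmological_connection _ hU hc _ hx]
    simp
  · rw [vielbeinEq_iff p hU hc, ← hilbert_add_cosmological_iff _ _ hT' hU hc']
    refine forall₂_congr fun x hx => forall_congr' fun a => ?_
    rw [EL_lagrangian p hU hc _ hx, hβ, EL_curvatureTerms_eq_zero hR hU hc _ _ _ _ hx,
      EL_einstein_vielbein _ hU hc hc' _ hx, EL_einstein _ hU hc' _ hx,
      EL_torsionTerms_eq_zero hT' hU hc' _ _ _ _ hx, EL_cosmological _ hU hc _ hx,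
      EL_cosmological _ hU hc' _ hx]
    simp

/-! ### The free energy density -/

/-- The vector density e T^μ is the vector of `divVec` plus a term that depends on the vielbein
only, so the latter cancels when two connections are compared. -/
theorem torsionDensity_eq (hc : IsConfiguration U e ω) {y : Pt} (hy : y ∈ U) (μ : Fin 3) :
    torsionDensity e ω μ y = detE (e y) * (∑ j, invE (e y) μ j
      * ∑ i, (frameDE (jet e 0 y) i j i - frameDE (jet e 0 y) j i i)) + divVec μ (e y, ω y) := by
  have h := hc.detE_ne_zero hy
  have w (i j) := eq_zero_of_antisymm (f := fun k l => ω y i k l) (hc.antisymm y hy i) j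
  have h1 (j : Fin 3) : tracePart (torsionL (jet e ω y)) j
      = ∑ i, (frameDE (jet e 0 y) i j i - frameDE (jet e 0 y) j i i)
        + ∑ i, frameω (jet e ω y) i j i := by
    have h2 (i) : frameω (jet e ω y) j i i = 0 := by
      simp only [frameω]
      exact Finset.sum_eq_zero fun ν _ => by
        change ω y ν i i * _ = 0
        rw [w, zero_mul]
    simp only [tracePart, torsionL_eq (J := jet e ω y) h, h2, sub_zero,
      ← Finset.sum_add_distrib]
    rfl
  simp only [torsionDensity, h1, mul_add, Finset.sum_add_distrib, divVec]
  congr 2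
  unfold frameω
  change ∑ j, invE (e y) μ j * ∑ i, ∑ ν, ω y ν j i * invE (e y) ν i = _
  simp only [Fin.sum_univ_three]
  ring

/-- The decomposition `lagrangian_einstein` is applied to ω and to the torsion-free connection and
subtracted. The parts without ω are equal, the torsion-free value is -κ e R̃, and the two
divergences differ by that of e T^μ, since T = 0 for the second connection. -/
theorem lagrangian_eq_divergence {p : Params} (hβ : p.BetaRel) (hγ : p.GammaRel) (hΛ : p.Λ = 0)
    (hU : IsOpen U) (hc : IsConfiguration U e ω) {x : Pt} (hx : x ∈ U) :
    lagrangian p (jet e ω x) = detE (e x) * (-p.κ * scalarLC e x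
      + 2 * p.γ₁ * ∑ i, ∑ j, ricciA (jet e ω x) i j ^ 2)
      - 2 * p.κ * ∑ μ, pd μ (torsionDensity e ω μ) x := by
  have h := hc.detE_ne_zero hx
  have hc' := hc.lcConnection hU
  have hT' := torsionFree_lcConnection hc
  have hJ := hc.antisymm_jet hU hx
  have hJ' := hc'.antisymm_jet hU hx
  have hd {ω : Pt → Connection} (hc : IsConfiguration U e ω) (μ) :
      DifferentiableAt ℝ (fun y => divVec μ (e y, ω y)) x :=
    (ContDiffAt.comp (g := divVec μ) x (contDiffAt_divVec μ (e x, ω x) h) (hc.contDiffAt_fld hU hx)).differentiableAt (by simp)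
  have h1 (μ : Fin 3) : pd μ (torsionDensity e ω μ) x
      = fderiv ℝ (divVec μ) (e x, ω x) ((jetMap e ω x).2 μ)
        - fderiv ℝ (divVec μ) (e x, lcConnection e x) ((jetMap e (lcConnection e) x).2 μ) := by
    rw [pd_congr hU (g := fun y => divVec μ (e y, ω y) - divVec μ (e y, lcConnection e y))
      (fun y hy => ?_) hx, pd_sub (hd hc μ) (hd hc' μ),
      pd_comp_fld hU hc hx ((contDiffAt_divVec μ (e x, ω x) h).differentiableAt (by simp)),
      pd_comp_fld hU hc' hx
        ((contDiffAt_divVec μ (e x, lcConnection e x) h).differentiableAt (by simp))]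
    have h2 : torsionDensity e (lcConnection e) μ y = 0 := by
      simp [torsionDensity, tracePart, hT'.torsionL hy]
    rw [torsionDensity_eq hc' hy] at h2
    rw [torsionDensity_eq hc hy]
    linarith
  have h3 : ∑ μ, pd μ (torsionDensity e ω μ) x
      = divTerm (jet e ω x) - divTerm (jet e (lcConnection e) x) := by
    rw [← divLagr_divVec (jet e ω x) h, ← divLagr_divVec (jet e (lcConnection e) x) h]
    simp only [h1, Finset.sum_sub_distrib]
    rfl
  have h4 : lagrangian (Params.einstein p.κ) (jet e (lcConnection e) x)
      = -p.κ * (detE (e x) * scalarLC e x) := by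
    rw [lagrangian_einstein_eq, lagrangian_hilbert, lagrangian_torsionTerms,
      scalarLC_eq hT' hU hc' hx]
    simp only [hT'.torsionL hx, zero_mul, Finset.sum_const_zero, mul_zero, add_zero]
    rfl
  have h5 := lagrangian_einstein p.κ (J := jet e ω x) h hJ
  have h6 := lagrangian_einstein p.κ (J := jet e (lcConnection e) x) h hJ'
  have h7 : (jet e ω x).dropω = (jet e (lcConnection e) x).dropω := rfl
  have h8 : lagrangian (Params.torsionTerms (p.β₁ + p.κ) (p.β₂ - 2 * p.κ) (p.β₃ - 4 * p.κ))
      (jet e ω x) = 0 := by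
    simp [lagrangian_torsionTerms, hβ.1, hβ.2.1, hβ.2.2]
  have h9 : (jet e ω x).e = e x := rfl
  rw [lagrangian_eq, h8, hγ.1, hγ.2, hJ.sum_ricciA_sq, lagrangian_cosmological, hΛ, h3, h5, h7,
    h9]
  rw [h6] at h4
  linear_combination h4

end

section

/-! ### Existence of the configurations -/

theorem pd_comp_linear {f : ℝ → ℝ} {f' : ℝ} (ℓ : Pt →L[ℝ] ℝ) {x : Pt} (hf : HasDerivAt f f' (ℓ x))
    (μ : Fin 3) : pd μ (fun y => f (ℓ y)) x = f' * ℓ (Pi.single μ 1) := by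
  have h := hf.comp_hasFDerivAt x ℓ.hasFDerivAt
  change fderiv ℝ (f ∘ ℓ) x _ = _
  rw [h.fderiv]
  simp

theorem invE_eq {e v : Vielbein} (h : ∀ i j, ∑ μ, v μ i * e μ j = kron i j) (μ i : Fin 3) :
    invE e μ i = v μ i := by
  have h1 : (Matrix.of v).transpose * Matrix.of e = 1 := by
    ext i j
    simpa [Matrix.mul_apply, Matrix.one_apply, kron] using h i j
  rw [invE, Matrix.inv_eq_left_inv h1]
  rfl

theorem einsteinEq_of_metric {κ : ℝ} {U : Set Pt} {e : Pt → Vielbein}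
    (h : ∀ y μ ν, metric e y μ ν = kron μ ν) : EinsteinEq κ 0 U e := by
  have h1 : christoffel e = 0 := by
    funext y μ ν ρ
    simp [christoffel, h, pd_const]
  have h2 : riemann e = 0 := by
    funext y μ ν ρ σ
    simp [riemann, h1, pd_const]
  intro x _ μ ν
  simp [scalarLC, ricciLC, h2]

theorem curvatureFree_zero (U : Set Pt) (e : Pt → Vielbein) : CurvatureFree U e 0 := by
  intro x _ μ ν j i
  simp [curvature, jet, pd_const]

theorem detE_of_matrix (a b c d e f g h i : ℝ) :
    detE ![![a, b, c], ![d, e, f], ![g, h, i]] =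
      a * e * i - a * f * h - b * d * i + b * f * g + c * d * h - c * e * g := by
  simp [detE, Matrix.det_fin_three]

/-- A frame rotating about the third axis, with the angle given by `ℓ`. -/
def rotatingFrame (ℓ : Pt →L[ℝ] ℝ) (p x : Pt) : Vielbein :=
  ![![Real.cos (ℓ x - ℓ p), -Real.sin (ℓ x - ℓ p), 0],
    ![Real.sin (ℓ x - ℓ p), Real.cos (ℓ x - ℓ p), 0], ![0, 0, 1]]

theorem isConfiguration_rotatingFrame (ℓ : Pt →L[ℝ] ℝ) (p : Pt) (U : Set Pt) :
    IsConfiguration U (rotatingFrame ℓ p) 0 := by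
  refine ⟨fun μ i => ContDiff.contDiffOn ?_, fun _ _ _ => contDiffOn_const, fun x _ => ?_,
    fun _ _ _ _ _ => by simp⟩
  · have h : ContDiff ℝ ∞ fun x => ℓ x - ℓ p := ℓ.contDiff.sub contDiff_const
    fin_cases μ <;> fin_cases i <;> simp only [rotatingFrame] <;>
      first
        | exact contDiff_const
        | exact Real.contDiff_cos.comp h
        | exact Real.contDiff_sin.comp h
        | exact (Real.contDiff_sin.comp h).neg
  · change detE (rotatingFrame ℓ p x) ≠ 0
    rw [rotatingFrame, detE_of_matrix]
    have := Real.sin_sq_add_cos_sq (ℓ x - ℓ p)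
    nlinarith

theorem metric_rotatingFrame (ℓ : Pt →L[ℝ] ℝ) (p x : Pt) (μ ν : Fin 3) :
    metric (rotatingFrame ℓ p) x μ ν = kron μ ν := by
  have := Real.sin_sq_add_cos_sq (ℓ x - ℓ p)
  fin_cases μ <;> fin_cases ν <;>
    simp [metric, rotatingFrame, Fin.sum_univ_three, kron] <;> linarith

/-- At `p` the frame is the identity, so the torsion there is the antisymmetrized product of the
gradient of the angle with the generator of the rotation. -/
theorem torsionL_rotatingFrame (ℓ : Pt →L[ℝ] ℝ) (p : Pt) (i j k : Fin 3) :
    torsionL (jet (rotatingFrame ℓ p) 0 p) i j k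
      = (kron j 1 * kron k 0 - kron j 0 * kron k 1) * ℓ (Pi.single i 1)
        - (kron i 1 * kron k 0 - kron i 0 * kron k 1) * ℓ (Pi.single j 1) := by
  have h0 (μ i : Fin 3) : rotatingFrame ℓ p p μ i = kron μ i := by
    fin_cases μ <;> fin_cases i <;> simp [rotatingFrame, kron]
  have hv (μ i : Fin 3) : invE (rotatingFrame ℓ p p) μ i = kron μ i := by
    refine invE_eq (v := fun μ i => kron μ i) (fun i j => ?_) μ i
    simp only [h0]
    simp [kron, eq_comm]
  have hs : HasDerivAt (fun r => Real.sin (r - ℓ p)) 1 (ℓ p) := by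
    simpa using ((hasDerivAt_id (ℓ p)).sub_const (ℓ p)).sin
  have hc : HasDerivAt (fun r => Real.cos (r - ℓ p)) 0 (ℓ p) := by
    simpa using ((hasDerivAt_id (ℓ p)).sub_const (ℓ p)).cos
  have hd (ν μ i : Fin 3) : pd ν (fun y => rotatingFrame ℓ p y μ i) p
      = (kron μ 1 * kron i 0 - kron μ 0 * kron i 1) * ℓ (Pi.single ν 1) := by
    have h1 := pd_comp_linear ℓ hs ν
    have h2 := pd_comp_linear ℓ hc ν
    have h3 := pd_comp_linear ℓ hs.neg ν
    simp only [Pi.neg_apply] at h3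
    fin_cases μ <;> fin_cases i <;> simp [rotatingFrame, kron, pd_const, h1, h2, h3]
  have ht (μ ν k : Fin 3) : torsion (jet (rotatingFrame ℓ p) 0 p) μ ν k
      = (kron ν 1 * kron k 0 - kron ν 0 * kron k 1) * ℓ (Pi.single μ 1)
        - (kron μ 1 * kron k 0 - kron μ 0 * kron k 1) * ℓ (Pi.single ν 1) := by
    simp [torsion, jet, hd]
  have he : (jet (rotatingFrame ℓ p) 0 p).e = rotatingFrame ℓ p p := rfl
  simp only [torsionL, he, hv, ht]
  rw [Finset.sum_eq_single i, Finset.sum_eq_single j]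
  · simp [kron]
  · intro b _ hb
    simp [kron, hb]
  · simp
  · intro b _ hb
    simp [kron, hb]
  · simp

theorem admitsDislocations {p : Params} (hβ : p.BetaRel) (hΛ : p.Λ = 0) {U : Set Pt}
    (hU : IsOpen U) (hne : U.Nonempty) : AdmitsDislocations p U := by
  obtain ⟨q, hq⟩ := hne
  -- The angle varies both across the axis of rotation and along it: the coordinate `x 0` produces
  -- the trace, `x 2` the axial part and the mixed component used below.
  obtain ⟨ℓ, hℓ⟩ : ∃ ℓ : Pt →L[ℝ] ℝ, ∀ x, ℓ x = x 0 + x 2 :=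
    ⟨ContinuousLinearMap.proj (R := ℝ) (φ := fun _ : Fin 3 => ℝ) 0
      + ContinuousLinearMap.proj (R := ℝ) (φ := fun _ : Fin 3 => ℝ) 2, fun _ => rfl⟩
  have l0 : ℓ (Pi.single 0 1) = 1 := by simp [hℓ]
  have l1 : ℓ (Pi.single 1 1) = 0 := by simp [hℓ]
  have l2 : ℓ (Pi.single 2 1) = 1 := by simp [hℓ]
  have hc := isConfiguration_rotatingFrame ℓ q U
  have hR := curvatureFree_zero U (rotatingFrame ℓ q)
  have h1 := reduction_of_curvatureFree hβ hU hc hR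
  refine ⟨rotatingFrame ℓ q, 0, hc, hR, ⟨⟨q, hq, 1, ?_⟩, ⟨q, hq, ?_⟩, ⟨q, hq, 1, 2, 0, ?_⟩⟩,
    h1.2.2 ?_, h1.1⟩
  · simp [tracePart, torsionL_rotatingFrame, kron, l0, l1]
  · simp [axialPart, torsionL_rotatingFrame, Fin.sum_univ_three, kron, eps, l0, l1, l2]
    norm_num
  · simp [mixedPart, tracePart, axialPart, torsionL_rotatingFrame, Fin.sum_univ_three, kron, eps,
      l0, l1, l2]
    norm_num
  · rw [hΛ]
    exact einsteinEq_of_metric (metric_rotatingFrame ℓ q)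

theorem admitsDefectFree {p : Params} (hβ : p.BetaRel) (hΛ : p.Λ = 0) {U : Set Pt}
    (hU : IsOpen U) : AdmitsDefectFree p U := by
  have hc := isConfiguration_rotatingFrame 0 0 U
  have hR := curvatureFree_zero U (rotatingFrame 0 0)
  have h1 := reduction_of_curvatureFree hβ hU hc hR
  refine ⟨rotatingFrame 0 0, 0, hc, hR, fun x _ μ ν i => ?_, h1.2.2 ?_, h1.1⟩
  · simp [torsion, jet, pd_const, rotatingFrame]
  · rw [hΛ]
    exact einsteinEq_of_metric (metric_rotatingFrame 0 0)

/-! ### Disclinations of general type: a warped metric -/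

/-- The frame `dx, dy, g dz` with `g = 1 + (x - c)²`. -/
def warpedFrame (c : ℝ) (x : Pt) : Vielbein :=
  ![![1, 0, 0], ![0, 1, 0], ![0, 0, 1 + (x 0 - c) ^ 2]]

/-- The torsion-free connection of `warpedFrame`. -/
def warpedConnection (c : ℝ) (x : Pt) : Connection :=
  ![0, 0, ![![0, 0, 2 * (x 0 - c)], 0, ![-(2 * (x 0 - c)), 0, 0]]]

theorem pd_warp (c : ℝ) (μ : Fin 3) (x : Pt) :
    pd μ (fun y => 1 + (y 0 - c) ^ 2) x = 2 * (x 0 - c) * kron μ 0 := by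
  have h : HasDerivAt (fun r : ℝ => 1 + (r - c) ^ 2) (2 * (x 0 - c)) (x 0) := by
    simpa using (((hasDerivAt_id (x 0)).sub_const c).pow 2).const_add 1
  refine (pd_comp_linear (f := fun r => 1 + (r - c) ^ 2) (x := x) (ContinuousLinearMap.proj 0) h μ).trans ?_
  simp [kron, Pi.single_apply, eq_comm]

theorem pd_warp_deriv (c : ℝ) (μ : Fin 3) (x : Pt) :
    pd μ (fun y => 2 * (y 0 - c)) x = 2 * kron μ 0 := by
  have h : HasDerivAt (fun r : ℝ => 2 * (r - c)) 2 (x 0) := by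
    simpa using ((hasDerivAt_id (x 0)).sub_const c).const_mul 2
  refine (pd_comp_linear (f := fun r => 2 * (r - c)) (x := x) (ContinuousLinearMap.proj 0) h μ).trans ?_
  simp [kron, Pi.single_apply, eq_comm]

theorem pd_warp_inv (c : ℝ) (μ : Fin 3) (x : Pt) :
    pd μ (fun y => 2 / (1 + (y 0 - c) ^ 2)) x
      = -(2 * (2 * (x 0 - c))) / (1 + (x 0 - c) ^ 2) ^ 2 * kron μ 0 := by
  have h : HasDerivAt (fun r : ℝ => 1 + (r - c) ^ 2) (2 * (x 0 - c)) (x 0) := by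
    simpa using (((hasDerivAt_id (x 0)).sub_const c).pow 2).const_add 1
  have h1 : HasDerivAt (fun r : ℝ => 2 / (1 + (r - c) ^ 2))
      (-(2 * (2 * (x 0 - c))) / (1 + (x 0 - c) ^ 2) ^ 2) (x 0) := by
    simpa using (hasDerivAt_const (x 0) (2 : ℝ)).fun_div h (by positivity)
  refine (pd_comp_linear (f := fun r => 2 / (1 + (r - c) ^ 2)) (x := x) (ContinuousLinearMap.proj 0) h1 μ).trans ?_
  simp [kron, Pi.single_apply, eq_comm]

theorem isConfiguration_warped (c : ℝ) (U : Set Pt) :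
    IsConfiguration U (warpedFrame c) (warpedConnection c) := by
  refine ⟨fun μ i => ContDiff.contDiffOn ?_, fun μ i j => ContDiff.contDiffOn ?_, fun x _ => ?_,
    fun x _ μ i j => ?_⟩
  · fin_cases μ <;> fin_cases i <;> simp [warpedFrame] <;> fun_prop
  · fin_cases μ <;> fin_cases i <;> fin_cases j <;> simp [warpedConnection] <;> fun_prop
  · change detE (warpedFrame c x) ≠ 0
    rw [warpedFrame, detE_of_matrix]
    have : 0 < 1 + (x 0 - c) ^ 2 := by positivity
    simpa using this.ne'
  · fin_cases μ <;> fin_cases i <;> fin_cases j <;> simp [warpedConnection]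

theorem invE_warpedFrame (c : ℝ) (x : Pt) (μ i : Fin 3) : invE (warpedFrame c x) μ i
    = (![![1, 0, 0], ![0, 1, 0], ![0, 0, (1 + (x 0 - c) ^ 2)⁻¹]] : Vielbein) μ i := by
  have : 1 + (x 0 - c) ^ 2 ≠ 0 := by positivity
  refine invE_eq (fun i j => ?_) μ i
  fin_cases i <;> fin_cases j <;> simp [warpedFrame, Fin.sum_univ_three, kron, this]

theorem pd_warpedFrame (c : ℝ) (ν μ i : Fin 3) (x : Pt) :
    pd ν (fun y => warpedFrame c y μ i) x
      = kron μ 2 * kron i 2 * (2 * (x 0 - c) * kron ν 0) := by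
  rw [← pd_warp]
  fin_cases μ <;> fin_cases i <;> simp [warpedFrame, kron, pd_const]

theorem pd_warpedConnection (c : ℝ) (ν μ i j : Fin 3) (x : Pt) :
    pd ν (fun y => warpedConnection c y μ i j) x
      = kron μ 2 * (kron i 0 * kron j 2 - kron i 2 * kron j 0) * (2 * kron ν 0) := by
  rw [← pd_warp_deriv c ν x]
  fin_cases μ <;> fin_cases i <;> fin_cases j <;>
    simp [warpedConnection, kron, pd_const, pd_neg]

theorem torsionFree_warped (c : ℝ) (U : Set Pt) :
    TorsionFree U (warpedFrame c) (warpedConnection c) := by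
  intro x _ μ ν i
  simp only [torsion, jet, pd_warpedFrame]
  fin_cases μ <;> fin_cases ν <;> fin_cases i <;>
    simp [warpedFrame, warpedConnection, Fin.sum_univ_three, kron]

theorem curvature_warped (c : ℝ) (x : Pt) (μ ν j i : Fin 3) :
    curvature (jet (warpedFrame c) (warpedConnection c) x) μ ν j i
      = 2 * (kron μ 0 * kron ν 2 - kron μ 2 * kron ν 0)
        * (kron j 0 * kron i 2 - kron j 2 * kron i 0) := by
  simp only [curvature, jet, pd_warpedConnection]
  fin_cases μ <;> fin_cases ν <;> fin_cases j <;> fin_cases i <;>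
    simp [warpedConnection, Fin.sum_univ_three, kron]

theorem ricci_warped (c : ℝ) (x : Pt) (i k : Fin 3) :
    ricci (jet (warpedFrame c) (warpedConnection c) x) i k
      = 2 / (1 + (x 0 - c) ^ 2) * (kron i 0 * kron k 0 + kron i 2 * kron k 2) := by
  simp only [ricci, curvatureL_jet, curvature_warped, invE_warpedFrame]
  fin_cases i <;> fin_cases k <;> simp [Fin.sum_univ_three, kron, div_eq_mul_inv]

theorem scalarCurv_warped (c : ℝ) (x : Pt) :
    scalarCurv (jet (warpedFrame c) (warpedConnection c) x)
      = 2 / (1 + (x 0 - c) ^ 2) * 2 := by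
  simp only [scalarCurv, ricci_warped]
  simp [Fin.sum_univ_three, kron]
  ring

theorem differentiable_warp_inv (c : ℝ) (x : Pt) :
    DifferentiableAt ℝ (fun y : Pt => 2 / (1 + (y 0 - c) ^ 2)) x := by
  have : 1 + (x 0 - c) ^ 2 ≠ 0 := by positivity
  fun_prop (disch := assumption)

/-- The Ricci tensor is 2/g times the projector onto the (0, 2) plane. The connection rotates only
within this plane, so the projector is parallel and the derivative of 2/g remains; at g = g' = 2 it
equals -1. -/
theorem covRicci_warped {c : ℝ} {x : Pt} (hx : x 0 - c = 1) (d i j : Fin 3) :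
    covRicci (warpedFrame c) (warpedConnection c) x d i j
      = -(kron d 0 * (kron i 0 * kron j 0 + kron i 2 * kron j 2)) := by
  have h (μ : Fin 3) : pd μ (fun y => ricci (jet (warpedFrame c) (warpedConnection c) y) i j) x
      = -kron μ 0 * (kron i 0 * kron j 0 + kron i 2 * kron j 2) := by
    simp only [ricci_warped]
    rw [pd_mul (differentiable_warp_inv c x) (differentiableAt_const _), pd_const, pd_warp_inv, hx]
    norm_num
  simp only [covRicci, h]
  simp only [ricci_warped, invE_warpedFrame, hx]
  fin_cases d <;> fin_cases i <;> fin_cases j <;>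
    simp [warpedConnection, Fin.sum_univ_three, kron]

theorem admitsDisclinations {p : Params} (hγ : p.GammaRel) {U : Set Pt} (hU : IsOpen U)
    (hne : U.Nonempty) : AdmitsDisclinations p U := by
  obtain ⟨q, hq⟩ := hne
  -- The minimum of g is placed at distance 1 from `q`; on the plane of the minimum the curvature
  -- gradient would vanish.
  have h1 : q 0 - (q 0 - 1) = 1 := by ring
  have hc := isConfiguration_warped (q 0 - 1) U
  have hT := torsionFree_warped (q 0 - 1) U
  refine ⟨_, _, hc, hT, ⟨⟨q, hq, 0, ?_⟩, ⟨q, hq, 0, 1, 1, ?_⟩⟩,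
    (reduction_of_torsionFree hγ hU hc hT).1⟩
  · simp only [scalarCurv_warped]
    rw [pd_mul (differentiable_warp_inv _ q) (differentiableAt_const _), pd_const, pd_warp_inv, h1]
    norm_num [kron]
  · simp only [cotton, covRicci_warped h1]
    simp [mixedPart, tracePart, axialPart, Fin.sum_univ_three, kron, eps]

end

end RiemannCartan

end

theorem mainTheorem1 (p : RiemannCartan.Params) (U : Set RiemannCartan.Pt)
    (hU : IsOpen U) (hne : U.Nonempty) :
    -- what each requirement forces
    (RiemannCartan.AdmitsDislocations p U → p.BetaRel) ∧
    (RiemannCartan.AdmitsDisclinations p U → p.GammaRel) ∧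
    (RiemannCartan.AdmitsDefectFree p U → p.Λ = 0) ∧
    -- the remaining two-parameter family meets all the requirements
    (p.BetaRel → p.GammaRel → p.Λ = 0 →
      RiemannCartan.AdmitsDislocations p U ∧ RiemannCartan.AdmitsDisclinations p U ∧
        RiemannCartan.AdmitsDefectFree p U) ∧
    -- its free energy density, up to an explicit total divergence
    (p.BetaRel → p.GammaRel → p.Λ = 0 →
      ∀ e ω, RiemannCartan.IsConfiguration U e ω → ∀ x ∈ U,
        RiemannCartan.lagrangian p (RiemannCartan.jet e ω x) =
          RiemannCartan.detE (e x) *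
            (-p.κ * RiemannCartan.scalarLC e x
              + 2 * p.γ₁ * ∑ i, ∑ j, RiemannCartan.ricciA (RiemannCartan.jet e ω x) i j ^ 2)
          - 2 * p.κ * ∑ μ, RiemannCartan.pd μ (RiemannCartan.torsionDensity e ω μ) x) ∧
    -- reduction to the Einstein equations for zero curvature
    (p.BetaRel → ∀ e ω, RiemannCartan.IsConfiguration U e ω →
      RiemannCartan.CurvatureFree U e ω →
        RiemannCartan.ConnectionEq p U e ω ∧
        (RiemannCartan.VielbeinEq p U e ω ↔ RiemannCartan.EinsteinEq p.κ p.Λ U e)) ∧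
    -- reduction to the Einstein equations for zero torsion
    (p.GammaRel → ∀ e ω, RiemannCartan.IsConfiguration U e ω →
      RiemannCartan.TorsionFree U e ω →
        RiemannCartan.ConnectionEq p U e ω ∧
        (RiemannCartan.VielbeinEq p U e ω ↔ RiemannCartan.EinsteinEq p.κ p.Λ U e)) := by
  exact ⟨RiemannCartan.betaRel_of_admitsDislocations hU,
    RiemannCartan.gammaRel_of_admitsDisclinations hU,
    RiemannCartan.cosmological_eq_zero hU hne,
    fun hβ hγ hΛ => ⟨RiemannCartan.admitsDislocations hβ hΛ hU hne,
      RiemannCartan.admitsDisclinations hγ hU hne, RiemannCartan.admitsDefectFree hβ hΛ hU⟩,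
    fun hβ hγ hΛ _ _ hc _ hx => RiemannCartan.lagrangian_eq_divergence hβ hγ hΛ hU hc hx,
    fun hβ _ _ hc hR => RiemannCartan.reduction_of_curvatureFree hβ hU hc hR,
    fun hγ _ _ hc hT => RiemannCartan.reduction_of_torsionFree hγ hU hc hT⟩
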